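/- Let $d\ge 2$ be an integer, let $dU$ be the normalized Haar measure on the group $\mathrm U(d)$ of unitary $d\times d$ matrices, and let all systems be finite-dimensional. For a family $(\mathcal C_U)_{U\in\mathrm U(d)}$ of channels on $\mathbb C^d\otimes\mathbb C^d$, the average global fidelity with $U\otimes U$ is $$F=\int dU\,\frac1{d^4}\operatorname{Tr}\bigl[C_U\,|U\otimes U\rangle\langle U\otimes U|\bigr],$$ where $C_U$ is the Choi operator of $\mathcal C_U$ and $|A\rangle=\sum_{i,j}A_{ij}|i\rangle|j\rangle$. A (one-to-two) learning scheme consists of a fixed state $\sigma$ on $\mathbb C^d\otimes\mathbb C^k$ ($k$ arbitrary) and a fixed channel $\Lambda$; with $\sigma_U=(U\otimes I)\sigma(U^\dagger\otimes I)$ it realizes the channels $\mathcal L_U(\rho)=\Lambda(\rho\otimes\sigma_U)$. It is of interaction type if $\mathcal L_U(\rho)=\operatorname{Tr}_P[W(\rho\otimes\sigma_U)W^\dagger]$, where $P=\mathbb C^d\otimes\mathbb C^k$ and $W$ is unitary. A measure-and-prepare scheme performs a fixed measurement (POVM) on $\sigma_U$ and then, on the two input systems, a channel depending (measurably) on the outcome;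 it is an estimation scheme if the outcome is an estimate $V\in\mathrm U(d)$ and the channel is $\rho\mapsto(V\otimes V)\rho(V\otimes V)^\dagger$. A (one-to-two) cloning network realizes $\mathcal C_U=\mathcal B\circ(\mathcal U\otimes\mathcal I_M)\circ\mathcal A$ with a quantum memory $M$ of arbitrary dimension and fixed channels $\mathcal A,\mathcal B$, where $\mathcal U(\rho)=U\rho U^\dagger$. Then: 1. The maximum of $F$ over all learning schemes exists and equals $$F_{\rm learn}=\begin{cases}6/d^4,& d>2,\\ 5/d^4,& d=2.\end{cases}$$ The same value is the maximum of $F$ over the learning schemes of interaction type. 2. $F_{\rm learn}$ is also the maximum of $F$ over all measure-and-prepare schemes, and it is the maximum of $F$ over the estimation schemes. 3. The maximum of $F$ over all cloning networks is $F_{\rm clon}=(d+\sqrt{d^2-1})/d^3$, and every learning scheme has $F<F_{\rm clon}$. In particular, $F<F_{\rm clon}$ for every scheme that applies $U$ to half of a maximally entangled state, clones the resulting state $\frac1d|U\rangle\langle U|$ by a fixed channel, and uses the two clones to program a channel on the two input systems through another fixed channel. -/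

import Mathlib

open scoped Matrix Kronecker ComplexOrder
open MeasureTheory

namespace QuantumLearning

noncomputable section

/-! ### Channels, states, partial trace -/

/-- The ampliation `Φ ⊗ id_k` of a linear map `Φ` between matrix algebras. -/
def ampliate {m n : Type} (Φ : Matrix n n ℂ →ₗ[ℂ] Matrix m m ℂ) (k : ℕ)
    (X : Matrix (n × Fin k) (n × Fin k) ℂ) : Matrix (m × Fin k) (m × Fin k) ℂ :=
  Matrix.of fun p q => Φ (Matrix.of fun i j => X (i, p.2) (j, q.2)) p.1 q.1

/-- Quantum channels: completely positive and trace-preserving linear maps. -/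
structure IsChannel {m n : Type} [Fintype m] [Fintype n]
    (Φ : Matrix n n ℂ →ₗ[ℂ] Matrix m m ℂ) : Prop where
  completelyPositive : ∀ (k : ℕ) (X : Matrix (n × Fin k) (n × Fin k) ℂ),
    X.PosSemidef → (ampliate Φ k X).PosSemidef
  tracePreserving : ∀ X : Matrix n n ℂ, (Φ X).trace = X.trace

/-- A density matrix: a positive semidefinite matrix of unit trace. -/
structure DensityMatrix (n : Type) [Fintype n] where
  mat : Matrix n n ℂ
  posSemidef : mat.PosSemidef
  trace_eq_one : mat.trace = 1

/-- The partial trace over the second tensor factor. -/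
def traceSnd {m n : Type} [Fintype n] (X : Matrix (m × n) (m × n) ℂ) : Matrix m m ℂ :=
  Matrix.of fun i j => ∑ a, X (i, a) (j, a)

/-- The group `U(d)` of unitary `d × d` matrices. -/
abbrev Gate (d : ℕ) : Type := Matrix.unitaryGroup (Fin d) ℂ

/-- Conjugation by `U ⊗ I`, i.e. a single use of the gate `U` on the first tensor factor. -/
def applyGate {d : ℕ} {a : Type} [Fintype a] [DecidableEq a] (U : Gate d)
    (X : Matrix (Fin d × a) (Fin d × a) ℂ) : Matrix (Fin d × a) (Fin d × a) ℂ :=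
  ((U : Matrix (Fin d) (Fin d) ℂ) ⊗ₖ (1 : Matrix a a ℂ)) * X *
    ((U : Matrix (Fin d) (Fin d) ℂ) ⊗ₖ (1 : Matrix a a ℂ))ᴴ

theorem trace_applyGate {d : ℕ} {a : Type} [Fintype a] [DecidableEq a] (U : Gate d)
    (X : Matrix (Fin d × a) (Fin d × a) ℂ) : (applyGate U X).trace = X.trace := by
  have hU : (U : Matrix (Fin d) (Fin d) ℂ)ᴴ * (U : Matrix (Fin d) (Fin d) ℂ) = 1 :=
    Matrix.mem_unitaryGroup_iff'.mp U.2
  rw [applyGate, Matrix.trace_mul_comm, ← Matrix.mul_assoc, Matrix.conjTranspose_kronecker,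
    ← Matrix.mul_kronecker_mul, hU]
  simp

/-- The state `σ_U = (U ⊗ I) σ (U† ⊗ I)`. -/
def DensityMatrix.evolve {d : ℕ} {a : Type} [Fintype a] [DecidableEq a]
    (σ : DensityMatrix (Fin d × a)) (U : Gate d) : DensityMatrix (Fin d × a) where
  mat := applyGate U σ.mat
  posSemidef := σ.posSemidef.mul_mul_conjTranspose_same _
  trace_eq_one := by rw [trace_applyGate, σ.trace_eq_one]

/-! ### The global channel fidelity, averaged over the unitary group -/

/-- The Choi operator `(Φ ⊗ id)(|I⟩⟨I|)`, with `|I⟩ = ∑ i, |i⟩|i⟩`, on output ⊗ input. -/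
def choi {m n : Type} [DecidableEq n] (Φ : Matrix n n ℂ → Matrix m m ℂ) :
    Matrix (m × n) (m × n) ℂ :=
  Matrix.of fun p q => Φ (Matrix.single p.2 q.2 1) p.1 q.1

/-- The vector `|A⟩ = (A ⊗ I)|I⟩`. -/
def ket {m n : Type} (A : Matrix m n ℂ) : m × n → ℂ := fun p => A p.1 p.2

/-- The rank-one operator `|v⟩⟨v|`. -/
def ketbra {n : Type} (v : n → ℂ) : Matrix n n ℂ := Matrix.vecMulVec v (star v)

/-- The matrix `U ⊗ U`. -/
def twoCopies {d : ℕ} (U : Gate d) : Matrix (Fin d × Fin d) (Fin d × Fin d) ℂ :=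
  (U : Matrix (Fin d) (Fin d) ℂ) ⊗ₖ (U : Matrix (Fin d) (Fin d) ℂ)

/-- The global channel fidelity `Tr[C |U ⊗ U⟩⟨U ⊗ U|] / d ^ 4`, with `C` the Choi operator of `Φ`,
between a map `Φ` on two `d`-dimensional systems and the channel `ρ ↦ (U ⊗ U) ρ (U ⊗ U)†`. -/
def gateFidelity {d : ℕ} (U : Gate d)
    (Φ : Matrix (Fin d × Fin d) (Fin d × Fin d) ℂ → Matrix (Fin d × Fin d) (Fin d × Fin d) ℂ) :
    ℝ :=
  ((choi Φ * ketbra (ket (twoCopies U))).trace).re / (d : ℝ) ^ 4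

instance gateCompactSpace (d : ℕ) : CompactSpace (Gate d) := by
  have hcl : IsClosed ((Matrix.unitaryGroup (Fin d) ℂ : Submonoid (Matrix (Fin d) (Fin d) ℂ)) :
      Set (Matrix (Fin d) (Fin d) ℂ)) := isClosed_unitary
  have hK : IsCompact (Set.univ.pi fun _ : Fin d => Set.univ.pi fun _ : Fin d =>
      Metric.closedBall (0 : ℂ) 1) :=
    isCompact_univ_pi fun _ => isCompact_univ_pi fun _ => isCompact_closedBall _ _
  have : IsCompact ((Matrix.unitaryGroup (Fin d) ℂ : Submonoid (Matrix (Fin d) (Fin d) ℂ)) :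
      Set (Matrix (Fin d) (Fin d) ℂ)) := by
    refine IsCompact.of_isClosed_subset (s := Set.univ.pi fun _ : Fin d => Set.univ.pi
      fun _ : Fin d => Metric.closedBall (0 : ℂ) 1) hK hcl ?_
    intro A hA i _ j _
    simpa using entry_norm_bound_of_unitary hA i j
  exact isCompact_iff_compactSpace.mp this

instance gateMeasurableSpace (d : ℕ) : MeasurableSpace (Gate d) := borel _

instance gateBorelSpace (d : ℕ) : BorelSpace (Gate d) := ⟨rfl⟩

/-- The normalized Haar measure of `U(d)`. -/
def gateHaar (d : ℕ) : Measure (Gate d) :=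
  Measure.haarMeasure (⊤ : TopologicalSpace.PositiveCompacts (Gate d))

/-- The global fidelity of a `U`-dependent map `Φ U` with `U ⊗ U`, averaged over `U`. -/
def averageFidelity (d : ℕ)
    (Φ : Gate d → Matrix (Fin d × Fin d) (Fin d × Fin d) ℂ →
      Matrix (Fin d × Fin d) (Fin d × Fin d) ℂ) : ℝ :=
  ∫ U, gateFidelity U (Φ U) ∂(gateHaar d)

/-! ### Learning schemes -/

/-- The average fidelities of all one-to-two learning schemes: the gate `U` is applied once to a
fixed bipartite state `σ` (with an ancilla of arbitrary finite dimension `k`), and `σ_U` programs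
the map `ρ ↦ Λ (ρ ⊗ σ_U)`, with `Λ` an arbitrary fixed channel. -/
def learningFidelities (d : ℕ) : Set ℝ :=
  {F | ∃ (k : ℕ) (σ : DensityMatrix (Fin d × Fin k))
      (Λ : Matrix ((Fin d × Fin d) × (Fin d × Fin k)) ((Fin d × Fin d) × (Fin d × Fin k)) ℂ →ₗ[ℂ]
        Matrix (Fin d × Fin d) (Fin d × Fin d) ℂ),
      IsChannel Λ ∧ F = averageFidelity d fun U ρ => Λ (ρ ⊗ₖ (σ.evolve U).mat)}

/-- The average fidelities of the learning schemes in which the programmed map is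
`ρ ↦ Tr_P [W (ρ ⊗ σ_U) W†]`, with `W` a unitary interaction of the two input systems with the
program system `P`. -/
def interactionFidelities (d : ℕ) : Set ℝ :=
  {F | ∃ (k : ℕ) (σ : DensityMatrix (Fin d × Fin k))
      (W : Matrix.unitaryGroup ((Fin d × Fin d) × (Fin d × Fin k)) ℂ),
      F = averageFidelity d fun U ρ =>
        traceSnd ((W : Matrix ((Fin d × Fin d) × (Fin d × Fin k)) _ ℂ) *
          (ρ ⊗ₖ (σ.evolve U).mat) * (W : Matrix ((Fin d × Fin d) × (Fin d × Fin k)) _ ℂ)ᴴ)}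

/-- The average fidelities of the schemes that store `U` in the maximally entangled state
`|U⟩⟨U| / d`, clone this state with a fixed channel `K`, and then use the pair of clones to program
a map on the two input systems through a fixed channel `Λ`. -/
def stateCloningFidelities (d : ℕ) : Set ℝ :=
  {F | ∃ (K : Matrix (Fin d × Fin d) (Fin d × Fin d) ℂ →ₗ[ℂ]
        Matrix ((Fin d × Fin d) × (Fin d × Fin d)) ((Fin d × Fin d) × (Fin d × Fin d)) ℂ)
      (Λ : Matrix ((Fin d × Fin d) × ((Fin d × Fin d) × (Fin d × Fin d)))
          ((Fin d × Fin d) × ((Fin d × Fin d) × (Fin d × Fin d))) ℂ →ₗ[ℂ]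
        Matrix (Fin d × Fin d) (Fin d × Fin d) ℂ),
      IsChannel K ∧ IsChannel Λ ∧ F = averageFidelity d fun U ρ =>
        Λ (ρ ⊗ₖ K ((d : ℂ)⁻¹ • ketbra (ket (U : Matrix (Fin d) (Fin d) ℂ))))}

/-! ### Measure-and-prepare schemes -/

/-- A quantum measurement (positive operator valued measure) with outcomes in `Ω`. -/
structure POVM (Ω : Type) [MeasurableSpace Ω] (n : Type) [Fintype n] [DecidableEq n] where
  effect : VectorMeasure Ω (Matrix n n ℂ)
  posSemidef : ∀ s, (effect s).PosSemidef
  effect_univ : effect Set.univ = 1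

open scoped MatrixOrder Matrix.Norms.L2Operator in
theorem trace_mul_re_nonneg {n : Type} [Fintype n] {A B : Matrix n n ℂ}
    (hA : A.PosSemidef) (hB : B.PosSemidef) : 0 ≤ (A * B).trace.re := by
  classical
  obtain ⟨C, rfl⟩ := (CStarAlgebra.nonneg_iff_eq_star_mul_self (A := Matrix n n ℂ)).mp hB.nonneg
  rw [← Matrix.mul_assoc, Matrix.trace_mul_comm, ← Matrix.mul_assoc]
  exact (Complex.le_def.mp (hA.mul_mul_conjTranspose_same C).trace_nonneg).1

/-- The law of the outcome of the measurement `P` on the state `τ`: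
`Prob(s) = Tr[P(s) τ]` (Born's rule). -/
def POVM.law {Ω : Type} [MeasurableSpace Ω] {n : Type} [Fintype n] [DecidableEq n]
    (P : POVM Ω n) (τ : DensityMatrix n) : Measure Ω :=
  Measure.ofMeasurable (fun s _ => ENNReal.ofReal ((P.effect s * τ.mat).trace.re))
    (by simp)
    (by
      intro f hf hd
      have h := P.effect.m_iUnion hf hd
      have hc : Continuous fun A : Matrix n n ℂ => (A * τ.mat).trace.re :=
        Complex.continuous_re.comp (continuous_id.matrix_mul continuous_const).matrix_trace
      have h2 : HasSum (fun i => (P.effect (f i) * τ.mat).trace.re)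
          ((P.effect (⋃ i, f i) * τ.mat).trace.re) :=
        h.map (⟨⟨fun A : Matrix n n ℂ => (A * τ.mat).trace.re, by simp⟩,
          fun A B => by simp [Matrix.add_mul]⟩ : Matrix n n ℂ →+ ℝ) hc
      rw [← h2.tsum_eq]
      exact ENNReal.ofReal_tsum_of_nonneg
        (fun i => trace_mul_re_nonneg (P.posSemidef _) τ.posSemidef) h2.summable)

/-- The map `ρ ↦ ∫ C_x(ρ) Tr[P(dx) τ]`: the program state `τ` is measured, and the map `C x` is
performed on the input systems when the outcome is `x`. -/
def measurePrepareMap {d : ℕ} {Ω : Type} [MeasurableSpace Ω] {n : Type} [Fintype n] [DecidableEq n]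
    (P : POVM Ω n)
    (C : Ω → Matrix (Fin d × Fin d) (Fin d × Fin d) ℂ → Matrix (Fin d × Fin d) (Fin d × Fin d) ℂ)
    (τ : DensityMatrix n) (ρ : Matrix (Fin d × Fin d) (Fin d × Fin d) ℂ) :
    Matrix (Fin d × Fin d) (Fin d × Fin d) ℂ :=
  Matrix.of fun i j => ∫ x, C x ρ i j ∂(P.law τ)

/-- The average fidelities of all measure-and-prepare schemes: `U` is applied to a fixed bipartite
state, the resulting state is measured, and a channel depending on the outcome is performed on the
two input systems. -/
def measurePrepareFidelities (d : ℕ) : Set ℝ :=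
  {F | ∃ (k : ℕ) (σ : DensityMatrix (Fin d × Fin k)) (Ω : Type) (_ : MeasurableSpace Ω)
      (P : POVM Ω (Fin d × Fin k))
      (C : Ω → Matrix (Fin d × Fin d) (Fin d × Fin d) ℂ →ₗ[ℂ]
        Matrix (Fin d × Fin d) (Fin d × Fin d) ℂ),
      (∀ x, IsChannel (C x)) ∧ (∀ ρ i j, Measurable fun x => C x ρ i j) ∧
      F = averageFidelity d fun U => measurePrepareMap P (fun x => C x) (σ.evolve U)}

/-- The average fidelities of all estimation schemes: `U` is applied to a fixed bipartite state, the
resulting state is measured to give an estimate `V` of `U`, and `V ⊗ V` is performed on the two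
input systems. -/
def estimationFidelities (d : ℕ) : Set ℝ :=
  {F | ∃ (k : ℕ) (σ : DensityMatrix (Fin d × Fin k)) (P : POVM (Gate d) (Fin d × Fin k)),
      F = averageFidelity d fun U =>
        measurePrepareMap P (fun V ρ => twoCopies V * ρ * (twoCopies V)ᴴ) (σ.evolve U)}

/-! ### Cloning networks -/

/-- The average fidelities of all one-to-two cloning networks `ℬ ∘ (U ⊗ id_M) ∘ 𝒜`: a channel `𝒜`
maps the two input systems to a `d`-dimensional system and a quantum memory of arbitrary finite
dimension `k`, the gate `U` is applied to the former, and a channel `ℬ` maps the result to the two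
output systems. -/
def cloningFidelities (d : ℕ) : Set ℝ :=
  {F | ∃ (k : ℕ)
      (𝒜 : Matrix (Fin d × Fin d) (Fin d × Fin d) ℂ →ₗ[ℂ] Matrix (Fin d × Fin k) (Fin d × Fin k) ℂ)
      (ℬ : Matrix (Fin d × Fin k) (Fin d × Fin k) ℂ →ₗ[ℂ] Matrix (Fin d × Fin d) (Fin d × Fin d) ℂ),
      IsChannel 𝒜 ∧ IsChannel ℬ ∧ F = averageFidelity d fun U ρ => ℬ (applyGate U (𝒜 ρ))}

end

end QuantumLearning

/-!
All fidelities are reduced to averages `∫ |Tr (Bᴴ * (U ⊗ U ⊗ conj U))| ^ 2 dU`. A scheme that uses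
the gate once is, in Kraus form, a family of operators `B_t * (U ⊗ 1) * A_s`, and its overlap with
`U ⊗ U` is the overlap of `U ⊗ U ⊗ conj U` with an operator `combOp A_s B_t` that does not depend on
`U` (`norm_trace_network`). Schur orthogonality (`IsUnitaryRep.integral_mul_star`) evaluates such an
average in terms of the commutant of `U ⊗ U ⊗ conj U`.

This commutant is the partial transpose of the commutant of `U ⊗ U ⊗ U`, which is spanned by the
permutations of the systems (`exists_permComb`, proved directly with a few explicit gates). It
follows that `U ⊗ U ⊗ conj U` splits into two copies of `U`, one in the symmetric and one in the
antisymmetric part of the first two systems (`embed`), and two further irreducible pieces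
(`restProj`), one of which vanishes for `d = 2`. The average is computed in `integral_overlap`. The
sixth moment of the trace of `U` is the sum of the squared multiplicities, `4 + 1 + 1 = 6`, or
`4 + 1 = 5` for `d = 2` (`integral_norm_trace_pow_six`).

*Upper bounds.* By the Cauchy-Schwarz inequality, the average is bounded by the quadratic form of
`Bᴴ * B` in a weighted sum of the projections to the pieces. Trace preservation of the decoding
gives `∑ Bᴴ * B = d • G`, with `G` a Gram matrix of the encoding (`sum_combOp_gram`). For every
network, the partial trace of `G` over the gate input is the identity, which suffices for weights
depending on the symmetry type only; the best ones are inversely proportional to `tau d ε` and give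
`(d + √(d ^ 2 - 1)) / d ^ 3` (`network_le`). In a learning scheme the input systems enter after the
gate, so that `G = 1 ⊗ γ` with `γ` of unit trace; then the four pieces contribute `2 + 2 + 1 + 1` to
the bound, or `2 + 2 + 1` for `d = 2` (`learning_le`). Interaction schemes and schemes that clone
the stored state are learning schemes. A measure-and-prepare scheme is approximated by schemes with
finitely many outcomes, which are learning schemes as well.

*Optimal schemes.* The optimal network encodes the two inputs into the gate input, a `d`-dimensional
memory and a bit for the symmetry type, and decodes coherently (`cloning_attained`). The optimal
learning scheme stores `U` in a maximally entangled state and estimates it with the covariant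
measurement `d |V⟩⟨V| dV`; its fidelity is the sixth moment of the trace divided by `d ^ 4`
(`averageFidelity_estimate`). As a channel this measurement is an integral of Kraus operators
(`learning_attained`), and a Stinespring dilation turns any learning scheme into one of interaction
type (`learning_mem_interactionFidelities`).
-/

open scoped Matrix Kronecker ComplexOrder
open MeasureTheory
namespace QuantumLearning
noncomputable section

/-! ### Kraus families -/

/-- The completely positive map `X ↦ ∑ q, K q * X * (K q)ᴴ` with Kraus operators `K`. -/
def krausMap {r m n : Type} [Fintype r] [Fintype n] (K : r → Matrix m n ℂ) :
    Matrix n n ℂ →ₗ[ℂ] Matrix m m ℂ where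
  toFun X := ∑ q, K q * X * (K q)ᴴ
  map_add' X Y := by simp [Matrix.mul_add, Matrix.add_mul, Finset.sum_add_distrib]
  map_smul' c X := by simp [Finset.smul_sum]

theorem krausMap_apply {r m n : Type} [Fintype r] [Fintype n] (K : r → Matrix m n ℂ)
    (X : Matrix n n ℂ) : krausMap K X = ∑ q, K q * X * (K q)ᴴ := rfl

theorem ampliate_krausMap {r m n : Type} [Fintype r] [Fintype n]
    (K : r → Matrix m n ℂ) (k : ℕ) (X : Matrix (n × Fin k) (n × Fin k) ℂ) :
    ampliate (krausMap K) k X =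
      ∑ q, (K q ⊗ₖ (1 : Matrix (Fin k) (Fin k) ℂ)) * X *
        (K q ⊗ₖ (1 : Matrix (Fin k) (Fin k) ℂ))ᴴ := by
  ext p q
  simp only [ampliate, krausMap_apply, Matrix.of_apply, Matrix.sum_apply]
  refine Finset.sum_congr rfl fun s _ => ?_
  simp only [Matrix.mul_apply, Matrix.conjTranspose_apply, Matrix.kroneckerMap_apply,
    Fintype.sum_prod_type, Matrix.of_apply, Matrix.one_apply, mul_ite, mul_one,
    mul_zero, ite_mul, zero_mul, apply_ite star, star_zero,
    Finset.sum_ite_eq, Finset.mem_univ, if_true]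

theorem isChannel_krausMap {r m n : Type} [Fintype r] [Fintype m] [Fintype n] [DecidableEq n]
    {K : r → Matrix m n ℂ} (hK : ∑ q, (K q)ᴴ * K q = 1) : IsChannel (krausMap K) where
  completelyPositive k X hX := by
    rw [ampliate_krausMap]
    exact Matrix.posSemidef_sum _ fun q _ => hX.mul_mul_conjTranspose_same _
  tracePreserving X := by
    rw [krausMap_apply, Matrix.trace_sum]
    have : ∀ q, (K q * X * (K q)ᴴ).trace = ((K q)ᴴ * K q * X).trace := fun q => by
      rw [Matrix.trace_mul_comm, Matrix.mul_assoc]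
    simp_rw [this]
    rw [← Matrix.trace_sum, ← Finset.sum_mul, hK, Matrix.one_mul]

theorem linearMap_ext_single {n m : Type} [Fintype n] [DecidableEq n]
    {Φ Ψ : Matrix n n ℂ →ₗ[ℂ] Matrix m m ℂ}
    (h : ∀ i j, Φ (Matrix.single i j 1) = Ψ (Matrix.single i j 1)) : Φ = Ψ := by
  refine LinearMap.ext fun X => ?_
  rw [Matrix.matrix_eq_sum_single X]
  simp only [map_sum]
  refine Finset.sum_congr rfl fun i _ => Finset.sum_congr rfl fun j _ => ?_
  have : Matrix.single i j (X i j) = X i j • Matrix.single i j (1 : ℂ) := by simp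
  rw [this, map_smul, map_smul, h]

open scoped MatrixOrder Matrix.Norms.L2Operator in
theorem posSemidef_exists_sqrt {n : Type} [Fintype n] {X : Matrix n n ℂ} (hX : X.PosSemidef) :
    ∃ B : Matrix n n ℂ, X = Bᴴ * B := by
  classical
  exact (CStarAlgebra.nonneg_iff_eq_star_mul_self (A := Matrix n n ℂ)).mp hX.nonneg

/-- A positive semidefinite matrix is a sum of rank-one operators. -/
theorem posSemidef_exists_sum {n : Type} [Fintype n] {X : Matrix n n ℂ} (hX : X.PosSemidef) :
    ∃ v : n → n → ℂ, ∀ i j, X i j = ∑ r, v r i * star (v r j) := by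
  obtain ⟨B, hB⟩ := posSemidef_exists_sqrt hX
  refine ⟨fun r i => star (B r i), fun i j => ?_⟩
  rw [hB, Matrix.mul_apply]
  simp

theorem choi_posSemidef {m n : Type} [Fintype m] [Fintype n] [DecidableEq n]
    {Φ : Matrix n n ℂ →ₗ[ℂ] Matrix m m ℂ} (hΦ : IsChannel Φ) : (choi Φ).PosSemidef := by
  classical
  let e : n ≃ Fin (Fintype.card n) := Fintype.equivFin n
  let w : n × Fin (Fintype.card n) → ℂ := fun p => if e p.1 = p.2 then 1 else 0
  have h := hΦ.completelyPositive (Fintype.card n) (ketbra w)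
    (Matrix.posSemidef_vecMulVec_self_star w)
  have h2 := h.submatrix (fun p : m × n => (p.1, e p.2))
  convert h2 using 1
  ext p q
  simp only [choi, ampliate, Matrix.of_apply, Matrix.submatrix_apply]
  suffices h3 : (Matrix.single p.2 q.2 1 : Matrix n n ℂ) =
      Matrix.of fun i j => ketbra w (i, e p.2) (j, e q.2) by rw [h3]
  ext i j
  simp only [ketbra, Matrix.vecMulVec_apply, Matrix.of_apply, Matrix.single_apply, w,
    Pi.star_apply, EmbeddingLike.apply_eq_iff_eq]
  by_cases h1 : i = p.2 <;> by_cases h2 : j = q.2 <;> simp [h1, h2, eq_comm]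

/-- Every quantum channel has a Kraus decomposition: its Choi operator is positive semidefinite, and
the rows of a square root of it are the Kraus operators. -/
theorem IsChannel.exists_kraus {m n : Type} [Fintype m] [Fintype n] [DecidableEq n]
    {Φ : Matrix n n ℂ →ₗ[ℂ] Matrix m m ℂ} (hΦ : IsChannel Φ) :
    ∃ K : m × n → Matrix m n ℂ, Φ = krausMap K ∧ ∑ q, (K q)ᴴ * K q = 1 := by
  classical
  obtain ⟨v, hv⟩ := posSemidef_exists_sum (choi_posSemidef hΦ)
  let K : m × n → Matrix m n ℂ := fun q => Matrix.of fun o i => v q (o, i)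
  have hΦK : Φ = krausMap K := by
    refine linearMap_ext_single fun i j => ?_
    ext o o'
    have h := hv (o, i) (o', j)
    simp only [choi, Matrix.of_apply] at h
    rw [h, krausMap_apply, Matrix.sum_apply]
    refine Finset.sum_congr rfl fun q _ => ?_
    simp [Matrix.mul_apply, Matrix.single_apply, K, ite_and]
  refine ⟨K, hΦK, ?_⟩
  ext i j
  have h := hΦ.tracePreserving (Matrix.single j i (1 : ℂ))
  rw [hΦK, krausMap_apply, Matrix.trace_sum] at h
  have h2 : ∀ q, (K q * Matrix.single j i (1 : ℂ) * (K q)ᴴ).trace =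
      ((K q)ᴴ * K q) i j := fun q => by
    rw [Matrix.trace_mul_comm, ← Matrix.mul_assoc, Matrix.trace_mul_single]
    simp
  simp_rw [h2] at h
  rw [Matrix.sum_apply, h, Matrix.one_apply]
  by_cases hij : i = j
  · subst hij; simp
  · rw [if_neg hij, Matrix.trace_single_eq_of_ne _ _ _ (Ne.symm hij)]

/-- The fidelity of a completely positive map in terms of its Kraus operators. -/
theorem gateFidelity_krausMap {d : ℕ} {r : Type} [Fintype r] (U : Gate d)
    (N : r → Matrix (Fin d × Fin d) (Fin d × Fin d) ℂ) :
    gateFidelity U (krausMap N) = (∑ q, ‖((twoCopies U)ᴴ * N q).trace‖ ^ 2) / (d : ℝ) ^ 4 := by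
  rw [gateFidelity]
  congr 1
  have h : (choi (krausMap N) * ketbra (ket (twoCopies U))).trace =
      ∑ q, ((‖((twoCopies U)ᴴ * N q).trace‖ ^ 2 : ℝ) : ℂ) := by
    have h1 : ∀ q, ((‖((twoCopies U)ᴴ * N q).trace‖ ^ 2 : ℝ) : ℂ) =
        (∑ p : (Fin d × Fin d) × (Fin d × Fin d), star (twoCopies U p.1 p.2) * N q p.1 p.2) *
        (∑ p : (Fin d × Fin d) × (Fin d × Fin d), (twoCopies U p.1 p.2) * star (N q p.1 p.2)) := by
      intro q
      have h0 : ((twoCopies U)ᴴ * N q).trace = ∑ p : (Fin d × Fin d) × (Fin d × Fin d),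
          star (twoCopies U p.1 p.2) * N q p.1 p.2 := by
        simp only [Matrix.trace, Matrix.diag_apply, Matrix.mul_apply, Matrix.conjTranspose_apply]
        rw [Finset.sum_comm, ← Fintype.sum_prod_type
          (f := fun p : (Fin d × Fin d) × (Fin d × Fin d) => star (twoCopies U p.1 p.2) * N q p.1 p.2)]
      rw [Complex.ofReal_pow, ← Complex.mul_conj', h0]
      congr 1
      rw [map_sum]
      simp
    simp_rw [h1, Finset.sum_mul_sum]
    rw [Finset.sum_comm, Matrix.trace]
    refine Finset.sum_congr rfl fun p _ => ?_
    rw [Matrix.diag_apply, Matrix.mul_apply, Finset.sum_comm]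
    refine Finset.sum_congr rfl fun p' _ => ?_
    have : choi (krausMap N) p p' = ∑ q, N q p.1 p.2 * star (N q p'.1 p'.2) := by
      simp [choi, krausMap_apply, Matrix.sum_apply, Matrix.mul_apply, Matrix.single_apply, ite_and]
    rw [this, Finset.sum_mul]
    refine Finset.sum_congr rfl fun q _ => ?_
    simp only [ketbra, ket, Matrix.vecMulVec_apply, Pi.star_apply]
    ring
  rw [h, ← Complex.ofReal_sum, Complex.ofReal_re]


/-! ### Haar averages and orthogonality relations -/

instance gateHaar_isHaarMeasure (d : ℕ) : (gateHaar d).IsHaarMeasure := by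
  unfold gateHaar; infer_instance

instance gateHaar_isProbabilityMeasure (d : ℕ) : IsProbabilityMeasure (gateHaar d) :=
  ⟨by simpa [gateHaar] using
    Measure.haarMeasure_self (K₀ := (⊤ : TopologicalSpace.PositiveCompacts (Gate d)))⟩

theorem integrable_of_continuous {d : ℕ} {E : Type} [NormedAddCommGroup E] {f : Gate d → E}
    (hf : Continuous f) : Integrable f (gateHaar d) :=
  hf.integrable_of_hasCompactSupport (HasCompactSupport.of_compactSpace f)

/-- The entrywise Haar average of a matrix-valued function. -/
def haarAverage {d : ℕ} {m n : Type} (f : Gate d → Matrix m n ℂ) : Matrix m n ℂ :=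
  Matrix.of fun i j => ∫ U, f U i j ∂gateHaar d

theorem haarAverage_mul {d : ℕ} {l m n : Type} [Fintype m] {f : Gate d → Matrix m n ℂ}
    (hf : Continuous f) (A : Matrix l m ℂ) :
    haarAverage (fun U => A * f U) = A * haarAverage f := by
  ext i j
  simp only [haarAverage, Matrix.of_apply, Matrix.mul_apply]
  rw [integral_finsetSum _ fun k _ =>
    (integrable_of_continuous (hf.matrix_elem k j)).const_mul (A i k)]
  simp_rw [integral_const_mul]

theorem mul_haarAverage {d : ℕ} {l m n : Type} [Fintype m] {f : Gate d → Matrix l m ℂ}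
    (hf : Continuous f) (A : Matrix m n ℂ) :
    haarAverage (fun U => f U * A) = haarAverage f * A := by
  ext i j
  simp only [haarAverage, Matrix.of_apply, Matrix.mul_apply]
  rw [integral_finsetSum _ fun k _ =>
    (integrable_of_continuous (hf.matrix_elem i k)).mul_const (A k j)]
  simp_rw [integral_mul_const]

theorem trace_haarAverage {d : ℕ} {n : Type} [Fintype n] {f : Gate d → Matrix n n ℂ}
    (hf : Continuous f) : (haarAverage f).trace = ∫ U, (f U).trace ∂gateHaar d := by
  simp only [haarAverage, Matrix.trace, Matrix.diag_apply, Matrix.of_apply]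
  rw [integral_finsetSum _ fun k _ => integrable_of_continuous (hf.matrix_elem k k)]

theorem haarAverage_comp_mul_left {d : ℕ} {m n : Type} (f : Gate d → Matrix m n ℂ) (V : Gate d) :
    haarAverage (fun U => f (V * U)) = haarAverage f := by
  ext i j
  exact integral_mul_left_eq_self (fun U => f U i j) V

theorem trace_conjTranspose_mul_eq_sum {m n : Type} [Fintype m] [Fintype n] (A B : Matrix m n ℂ) :
    (Aᴴ * B).trace = ∑ p : m × n, star (A p.1 p.2) * B p.1 p.2 := by
  simp only [Matrix.trace, Matrix.diag_apply, Matrix.mul_apply, Matrix.conjTranspose_apply]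
  rw [Finset.sum_comm, ← Fintype.sum_prod_type (f := fun p : m × n => star (A p.1 p.2) * B p.1 p.2)]

/-- A continuous unitary matrix representation of `U(d)`. -/
structure IsUnitaryRep {d : ℕ} {n : Type} [Fintype n] [DecidableEq n]
    (G : Gate d → Matrix n n ℂ) : Prop where
  continuous : Continuous G
  map_mul : ∀ V U, G (V * U) = G V * G U
  unitary : ∀ U, (G U)ᴴ * G U = 1

section Rep
variable {d : ℕ} {n : Type} [Fintype n] [DecidableEq n] {G : Gate d → Matrix n n ℂ}

theorem IsUnitaryRep.continuous_twirl (hG : IsUnitaryRep G) (X : Matrix n n ℂ) :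
    Continuous fun U => G U * X * (G U)ᴴ :=
  (hG.continuous.matrix_mul continuous_const).matrix_mul hG.continuous.matrix_conjTranspose

theorem IsUnitaryRep.twirl_commute (hG : IsUnitaryRep G) (X : Matrix n n ℂ) (V : Gate d) :
    G V * haarAverage (fun U => G U * X * (G U)ᴴ) =
      haarAverage (fun U => G U * X * (G U)ᴴ) * G V := by
  have h1 : haarAverage (fun U => G U * X * (G U)ᴴ) =
      G V * haarAverage (fun U => G U * X * (G U)ᴴ) * (G V)ᴴ := by
    rw [← haarAverage_mul (hG.continuous_twirl X), ← mul_haarAverage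
      (continuous_const.matrix_mul (hG.continuous_twirl X)), ← haarAverage_comp_mul_left _ V]
    congr 1
    funext U
    simp only [hG.map_mul, Matrix.conjTranspose_mul, Matrix.mul_assoc]
  conv_rhs => rw [h1]
  rw [Matrix.mul_assoc _ _ (G V), hG.unitary, Matrix.mul_one]

/-- The Schur orthogonality relations, in terms of an orthogonal spanning family of the commutant:
`∫ G i j * conj (G k l)` is the entry `(i, k)` of the orthogonal projection of the matrix unit
`(j, l)` to the commutant. Members of the family may vanish. -/
theorem IsUnitaryRep.integral_mul_star (hG : IsUnitaryRep G) {ι : Type} [Fintype ι]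
    (b : ι → Matrix n n ℂ) (hcomm : ∀ s U, G U * b s = b s * G U)
    (horth : ∀ s t, s ≠ t → ((b s)ᴴ * b t).trace = 0)
    (hspan : ∀ X, (∀ U, G U * X = X * G U) → X ∈ Submodule.span ℂ (Set.range b)) (i j k l : n) :
    ∫ U, G U i j * star (G U k l) ∂gateHaar d =
      ∑ s, b s i k * star (b s j l) / ((b s)ᴴ * b s).trace := by
  set X : Matrix n n ℂ := Matrix.single j l 1 with hX
  set Y := haarAverage (fun U => G U * X * (G U)ᴴ) with hY
  have h1 : ∫ U, G U i j * star (G U k l) ∂gateHaar d = Y i k := by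
    simp only [hY, haarAverage, Matrix.of_apply]
    congr 1
    funext U
    simp [hX, Matrix.mul_apply, Matrix.single_apply, ite_and]
  obtain ⟨y, hy⟩ := (Submodule.mem_span_range_iff_exists_fun ℂ).mp
    (hspan Y fun U => hG.twirl_commute X U)
  have h2 : ∀ t, star (b t j l) = y t * ((b t)ᴴ * b t).trace := by
    intro t
    have h3 : ((b t)ᴴ * Y).trace = star (b t j l) := by
      rw [hY, ← haarAverage_mul (hG.continuous_twirl X), trace_haarAverage
        (continuous_const.matrix_mul (hG.continuous_twirl X))]
      have : ∀ U, ((b t)ᴴ * (G U * X * (G U)ᴴ)).trace = star (b t j l) := fun U => by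
        have h4 : (G U)ᴴ * (b t)ᴴ * G U = (b t)ᴴ := by
          rw [← Matrix.conjTranspose_mul, ← hcomm, Matrix.conjTranspose_mul, Matrix.mul_assoc,
            hG.unitary, Matrix.mul_one]
        rw [← Matrix.mul_assoc, Matrix.trace_mul_comm, ← Matrix.mul_assoc, ← Matrix.mul_assoc, h4,
          hX, Matrix.trace_mul_single]
        simp
      simp_rw [this]
      simp
    rw [← h3, ← hy, Finset.mul_sum, Matrix.trace_sum, Finset.sum_eq_single t]
    · simp
    · intro s _ hs
      simp [horth t s hs.symm]
    · simp
  rw [h1, ← hy, Matrix.sum_apply]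
  refine Finset.sum_congr rfl fun t _ => ?_
  rw [h2 t, Matrix.smul_apply, smul_eq_mul]
  by_cases h0 : ((b t)ᴴ * b t).trace = 0
  · rw [Matrix.trace_conjTranspose_mul_self_eq_zero_iff.mp h0]
    simp
  · field_simp

theorem IsUnitaryRep.integral_norm_sq_trace (hG : IsUnitaryRep G) {ι : Type} [Fintype ι]
    (b : ι → Matrix n n ℂ) (hcomm : ∀ s U, G U * b s = b s * G U)
    (horth : ∀ s t, s ≠ t → ((b s)ᴴ * b t).trace = 0)
    (hspan : ∀ X, (∀ U, G U * X = X * G U) → X ∈ Submodule.span ℂ (Set.range b))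
    (B : Matrix n n ℂ) :
    ((∫ U, ‖(Bᴴ * G U).trace‖ ^ 2 ∂gateHaar d : ℝ) : ℂ) =
      ∑ s, (Bᴴ * b s * B * (b s)ᴴ).trace / ((b s)ᴴ * b s).trace := by
  have h1 : ∀ U, ((‖(Bᴴ * G U).trace‖ ^ 2 : ℝ) : ℂ) = ∑ p : n × n, ∑ q : n × n,
      (star (B p.1 p.2) * B q.1 q.2) * (G U p.1 p.2 * star (G U q.1 q.2)) := fun U => by
    rw [Complex.ofReal_pow, ← Complex.mul_conj', trace_conjTranspose_mul_eq_sum, map_sum,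
      Finset.sum_mul_sum]
    refine Finset.sum_congr rfl fun p _ => Finset.sum_congr rfl fun q _ => ?_
    rw [← RCLike.star_def, star_mul', star_star]
    ring
  have hc : ∀ p q : n × n, Continuous fun U => G U p.1 p.2 * star (G U q.1 q.2) := fun p q =>
    (hG.continuous.matrix_elem _ _).mul (hG.continuous.matrix_elem _ _).star
  rw [← integral_complex_ofReal]
  simp_rw [h1]
  rw [integral_finsetSum Finset.univ (f := fun p U => ∑ q : n × n, (star (B p.1 p.2) * B q.1 q.2) *
      (G U p.1 p.2 * star (G U q.1 q.2))) fun p _ => integrable_of_continuous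
    (continuous_finsetSum _ fun q _ => continuous_const.mul (hc p q))]
  have h2 : ∀ p : n × n, ∫ U, ∑ q : n × n, (star (B p.1 p.2) * B q.1 q.2) *
      (G U p.1 p.2 * star (G U q.1 q.2)) ∂gateHaar d = ∑ q : n × n, (star (B p.1 p.2) * B q.1 q.2) *
      ∑ s, b s p.1 q.1 * star (b s p.2 q.2) / ((b s)ᴴ * b s).trace := fun p => by
    rw [integral_finsetSum Finset.univ (f := fun q U => (star (B p.1 p.2) * B q.1 q.2) *
      (G U p.1 p.2 * star (G U q.1 q.2))) fun q _ =>
        integrable_of_continuous (continuous_const.mul (hc p q))]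
    refine Finset.sum_congr rfl fun q _ => ?_
    rw [integral_const_mul, hG.integral_mul_star b hcomm horth hspan]
  simp_rw [h2, Finset.mul_sum]
  rw [Finset.sum_congr rfl fun p _ => Finset.sum_comm, Finset.sum_comm]
  refine Finset.sum_congr rfl fun s _ => ?_
  have h3 : (Bᴴ * b s * B * (b s)ᴴ).trace = ∑ p : n × n, ∑ q : n × n,
      star (B p.1 p.2) * B q.1 q.2 * (b s p.1 q.1 * star (b s p.2 q.2)) := by
    rw [Matrix.mul_assoc, Matrix.mul_assoc, trace_conjTranspose_mul_eq_sum]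
    refine Finset.sum_congr rfl fun p _ => ?_
    rw [← Matrix.mul_assoc, Fintype.sum_prod_type_right, Matrix.mul_apply, Finset.mul_sum]
    refine Finset.sum_congr rfl fun l _ => ?_
    rw [Matrix.mul_apply, Finset.sum_mul, Finset.mul_sum]
    refine Finset.sum_congr rfl fun k _ => ?_
    rw [Matrix.conjTranspose_apply]
    ring
  rw [h3, Finset.sum_div]
  refine Finset.sum_congr rfl fun p _ => ?_
  rw [Finset.sum_div]
  refine Finset.sum_congr rfl fun q _ => ?_
  ring

end Rep


/-! ### Some unitary gates -/

/-- The diagonal gate with entry `i` at `a` and entries `1` elsewhere. -/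
def phaseGate {d : ℕ} (a : Fin d) : Gate d :=
  ⟨Matrix.diagonal fun i => if i = a then Complex.I else 1, by
    rw [Matrix.mem_unitaryGroup_iff', Matrix.star_eq_conjTranspose, Matrix.diagonal_conjTranspose,
      Matrix.diagonal_mul_diagonal, ← Matrix.diagonal_one]
    congr 1
    funext i
    by_cases h : i = a <;> simp [h]⟩

/-- The gate permuting the basis vectors by `π`. -/
def permGate {d : ℕ} (π : Equiv.Perm (Fin d)) : Gate d :=
  ⟨Matrix.of fun i j => if i = π j then 1 else 0, by
    rw [Matrix.mem_unitaryGroup_iff']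
    ext i j
    simp [Matrix.mul_apply, Matrix.star_apply, Matrix.one_apply, apply_ite star, eq_comm]⟩

/-- The gate `1 + (i - 1) / 2 * |w⟩⟨w|` with `w = e_a + e_b`, which mixes the basis vectors `e_a`
and `e_b` and fixes the others. -/
def mixGate {d : ℕ} (a b : Fin d) (hab : a ≠ b) : Gate d :=
  ⟨1 + ((Complex.I - 1) / 2) • Matrix.vecMulVec (Pi.single a 1 + Pi.single b 1)
      (Pi.single a 1 + Pi.single b 1), by
    set w : Fin d → ℂ := Pi.single a 1 + Pi.single b 1 with hw
    have hww : w ⬝ᵥ w = 2 := by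
      simp [hw, hab, hab.symm]; norm_num
    have hsw : star w = w := by
      rw [hw, star_add, ← Pi.single_star, ← Pi.single_star, star_one]
    have h1 : (Matrix.vecMulVec w w)ᴴ = Matrix.vecMulVec w w := by
      rw [Matrix.conjTranspose_vecMulVec, hsw]
    have h2 : Matrix.vecMulVec w w * Matrix.vecMulVec w w = (2 : ℂ) • Matrix.vecMulVec w w := by
      rw [Matrix.vecMulVec_mul_vecMulVec, hww]
      ext i j
      simp [Matrix.vecMulVec_apply]
      ring
    have hI := Complex.I_mul_I
    rw [Matrix.mem_unitaryGroup_iff', Matrix.star_eq_conjTranspose, Matrix.conjTranspose_add,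
      Matrix.conjTranspose_smul, h1, Matrix.conjTranspose_one, Matrix.add_mul, Matrix.mul_add,
      Matrix.mul_add, Matrix.smul_mul, Matrix.smul_mul, Matrix.mul_smul, Matrix.mul_smul, h2,
      Matrix.mul_one, Matrix.mul_one, Matrix.one_mul, add_assoc, smul_smul, smul_smul, ← add_smul, ← add_smul]
    have h3 : (Complex.I - 1) / 2 + (star ((Complex.I - 1) / 2) +
        star ((Complex.I - 1) / 2) * ((Complex.I - 1) / 2) * 2) = 0 := by
      simp
      linear_combination (-1 / 2 : ℂ) * hI
    rw [h3, zero_smul, add_zero]⟩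

theorem permGate_mulVec {d : ℕ} (π : Equiv.Perm (Fin d)) (c : Fin d) :
    ((permGate π : Gate d) : Matrix (Fin d) (Fin d) ℂ) *ᵥ Pi.single c 1 = Pi.single (π c) 1 := by
  ext i
  simp [permGate, Pi.single_apply]

theorem mixGate_mulVec_left {d : ℕ} (a b : Fin d) (hab : a ≠ b) :
    ((mixGate a b hab : Gate d) : Matrix (Fin d) (Fin d) ℂ) *ᵥ Pi.single a 1 =
      ((1 + Complex.I) / 2) • Pi.single a 1 + ((Complex.I - 1) / 2) • Pi.single b 1 := by
  ext i
  by_cases h : i = a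
  · subst h
    simp [mixGate, Matrix.vecMulVec_apply, hab]; ring
  · simp [mixGate, Matrix.vecMulVec_apply, hab, h]

theorem mixGate_mulVec_right {d : ℕ} (a b : Fin d) (hab : a ≠ b) :
    ((mixGate a b hab : Gate d) : Matrix (Fin d) (Fin d) ℂ) *ᵥ Pi.single b 1 =
      ((Complex.I - 1) / 2) • Pi.single a 1 + ((1 + Complex.I) / 2) • Pi.single b 1 := by
  ext i
  by_cases h : i = b
  · subst h
    simp [mixGate, Matrix.vecMulVec_apply, hab.symm]; ring
  · simp [mixGate, Matrix.vecMulVec_apply, hab.symm, h]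

theorem mixGate_mulVec_of_ne {d : ℕ} (a b : Fin d) (hab : a ≠ b) {c : Fin d} (ha : c ≠ a)
    (hb : c ≠ b) :
    ((mixGate a b hab : Gate d) : Matrix (Fin d) (Fin d) ℂ) *ᵥ Pi.single c 1 = Pi.single c 1 := by
  ext i
  simp [mixGate, Matrix.vecMulVec_apply, ha.symm, hb.symm, Matrix.one_apply, Pi.single_apply]

/-- The transpose of a gate. -/
def transposeGate {d : ℕ} (U : Gate d) : Gate d :=
  ⟨(U : Matrix (Fin d) (Fin d) ℂ)ᵀ, by
    have h : (U : Matrix (Fin d) (Fin d) ℂ) * (U : Matrix (Fin d) (Fin d) ℂ)ᴴ = 1 :=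
      Matrix.mem_unitaryGroup_iff.mp U.2
    rw [Matrix.mem_unitaryGroup_iff', Matrix.star_eq_conjTranspose, ← Matrix.transpose_one, ← h,
      Matrix.transpose_mul]
    rfl⟩

/-! ### The commutant of `U ⊗ U ⊗ U` -/

/-- The index set of three `d`-dimensional systems. -/
abbrev Tri (d : ℕ) : Type := (Fin d × Fin d) × Fin d

/-- The matrix `U ⊗ U ⊗ U`. -/
def threeCopies {d : ℕ} (U : Gate d) : Matrix (Tri d) (Tri d) ℂ :=
  twoCopies U ⊗ₖ (U : Matrix (Fin d) (Fin d) ℂ)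

/-- The product vector `u ⊗ v ⊗ w`. -/
def triVec {d : ℕ} (u v w : Fin d → ℂ) : Tri d → ℂ := fun p => u p.1.1 * v p.1.2 * w p.2

/-- The linear combination with coefficients `c` of the six permutations of three systems. -/
def permComb {d : ℕ} (c : Fin 6 → ℂ) : Matrix (Tri d) (Tri d) ℂ := Matrix.of fun p q =>
  c 0 * (if p.1.1 = q.1.1 ∧ p.1.2 = q.1.2 ∧ p.2 = q.2 then 1 else 0) +
  c 1 * (if p.1.1 = q.1.2 ∧ p.1.2 = q.1.1 ∧ p.2 = q.2 then 1 else 0) +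
  c 2 * (if p.1.1 = q.1.1 ∧ p.1.2 = q.2 ∧ p.2 = q.1.2 then 1 else 0) +
  c 3 * (if p.1.1 = q.2 ∧ p.1.2 = q.1.2 ∧ p.2 = q.1.1 then 1 else 0) +
  c 4 * (if p.1.1 = q.1.2 ∧ p.1.2 = q.2 ∧ p.2 = q.1.1 then 1 else 0) +
  c 5 * (if p.1.1 = q.2 ∧ p.1.2 = q.1.1 ∧ p.2 = q.1.2 then 1 else 0)

section Tri
variable {d : ℕ}

theorem threeCopies_mulVec_triVec (U : Gate d) (u v w : Fin d → ℂ) :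
    threeCopies U *ᵥ triVec u v w = triVec ((U : Matrix (Fin d) (Fin d) ℂ) *ᵥ u)
      ((U : Matrix (Fin d) (Fin d) ℂ) *ᵥ v) ((U : Matrix (Fin d) (Fin d) ℂ) *ᵥ w) := by
  ext p
  simp only [threeCopies, twoCopies, Matrix.mulVec, dotProduct, triVec, Matrix.kroneckerMap_apply,
    Fintype.sum_prod_type]
  rw [Finset.sum_mul_sum, Finset.sum_mul]
  refine Finset.sum_congr rfl fun i _ => ?_
  rw [Finset.sum_mul]
  refine Finset.sum_congr rfl fun j _ => ?_
  rw [Finset.mul_sum]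
  refine Finset.sum_congr rfl fun k _ => ?_
  ring

theorem permComb_mulVec_triVec (c : Fin 6 → ℂ) (u v w : Fin d → ℂ) :
    permComb c *ᵥ triVec u v w = c 0 • triVec u v w + c 1 • triVec v u w + c 2 • triVec u w v +
      c 3 • triVec w v u + c 4 • triVec v w u + c 5 • triVec w u v := by
  ext p
  simp only [permComb, Matrix.mulVec, dotProduct, triVec, Matrix.of_apply, Fintype.sum_prod_type,
    add_mul, Finset.sum_add_distrib, ite_and, mul_ite, mul_one, mul_zero, ite_mul, zero_mul,
    Pi.add_apply, Pi.smul_apply, smul_eq_mul]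
  simp [Finset.sum_ite_irrel]
  ring

theorem permComb_commute (c : Fin 6 → ℂ) (U : Gate d) :
    threeCopies U * permComb c = permComb c * threeCopies U := by
  ext p q
  simp only [permComb, threeCopies, twoCopies, Matrix.mul_apply, Matrix.of_apply,
    Fintype.sum_prod_type, Matrix.kroneckerMap_apply,
    add_mul, mul_add, Finset.sum_add_distrib, ite_and, mul_ite, mul_one, mul_zero, ite_mul,
    zero_mul]
  simp [Finset.sum_ite_irrel]
  ring

theorem triVec_single (a b c : Fin d) :
    triVec (Pi.single a 1) (Pi.single b 1) (Pi.single c 1) = Pi.single ((a, b), c) 1 := by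
  ext p
  obtain ⟨⟨i, j⟩, k⟩ := p
  simp only [triVec, Pi.single_apply, Prod.mk.injEq]
  split_ifs <;> simp_all

theorem exists_perm_three {x₀ x₁ x₂ a b c : Fin d} (h01 : x₀ ≠ x₁) (h02 : x₀ ≠ x₂) (h12 : x₁ ≠ x₂)
    (hab : a ≠ b) (hac : a ≠ c) (hbc : b ≠ c) :
    ∃ π : Equiv.Perm (Fin d), π x₀ = a ∧ π x₁ = b ∧ π x₂ = c := by
  obtain ⟨σ, h0, h1⟩ : ∃ σ : Equiv.Perm (Fin d), σ x₀ = a ∧ σ x₁ = b := by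
    refine ⟨Equiv.swap x₀ a |>.trans (Equiv.swap (Equiv.swap x₀ a x₁) b), ?_, by simp⟩
    have h : a ≠ Equiv.swap x₀ a x₁ := fun h => h01 <| (Equiv.swap x₀ a).injective <| by
      rw [← h, Equiv.swap_apply_left]
    simp [Equiv.swap_apply_of_ne_of_ne h hab]
  have ha : a ≠ σ x₂ := fun h => h02 <| σ.injective <| by rw [← h, h0]
  have hb : b ≠ σ x₂ := fun h => h12 <| σ.injective <| by rw [← h, h1]
  exact ⟨σ.trans (Equiv.swap (σ x₂) c), by simp [h0, Equiv.swap_apply_of_ne_of_ne ha hac],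
    by simp [h1, Equiv.swap_apply_of_ne_of_ne hb hbc], by simp⟩

/-- The basis vector `e_a ⊗ e_b ⊗ e_c`. -/
def triBasis (a b c : Fin d) : Tri d → ℂ :=
  triVec (Pi.single a 1) (Pi.single b 1) (Pi.single c 1)

theorem triBasis_apply (a b c : Fin d) (p : Tri d) :
    triBasis a b c p = if p = ((a, b), c) then 1 else 0 := by
  rw [triBasis, triVec_single, Pi.single_apply]

theorem mulVec_triBasis (Y : Matrix (Tri d) (Tri d) ℂ) (a b c : Fin d) (p : Tri d) :
    (Y *ᵥ triBasis a b c) p = Y p ((a, b), c) := by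
  rw [triBasis, triVec_single]
  simp

theorem eq_zero_of_mulVec_triBasis {Y : Matrix (Tri d) (Tri d) ℂ}
    (h : ∀ a b c, Y *ᵥ triBasis a b c = 0) : Y = 0 := by
  ext p ⟨⟨a, b⟩, c⟩
  rw [← mulVec_triBasis Y, h]
  simp

/-- The number of systems in state `a`, as an exponent. -/
def weight (a : Fin d) (p : Tri d) : ℕ :=
  (if p.1.1 = a then 1 else 0) + (if p.1.2 = a then 1 else 0) + (if p.2 = a then 1 else 0)

theorem threeCopies_phaseGate_mulVec (a : Fin d) (x : Tri d → ℂ) (p : Tri d) :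
    (threeCopies (phaseGate a) *ᵥ x) p = Complex.I ^ weight a p * x p := by
  have h : threeCopies (phaseGate a) = Matrix.diagonal fun p => Complex.I ^ weight a p := by
    simp only [threeCopies, twoCopies, phaseGate, Matrix.diagonal_kronecker_diagonal]
    congr 1
    funext p
    simp only [weight, pow_add, pow_ite, pow_one, pow_zero]
  rw [h, Matrix.mulVec_diagonal]

section Commutant
variable {Y : Matrix (Tri d) (Tri d) ℂ}

theorem mulVec_threeCopies (hY : ∀ U, threeCopies U * Y = Y * threeCopies U)
    (U : Gate d) (x : Tri d → ℂ) :
    Y *ᵥ (threeCopies U *ᵥ x) = threeCopies U *ᵥ (Y *ᵥ x) := by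
  rw [Matrix.mulVec_mulVec, Matrix.mulVec_mulVec, hY]

theorem threeCopies_phaseGate_triBasis (a : Fin d) (q : Tri d) :
    threeCopies (phaseGate a) *ᵥ triBasis q.1.1 q.1.2 q.2 =
      Complex.I ^ weight a q • triBasis q.1.1 q.1.2 q.2 := by
  ext p
  rw [threeCopies_phaseGate_mulVec, Pi.smul_apply, triBasis_apply, smul_eq_mul]
  by_cases h : p = q
  · subst h; rfl
  · simp [h]

/-- Phase gates commute with `Y`, and `i ^ k` separates the exponents `k ≤ 3`: so `Y` preserves the
number of systems in each basis state. -/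
theorem entry_eq_zero_of_weight (hY : ∀ U, threeCopies U * Y = Y * threeCopies U)
    {a : Fin d} {p q : Tri d} (h : weight a p ≠ weight a q) :
    Y p q = 0 := by
  have h1 := congrFun (mulVec_threeCopies hY (phaseGate a) (triBasis q.1.1 q.1.2 q.2)) p
  rw [threeCopies_phaseGate_triBasis, threeCopies_phaseGate_mulVec, Matrix.mulVec_smul,
    Pi.smul_apply, mulVec_triBasis, smul_eq_mul] at h1
  have h2 : ∀ r : Tri d, weight a r ≤ 3 := fun r => by
    unfold weight; split_ifs <;> norm_num
  have h3 : Complex.I ^ weight a q ≠ Complex.I ^ weight a p := by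
    have hp := h2 p
    have hq := h2 q
    intro h4
    apply h
    generalize weight a p = x at *
    generalize weight a q = y at *
    have e2 : (Complex.I) ^ 2 = -1 := Complex.I_sq
    have e3 : (Complex.I) ^ 3 = -Complex.I := Complex.I_pow_three
    interval_cases x <;> interval_cases y <;> first
      | rfl
      | (exfalso; simp only [e2, e3, pow_zero, pow_one] at h4
         have hr := congrArg Complex.re h4
         have hi := congrArg Complex.im h4
         simp at hr hi
         try linarith)
  have h5 : (Complex.I ^ weight a q - Complex.I ^ weight a p) * Y p q = 0 := by
    linear_combination h1
  exact (mul_eq_zero.mp h5).resolve_left (sub_ne_zero.mpr h3)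

theorem mulVec_triBasis_perm (hY : ∀ U, threeCopies U * Y = Y * threeCopies U)
    (π : Equiv.Perm (Fin d)) {a b c : Fin d}
    (h : Y *ᵥ triBasis a b c = 0) : Y *ᵥ triBasis (π a) (π b) (π c) = 0 := by
  have h1 := mulVec_threeCopies hY (permGate π) (triBasis a b c)
  rwa [h, Matrix.mulVec_zero, triBasis, threeCopies_mulVec_triVec, permGate_mulVec,
    permGate_mulVec, permGate_mulVec] at h1

end Commutant

end Tri

section Tri
variable {d : ℕ}

theorem triVec_expand (α β γ δ ε ζ : ℂ) (a a' b b' c c' : Fin d) :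
    triVec (α • Pi.single a 1 + β • Pi.single a' 1) (γ • Pi.single b 1 + δ • Pi.single b' 1)
      (ε • Pi.single c 1 + ζ • Pi.single c' 1) =
    (α * γ * ε) • triBasis a b c + (α * γ * ζ) • triBasis a b c' +
    (α * δ * ε) • triBasis a b' c + (α * δ * ζ) • triBasis a b' c' +
    (β * γ * ε) • triBasis a' b c + (β * γ * ζ) • triBasis a' b c' +
    (β * δ * ε) • triBasis a' b' c + (β * δ * ζ) • triBasis a' b' c' := by
  ext p
  simp only [triBasis, triVec, Pi.add_apply, Pi.smul_apply, smul_eq_mul]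
  ring

variable {Y : Matrix (Tri d) (Tri d) ℂ}

theorem mulVec_triVec_eq_zero (hY : ∀ U, threeCopies U * Y = Y * threeCopies U) {a b c : Fin d}
    (h : Y *ᵥ triBasis a b c = 0) (U : Gate d) :
    Y *ᵥ triVec ((U : Matrix (Fin d) (Fin d) ℂ) *ᵥ Pi.single a 1)
      ((U : Matrix (Fin d) (Fin d) ℂ) *ᵥ Pi.single b 1)
      ((U : Matrix (Fin d) (Fin d) ℂ) *ᵥ Pi.single c 1) = 0 := by
  rw [← threeCopies_mulVec_triVec, mulVec_threeCopies hY, ← triBasis, h, Matrix.mulVec_zero]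

theorem add_I_div_ne_zero : ((1 + Complex.I) / 2 : ℂ) ≠ 0 := by
  intro h
  have := congrArg Complex.re h
  norm_num at this

theorem sub_I_div_ne_zero : ((Complex.I - 1) / 2 : ℂ) ≠ 0 := by
  intro h
  have := congrArg Complex.re h
  norm_num at this

/-- Two images of basis vectors of different weights are linearly independent unless they vanish. -/
theorem mulVec_triBasis_eq_zero_of_add (hY : ∀ U, threeCopies U * Y = Y * threeCopies U)
    {a : Fin d} {p q : Tri d} (hw : weight a p ≠ weight a q) {α β : ℂ} (hα : α ≠ 0)
    (h : α • (Y *ᵥ triBasis p.1.1 p.1.2 p.2) + β • (Y *ᵥ triBasis q.1.1 q.1.2 q.2) = 0) :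
    Y *ᵥ triBasis p.1.1 p.1.2 p.2 = 0 := by
  ext r
  have h1 := congrFun h r
  simp only [Pi.add_apply, Pi.smul_apply, mulVec_triBasis, smul_eq_mul, Pi.zero_apply] at h1 ⊢
  by_cases hr : weight a r = weight a p
  · have h2 : Y r q = 0 := entry_eq_zero_of_weight hY (a := a) (by rw [hr]; exact hw)
    change α * Y r p + β * Y r q = 0 at h1
    rw [h2, mul_zero, add_zero] at h1
    exact (mul_eq_zero.mp h1).resolve_left hα
  · exact entry_eq_zero_of_weight hY hr

/-- For distinct `a`, `b`, `c` the vector `e_a ⊗ e_b ⊗ e_c` is cyclic for the matrices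
`U ⊗ U ⊗ U`. -/
theorem eq_zero_of_mulVec_distinct (hY : ∀ U, threeCopies U * Y = Y * threeCopies U)
    {a b c : Fin d} (hab : a ≠ b) (hac : a ≠ c) (hbc : b ≠ c)
    (h : Y *ᵥ triBasis a b c = 0) : Y = 0 := by
  have H1 : ∀ x y z : Fin d, x ≠ y → x ≠ z → y ≠ z → Y *ᵥ triBasis x y z = 0 := by
    intro x y z hxy hxz hyz
    obtain ⟨π, rfl, rfl, rfl⟩ := exists_perm_three hab hac hbc hxy hxz hyz
    exact mulVec_triBasis_perm hY π h
  have hthird : ∀ x z : Fin d, ∃ y, y ≠ x ∧ y ≠ z := by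
    intro x z
    by_cases h1 : a ≠ x ∧ a ≠ z
    · exact ⟨a, h1⟩
    by_cases h2 : b ≠ x ∧ b ≠ z
    · exact ⟨b, h2⟩
    refine ⟨c, ?_⟩
    grind
  have hαβ := mul_ne_zero add_I_div_ne_zero sub_I_div_ne_zero
  have H2 : ∀ x z : Fin d, x ≠ z → Y *ᵥ triBasis x x z = 0 ∧ Y *ᵥ triBasis x z x = 0 ∧
      Y *ᵥ triBasis z x x = 0 := by
    intro x z hxz
    obtain ⟨y, hyx, hyz⟩ := hthird x z
    have hz : (Pi.single z 1 : Fin d → ℂ) = (1 : ℂ) • Pi.single z 1 + (0 : ℂ) • Pi.single z 1 := by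
      simp
    refine ⟨?_, ?_, ?_⟩
    · have h1 := mulVec_triVec_eq_zero hY (H1 x y z hyx.symm hxz hyz) (mixGate x y hyx.symm)
      rw [mixGate_mulVec_left, mixGate_mulVec_right, mixGate_mulVec_of_ne _ _ _ hxz.symm hyz.symm,
        hz, triVec_expand] at h1
      simp only [Matrix.mulVec_add, Matrix.mulVec_smul, H1 x y z hyx.symm hxz hyz,
        H1 y x z hyx hyz hxz, mul_zero, zero_smul, smul_zero, add_zero, mul_one] at h1
      exact mulVec_triBasis_eq_zero_of_add hY (a := x) (p := ((x, x), z)) (q := ((y, y), z))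
        (by simp [weight, hxz.symm, hyx]) hαβ h1
    · have h1 := mulVec_triVec_eq_zero hY (H1 x z y hxz hyx.symm hyz.symm) (mixGate x y hyx.symm)
      rw [mixGate_mulVec_left, mixGate_mulVec_right, mixGate_mulVec_of_ne _ _ _ hxz.symm hyz.symm,
        hz, triVec_expand] at h1
      simp only [Matrix.mulVec_add, Matrix.mulVec_smul, H1 x z y hxz hyx.symm hyz.symm,
        H1 y z x hyz hyx hxz.symm, mul_zero, zero_mul, zero_smul, smul_zero, add_zero,
        mul_one] at h1
      exact mulVec_triBasis_eq_zero_of_add hY (a := x) (p := ((x, z), x)) (q := ((y, z), y))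
        (by simp [weight, hxz.symm, hyx]) hαβ h1
    · have h1 := mulVec_triVec_eq_zero hY (H1 z x y hxz.symm hyz.symm hyx.symm)
        (mixGate x y hyx.symm)
      rw [mixGate_mulVec_left, mixGate_mulVec_right, mixGate_mulVec_of_ne _ _ _ hxz.symm hyz.symm,
        hz, triVec_expand] at h1
      simp only [Matrix.mulVec_add, Matrix.mulVec_smul, H1 z x y hxz.symm hyz.symm hyx.symm,
        H1 z y x hyz.symm hxz.symm hyx, zero_mul, zero_smul, smul_zero, add_zero, one_mul] at h1
      exact mulVec_triBasis_eq_zero_of_add hY (a := x) (p := ((z, x), x)) (q := ((z, y), y))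
        (by simp [weight, hxz.symm, hyx]) hαβ h1
  have H3 : ∀ x : Fin d, Y *ᵥ triBasis x x x = 0 := by
    intro x
    obtain ⟨z, hzx, -⟩ := hthird x x
    have h1 := mulVec_triVec_eq_zero hY (H2 x z hzx.symm).1 (mixGate x z hzx.symm)
    rw [mixGate_mulVec_left, mixGate_mulVec_right, triVec_expand] at h1
    simp only [Matrix.mulVec_add, Matrix.mulVec_smul, (H2 x z hzx.symm).1, (H2 x z hzx.symm).2.1,
      (H2 x z hzx.symm).2.2, (H2 z x hzx).1, (H2 z x hzx).2.1, (H2 z x hzx).2.2,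
      smul_zero, add_zero] at h1
    exact mulVec_triBasis_eq_zero_of_add hY (a := x) (p := ((x, x), x)) (q := ((z, z), z))
      (by simp [weight, hzx]) (mul_ne_zero (mul_ne_zero add_I_div_ne_zero add_I_div_ne_zero)
        sub_I_div_ne_zero) h1
  refine eq_zero_of_mulVec_triBasis fun x y z => ?_
  by_cases hxy : x = y
  · subst hxy
    by_cases hxz : x = z
    · subst hxz; exact H3 x
    · exact (H2 x z hxz).1
  · by_cases hxz : x = z
    · subst hxz; exact (H2 x y hxy).2.1
    · by_cases hyz : y = z
      · subst hyz; exact (H2 y x (Ne.symm hxy)).2.2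
      · exact H1 x y z hxy hxz hyz

theorem sub_permComb_commute (hY : ∀ U, threeCopies U * Y = Y * threeCopies U) (c : Fin 6 → ℂ)
    (U : Gate d) : threeCopies U * (Y - permComb c) = (Y - permComb c) * threeCopies U := by
  rw [Matrix.mul_sub, Matrix.sub_mul, hY, permComb_commute]

/-- For `d ≥ 3`, read off the coefficients from the image of `e_a ⊗ e_b ⊗ e_c`: by weights, this
image is a combination of the six permuted vectors, and the difference kills a cyclic vector. -/
theorem exists_permComb_of_distinct (hY : ∀ U, threeCopies U * Y = Y * threeCopies U)
    {a b c : Fin d} (hab : a ≠ b) (hac : a ≠ c) (hbc : b ≠ c) :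
    ∃ x : Fin 6 → ℂ, Y = permComb x := by
  refine ⟨![Y ((a, b), c) ((a, b), c), Y ((b, a), c) ((a, b), c), Y ((a, c), b) ((a, b), c),
    Y ((c, b), a) ((a, b), c), Y ((b, c), a) ((a, b), c), Y ((c, a), b) ((a, b), c)], ?_⟩
  rw [← sub_eq_zero]
  refine eq_zero_of_mulVec_distinct (sub_permComb_commute hY _) hab hac hbc ?_
  ext ⟨⟨i, j⟩, k⟩
  rw [Matrix.sub_mulVec, Pi.sub_apply, mulVec_triBasis, triBasis, permComb_mulVec_triVec]
  simp only [Pi.add_apply, Pi.smul_apply, ← triBasis.eq_1, triBasis_apply, Prod.mk.injEq,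
    smul_eq_mul, Pi.zero_apply, and_assoc]
  by_cases h1 : i = a ∧ j = b ∧ k = c
  · obtain ⟨rfl, rfl, rfl⟩ := h1; simp [hab, hac, hbc, hab.symm, hac.symm, hbc.symm]
  by_cases h2 : i = b ∧ j = a ∧ k = c
  · obtain ⟨rfl, rfl, rfl⟩ := h2; simp [hab, hac, hbc, hab.symm, hac.symm, hbc.symm]
  by_cases h3 : i = a ∧ j = c ∧ k = b
  · obtain ⟨rfl, rfl, rfl⟩ := h3; simp [hab, hac, hbc, hab.symm, hac.symm, hbc.symm]
  by_cases h4 : i = c ∧ j = b ∧ k = a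
  · obtain ⟨rfl, rfl, rfl⟩ := h4; simp [hab, hac, hbc, hab.symm, hac.symm, hbc.symm]
  by_cases h5 : i = b ∧ j = c ∧ k = a
  · obtain ⟨rfl, rfl, rfl⟩ := h5; simp [hab, hac, hbc, hab.symm, hac.symm, hbc.symm]
  by_cases h6 : i = c ∧ j = a ∧ k = b
  · obtain ⟨rfl, rfl, rfl⟩ := h6; simp [hab, hac, hbc, hab.symm, hac.symm, hbc.symm]
  have h0 : Y ((i, j), k) ((a, b), c) = 0 := by
    by_contra hne
    have hw : ∀ x, weight x ((i, j), k) = weight x ((a, b), c) := fun x => by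
      by_contra hx
      exact hne (entry_eq_zero_of_weight hY hx)
    have ha := hw a
    have hb := hw b
    have hc := hw c
    simp only [weight, hab, hac, hbc, hab.symm, hac.symm, hbc.symm, if_true, if_false] at ha hb hc
    clear hw hne hY
    grind
  rw [h0]
  simp only [h1, h2, h3, h4, h5, h6, if_false]
  simp

/-- On the basis vectors with a single `1`, a matrix in the commutant of `U ⊗ U ⊗ U` has constant
row sums. -/
theorem sum_entries_two {Y : Matrix (Tri 2) (Tri 2) ℂ}
    (hY : ∀ U, threeCopies U * Y = Y * threeCopies U) (r : Tri 2) (hr : weight 0 r = 2) :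
    Y r ((0, 0), 1) + Y r ((0, 1), 0) + Y r ((1, 0), 0) = Y ((0, 0), 0) ((0, 0), 0) := by
  have h2 : r = ((0, 0), 1) ∨ r = ((0, 1), 0) ∨ r = ((1, 0), 0) := by
    revert r; decide
  have hz : ∀ p q : Tri 2, weight 0 p ≠ weight 0 q → Y p q = 0 := fun p q h =>
    entry_eq_zero_of_weight hY h
  have h0 : Y *ᵥ triBasis 0 0 0 = Y ((0, 0), 0) ((0, 0), 0) • triBasis 0 0 0 := by
    ext p
    rw [mulVec_triBasis, Pi.smul_apply, triBasis_apply, smul_eq_mul]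
    by_cases hp : p = ((0, 0), 0)
    · subst hp; simp
    · rw [if_neg hp, mul_zero]
      refine hz _ _ ?_
      revert p
      decide
  have h1 := congrFun (mulVec_threeCopies hY (mixGate 0 1 zero_ne_one) (triBasis 0 0 0)) r
  rw [h0, Matrix.mulVec_smul, triBasis, threeCopies_mulVec_triVec, mixGate_mulVec_left,
    triVec_expand] at h1
  simp only [Matrix.mulVec_add, Matrix.mulVec_smul, Pi.add_apply, Pi.smul_apply, mulVec_triBasis,
    triBasis_apply, smul_eq_mul] at h1
  rw [hz r ((0, 0), 0) (by rw [hr]; decide), hz r ((0, 1), 1) (by rw [hr]; decide),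
    hz r ((1, 0), 1) (by rw [hr]; decide), hz r ((1, 1), 0) (by rw [hr]; decide),
    hz r ((1, 1), 1) (by rw [hr]; decide)] at h1
  have hne := mul_ne_zero (mul_ne_zero add_I_div_ne_zero add_I_div_ne_zero) sub_I_div_ne_zero
  refine mul_left_cancel₀ hne ?_
  rcases h2 with rfl | rfl | rfl <;> simp [-mul_eq_mul_left_iff] at h1 ⊢ <;> linear_combination h1

/-- The commutant is closed under transposition, because the gates are. -/
theorem transpose_commute (hY : ∀ U, threeCopies U * Y = Y * threeCopies U) (U : Gate d) :
    threeCopies U * Yᵀ = Yᵀ * threeCopies U := by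
  have h : (threeCopies (transposeGate U))ᵀ = threeCopies U := by
    ext p q
    simp [threeCopies, twoCopies, transposeGate]
  have h1 := congrArg Matrix.transpose (hY (transposeGate U))
  rw [Matrix.transpose_mul, Matrix.transpose_mul, h] at h1
  exact h1.symm

/-- For `d = 2` there is no basis vector with three distinct labels. The block of `Y` on the
vectors with a single `1` determines `Y`, and it has constant row and column sums. -/
theorem exists_permComb_two {Y : Matrix (Tri 2) (Tri 2) ℂ}
    (hY : ∀ U, threeCopies U * Y = Y * threeCopies U) : ∃ x : Fin 6 → ℂ, Y = permComb x := by
  have hY' := transpose_commute hY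
  have r1 := sum_entries_two hY ((0, 0), 1) (by decide)
  have r2 := sum_entries_two hY ((0, 1), 0) (by decide)
  have r3 := sum_entries_two hY ((1, 0), 0) (by decide)
  have c1 := sum_entries_two hY' ((0, 0), 1) (by decide)
  have c2 := sum_entries_two hY' ((0, 1), 0) (by decide)
  have c3 := sum_entries_two hY' ((1, 0), 0) (by decide)
  simp only [Matrix.transpose_apply] at c1 c2 c3
  -- A matrix with constant row and column sums is a combination of permutation matrices, and the
  -- coefficient of the identity may be taken to be zero.
  let x : Fin 6 → ℂ := ![0, Y ((0, 0), 1) ((0, 0), 1), Y ((1, 0), 0) ((1, 0), 0),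
    Y ((0, 1), 0) ((0, 1), 0), Y ((0, 1), 0) ((0, 0), 1) - Y ((1, 0), 0) ((1, 0), 0),
    Y ((0, 0), 1) ((0, 1), 0) - Y ((1, 0), 0) ((1, 0), 0)]
  refine ⟨x, ?_⟩
  have hZ := sub_permComb_commute hY x
  rw [← sub_eq_zero]
  set Z := Y - permComb x with hZdef
  have hz : ∀ p q : Tri 2, weight 0 p ≠ weight 0 q → Z p q = 0 := fun p q h =>
    entry_eq_zero_of_weight hZ h
  have hw2 : ∀ p : Tri 2, weight 0 p = 2 → p = ((0, 0), 1) ∨ p = ((0, 1), 0) ∨ p = ((1, 0), 0) := by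
    decide
  have hw3 : ∀ p : Tri 2, weight 0 p = 3 → p = ((0, 0), 0) := by decide
  have e1 : Z *ᵥ triBasis 0 0 1 = 0 := by
    ext p
    rw [mulVec_triBasis, Pi.zero_apply]
    by_cases hp : weight 0 p = 2
    · rcases hw2 p hp with rfl | rfl | rfl <;>
        simp only [hZdef, permComb, x, Matrix.sub_apply, Matrix.of_apply] <;> simp <;> grind
    · exact hz _ _ (by simpa [weight] using hp)
  have e2 : Z *ᵥ triBasis 0 1 0 = 0 := by
    ext p
    rw [mulVec_triBasis, Pi.zero_apply]
    by_cases hp : weight 0 p = 2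
    · rcases hw2 p hp with rfl | rfl | rfl <;>
        simp only [hZdef, permComb, x, Matrix.sub_apply, Matrix.of_apply] <;> simp <;> grind
    · exact hz _ _ (by simpa [weight] using hp)
  have e3 : Z *ᵥ triBasis 1 0 0 = 0 := by
    ext p
    rw [mulVec_triBasis, Pi.zero_apply]
    by_cases hp : weight 0 p = 2
    · rcases hw2 p hp with rfl | rfl | rfl <;>
        simp only [hZdef, permComb, x, Matrix.sub_apply, Matrix.of_apply] <;> simp <;> grind
    · exact hz _ _ (by simpa [weight] using hp)
  have e0 : Z *ᵥ triBasis 0 0 0 = 0 := by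
    ext p
    rw [mulVec_triBasis, Pi.zero_apply]
    by_cases hp : weight 0 p = 3
    · obtain rfl := hw3 p hp
      simp only [hZdef, permComb, x, Matrix.sub_apply, Matrix.of_apply]
      simp
      grind
    · exact hz _ _ (by simpa [weight] using hp)
  have hflip : ∀ a b c : Fin 2, Z *ᵥ triBasis a b c = 0 →
      Z *ᵥ triBasis (Equiv.swap 0 1 a) (Equiv.swap 0 1 b) (Equiv.swap 0 1 c) = 0 :=
    fun a b c h => mulVec_triBasis_perm hZ _ h
  refine eq_zero_of_mulVec_triBasis fun a b c => ?_
  fin_cases a <;> fin_cases b <;> fin_cases c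
  · exact e0
  · exact e1
  · exact e2
  · simpa using hflip _ _ _ e3
  · exact e3
  · simpa using hflip _ _ _ e2
  · simpa using hflip _ _ _ e1
  · simpa using hflip _ _ _ e0

/-- The commutant of the matrices `U ⊗ U ⊗ U` is spanned by the permutations of the three
systems. -/
theorem exists_permComb (hd : 2 ≤ d) (hY : ∀ U, threeCopies U * Y = Y * threeCopies U) :
    ∃ x : Fin 6 → ℂ, Y = permComb x := by
  obtain rfl | h3 : 2 = d ∨ 3 ≤ d := by omega
  · exact exists_permComb_two hY
  · exact exists_permComb_of_distinct hY (a := ⟨0, by omega⟩) (b := ⟨1, by omega⟩)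
      (c := ⟨2, by omega⟩) (by simp) (by simp) (by simp)

end Tri

/-! ### The commutant of `U ⊗ U ⊗ conj U` -/

/-- The matrix `U ⊗ U ⊗ conj U`. -/
def mixedRep {d : ℕ} (U : Gate d) : Matrix (Tri d) (Tri d) ℂ :=
  twoCopies U ⊗ₖ (U : Matrix (Fin d) (Fin d) ℂ).map star

/-- The sign by which the swap acts on symmetric (`true`) or antisymmetric (`false`) vectors. -/
def sgn : Bool → ℝ
  | true => 1
  | false => -1

/-- The swap of the first two systems. -/
def swapMat (d : ℕ) : Matrix (Tri d) (Tri d) ℂ :=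
  Matrix.of fun p q => if p.1.1 = q.1.2 ∧ p.1.2 = q.1.1 ∧ p.2 = q.2 then 1 else 0

/-- The map `v ↦ v ⊗ ∑ i, e_i ⊗ e_i`. -/
def pairMat (d : ℕ) : Matrix (Tri d) (Fin d) ℂ :=
  Matrix.of fun p v => if p.1.1 = v ∧ p.1.2 = p.2 then 1 else 0

/-- The projection to the vectors which are symmetric or antisymmetric in the first two systems. -/
def symProj (d : ℕ) (ε : Bool) : Matrix (Tri d) (Tri d) ℂ :=
  (2⁻¹ : ℂ) • (1 + (sgn ε : ℂ) • swapMat d)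

/-- The square of `tau d ε` is `1 / d` times the dimension of the symmetric or antisymmetric
square of `ℂ ^ d`. -/
def tau (d : ℕ) (ε : Bool) : ℝ := Real.sqrt ((d + sgn ε) / 2)

/-- The isometric intertwiner from `U` to the symmetric or antisymmetric part of
`U ⊗ U ⊗ conj U`. -/
def embed (d : ℕ) (ε : Bool) : Matrix (Tri d) (Fin d) ℂ :=
  ((tau d ε)⁻¹ : ℂ) • (symProj d ε * pairMat d)

/-- The projection to the complement of the range of `embed d ε` in the symmetric or antisymmetric
part. -/
def restProj (d : ℕ) (ε : Bool) : Matrix (Tri d) (Tri d) ℂ :=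
  symProj d ε - embed d ε * (embed d ε)ᴴ

section
variable {d : ℕ}

theorem gate_conjTranspose_mul (U : Gate d) :
    (U : Matrix (Fin d) (Fin d) ℂ)ᴴ * (U : Matrix (Fin d) (Fin d) ℂ) = 1 :=
  Matrix.mem_unitaryGroup_iff'.mp U.2

theorem gate_mul_conjTranspose (U : Gate d) :
    (U : Matrix (Fin d) (Fin d) ℂ) * (U : Matrix (Fin d) (Fin d) ℂ)ᴴ = 1 :=
  Matrix.mem_unitaryGroup_iff.mp U.2

theorem gate_transpose_mul_map (U : Gate d) :
    (U : Matrix (Fin d) (Fin d) ℂ)ᵀ * (U : Matrix (Fin d) (Fin d) ℂ).map star = 1 := by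
  have h := congrArg Matrix.transpose (gate_conjTranspose_mul U)
  rw [Matrix.transpose_mul, Matrix.transpose_one] at h
  exact h

theorem gate_map_mul_transpose (U : Gate d) :
    (U : Matrix (Fin d) (Fin d) ℂ).map star * (U : Matrix (Fin d) (Fin d) ℂ)ᵀ = 1 :=
  mul_eq_one_comm.mp (gate_transpose_mul_map U)

theorem continuous_gate : Continuous fun U : Gate d => (U : Matrix (Fin d) (Fin d) ℂ) :=
  continuous_subtype_val

theorem isUnitaryRep_mixedRep : IsUnitaryRep (mixedRep (d := d)) where
  continuous := by
    refine continuous_matrix fun p q => ?_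
    have h : ∀ i j, Continuous fun U : Gate d => (U : Matrix (Fin d) (Fin d) ℂ) i j := fun i j =>
      continuous_gate.matrix_elem i j
    exact ((h _ _).mul (h _ _)).mul (h _ _).star
  map_mul V U := by
    have h : ((V * U : Gate d) : Matrix (Fin d) (Fin d) ℂ).map star =
        (V : Matrix (Fin d) (Fin d) ℂ).map star * (U : Matrix (Fin d) (Fin d) ℂ).map star := by
      ext i j
      simp [Matrix.mul_apply]
    rw [mixedRep, mixedRep, mixedRep, ← Matrix.mul_kronecker_mul, h, twoCopies, twoCopies,
      twoCopies, ← Matrix.mul_kronecker_mul]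
    rfl
  unitary U := by
    have h : ((U : Matrix (Fin d) (Fin d) ℂ).map star)ᴴ = (U : Matrix (Fin d) (Fin d) ℂ)ᵀ := by
      ext i j
      simp
    rw [mixedRep, Matrix.conjTranspose_kronecker, ← Matrix.mul_kronecker_mul, h,
      gate_transpose_mul_map, twoCopies, Matrix.conjTranspose_kronecker, ← Matrix.mul_kronecker_mul,
      gate_conjTranspose_mul, Matrix.one_kronecker_one, Matrix.one_kronecker_one]

theorem swapMat_mul_self : swapMat d * swapMat d = 1 := by
  ext p q
  simp only [swapMat, Matrix.mul_apply, Matrix.of_apply, Fintype.sum_prod_type, Matrix.one_apply,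
    Prod.ext_iff, ite_and, mul_ite, mul_one, mul_zero]
  simp [Finset.sum_ite_irrel]

theorem swapMat_conjTranspose : (swapMat d)ᴴ = swapMat d := by
  ext p q
  simp only [swapMat, Matrix.conjTranspose_apply, Matrix.of_apply, apply_ite star, star_one,
    star_zero]
  grind

theorem pairMat_conjTranspose_mul : (pairMat d)ᴴ * pairMat d = (d : ℂ) • 1 := by
  ext v w
  simp only [pairMat, Matrix.mul_apply, Matrix.of_apply, Matrix.conjTranspose_apply,
    apply_ite star, star_one, star_zero,
    Fintype.sum_prod_type, Matrix.smul_apply, Matrix.one_apply, ite_and, mul_ite, mul_one, mul_zero]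
  simp [Finset.sum_ite_irrel, eq_comm]

theorem pairMat_conjTranspose_mul_swapMat : (pairMat d)ᴴ * swapMat d * pairMat d = 1 := by
  ext v w
  simp only [pairMat, swapMat, Matrix.mul_apply, Matrix.of_apply, Matrix.conjTranspose_apply,
    apply_ite star, star_one, star_zero,
    Fintype.sum_prod_type, Matrix.one_apply, ite_and, mul_ite, mul_one, mul_zero]
  simp [Finset.sum_ite_irrel]
  grind

theorem mixedRep_mul_swapMat (U : Gate d) : mixedRep U * swapMat d = swapMat d * mixedRep U := by
  ext p q
  simp only [mixedRep, twoCopies, swapMat, Matrix.mul_apply, Matrix.of_apply,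
    Matrix.kroneckerMap_apply, Fintype.sum_prod_type, ite_and, mul_ite, mul_one, mul_zero,
    ite_mul, one_mul, zero_mul]
  simp [Finset.sum_ite_irrel]
  exact Or.inl (mul_comm _ _)

theorem mixedRep_mul_pairMat (U : Gate d) :
    mixedRep U * pairMat d = pairMat d * (U : Matrix (Fin d) (Fin d) ℂ) := by
  ext p v
  have h := congrFun (congrFun (gate_mul_conjTranspose U) p.1.2) p.2
  simp only [Matrix.mul_apply, Matrix.conjTranspose_apply, Matrix.one_apply] at h
  simp only [mixedRep, twoCopies, pairMat, Matrix.mul_apply, Matrix.of_apply,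
    Matrix.kroneckerMap_apply, Fintype.sum_prod_type, ite_and, mul_ite, mul_one, mul_zero,
    ite_mul, one_mul, zero_mul, Matrix.map_apply]
  simp [Finset.sum_ite_irrel]
  simp_rw [mul_assoc, ← Finset.mul_sum]
  simp at h
  rw [h]
  simp

end

section
variable {d : ℕ}

theorem sgn_mul_self (ε : Bool) : sgn ε * sgn ε = 1 := by
  cases ε <;> simp [sgn]

theorem add_sgn_pos (hd : 2 ≤ d) (ε : Bool) : 0 < ((d : ℝ) + sgn ε) / 2 := by
  have : (2 : ℝ) ≤ d := by exact_mod_cast hd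
  cases ε <;> simp only [sgn] <;> linarith

theorem tau_pos (hd : 2 ≤ d) (ε : Bool) : 0 < tau d ε := Real.sqrt_pos.mpr (add_sgn_pos hd ε)

theorem tau_sq (hd : 2 ≤ d) (ε : Bool) : tau d ε ^ 2 = (d + sgn ε) / 2 :=
  Real.sq_sqrt (add_sgn_pos hd ε).le

theorem tau_ne_zero (hd : 2 ≤ d) (ε : Bool) : (tau d ε : ℂ) ≠ 0 :=
  Complex.ofReal_ne_zero.mpr (tau_pos hd ε).ne'

theorem symProj_mul_swapMat (ε : Bool) : symProj d ε * swapMat d = (sgn ε : ℂ) • symProj d ε := by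
  have h : (sgn ε : ℂ) * (sgn ε : ℂ) = 1 := by exact_mod_cast sgn_mul_self ε
  have h1 : (1 + (sgn ε : ℂ) • swapMat d) * swapMat d =
      (sgn ε : ℂ) • (1 + (sgn ε : ℂ) • swapMat d) := by
    rw [Matrix.add_mul, Matrix.one_mul, Matrix.smul_mul, swapMat_mul_self, smul_add, smul_smul, h,
      one_smul, add_comm]
  rw [symProj, Matrix.smul_mul, h1, smul_comm]

theorem symProj_mul (ε ε' : Bool) :
    symProj d ε * symProj d ε' = if ε = ε' then symProj d ε else 0 := by
  have h : (sgn ε : ℂ) * (sgn ε : ℂ) = 1 := by exact_mod_cast sgn_mul_self ε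
  conv_lhs => rw [symProj.eq_1 d ε']
  rw [Matrix.mul_smul, Matrix.mul_add, Matrix.mul_smul, symProj_mul_swapMat, Matrix.mul_one,
    smul_smul, ← one_smul ℂ (symProj d ε), smul_smul, ← add_smul, smul_smul]
  split_ifs with h1
  · subst h1
    rw [mul_one, h]; norm_num
  · have : (sgn ε' : ℂ) * (sgn ε : ℂ) = -1 := by
      revert h1; cases ε <;> cases ε' <;> simp [sgn]
    rw [mul_one, this]; norm_num

theorem symProj_conjTranspose (ε : Bool) : (symProj d ε)ᴴ = symProj d ε := by
  simp [symProj, swapMat_conjTranspose]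

theorem pairMat_symProj_pairMat (ε : Bool) :
    (pairMat d)ᴴ * (symProj d ε * pairMat d) = (((d + sgn ε) / 2 : ℝ) : ℂ) • 1 := by
  rw [symProj, Matrix.smul_mul, Matrix.add_mul, Matrix.smul_mul, Matrix.one_mul, Matrix.mul_smul,
    Matrix.mul_add, Matrix.mul_smul, pairMat_conjTranspose_mul, ← Matrix.mul_assoc,
    pairMat_conjTranspose_mul_swapMat, ← add_smul, smul_smul]
  congr 1
  push_cast
  ring

theorem symProj_mul_embed (ε ε' : Bool) :
    symProj d ε * embed d ε' = if ε = ε' then embed d ε else 0 := by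
  rw [embed, Matrix.mul_smul, ← Matrix.mul_assoc, symProj_mul]
  split_ifs with h
  · subst h; rfl
  · simp

theorem embed_conjTranspose_mul_symProj (ε ε' : Bool) :
    (embed d ε)ᴴ * symProj d ε' = if ε = ε' then (embed d ε)ᴴ else 0 := by
  have h := congrArg Matrix.conjTranspose (symProj_mul_embed (d := d) ε' ε)
  rw [Matrix.conjTranspose_mul, symProj_conjTranspose] at h
  rw [h]
  by_cases h1 : ε = ε'
  · subst h1; simp
  · simp [h1, Ne.symm h1]

theorem embed_conjTranspose_mul (hd : 2 ≤ d) (ε ε' : Bool) :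
    (embed d ε)ᴴ * embed d ε' = if ε = ε' then 1 else 0 := by
  split_ifs with h
  · subst h
    have h1 : (embed d ε)ᴴ * embed d ε = ((tau d ε)⁻¹ : ℂ) • ((tau d ε)⁻¹ : ℂ) •
        ((pairMat d)ᴴ * (symProj d ε * pairMat d)) := by
      conv_lhs => rw [embed]
      rw [Matrix.conjTranspose_smul, Matrix.smul_mul, Matrix.mul_smul, Matrix.conjTranspose_mul,
        symProj_conjTranspose, Matrix.mul_assoc, ← Matrix.mul_assoc (symProj d ε), symProj_mul,
        if_pos rfl]
      simp
    rw [h1, pairMat_symProj_pairMat, smul_smul, smul_smul, ← tau_sq hd]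
    have := tau_ne_zero hd ε
    have h2 : ((tau d ε : ℂ))⁻¹ * ((tau d ε : ℂ))⁻¹ * ((tau d ε ^ 2 : ℝ) : ℂ) = 1 := by
      push_cast; field_simp
    rw [h2, one_smul]
  · have h1 : embed d ε' = symProj d ε' * embed d ε' := by simp [symProj_mul_embed]
    rw [h1, ← Matrix.mul_assoc, embed_conjTranspose_mul_symProj, if_neg h, Matrix.zero_mul]

theorem restProj_conjTranspose (ε : Bool) : (restProj d ε)ᴴ = restProj d ε := by
  simp [restProj, symProj_conjTranspose]

theorem restProj_mul_embed (hd : 2 ≤ d) (ε ε' : Bool) : restProj d ε * embed d ε' = 0 := by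
  rw [restProj, Matrix.sub_mul, symProj_mul_embed, Matrix.mul_assoc, embed_conjTranspose_mul hd]
  split_ifs <;> simp

theorem embed_conjTranspose_mul_restProj (hd : 2 ≤ d) (ε ε' : Bool) :
    (embed d ε')ᴴ * restProj d ε = 0 := by
  have h := congrArg Matrix.conjTranspose (restProj_mul_embed hd ε ε')
  rwa [Matrix.conjTranspose_mul, restProj_conjTranspose, Matrix.conjTranspose_zero] at h

theorem restProj_mul (hd : 2 ≤ d) (ε ε' : Bool) :
    restProj d ε * restProj d ε' = if ε = ε' then restProj d ε else 0 := by
  conv_lhs => rw [restProj.eq_1 d ε']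
  rw [Matrix.mul_sub, ← Matrix.mul_assoc, restProj_mul_embed hd, Matrix.zero_mul, sub_zero,
    restProj, Matrix.sub_mul, symProj_mul, Matrix.mul_assoc, embed_conjTranspose_mul_symProj]
  split_ifs <;> simp

theorem trace_swapMat : (swapMat d).trace = (d : ℂ) ^ 2 := by
  simp only [Matrix.trace, Matrix.diag_apply, swapMat, Matrix.of_apply, Fintype.sum_prod_type,
    ite_and]
  simp [Finset.sum_ite_irrel]
  ring

theorem trace_embed_mul (hd : 2 ≤ d) (ε ε' : Bool) :
    (embed d ε * (embed d ε')ᴴ).trace = if ε = ε' then (d : ℂ) else 0 := by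
  rw [Matrix.trace_mul_comm, embed_conjTranspose_mul hd]
  by_cases h : ε = ε'
  · simp [h]
  · simp [h, Ne.symm h]

theorem trace_restProj (hd : 2 ≤ d) (ε : Bool) :
    (restProj d ε).trace = ((d * (d * tau d ε ^ 2 - 1) : ℝ) : ℂ) := by
  rw [restProj, Matrix.trace_sub, trace_embed_mul hd, if_pos rfl, symProj, Matrix.trace_smul,
    Matrix.trace_add, Matrix.trace_smul, trace_swapMat, tau_sq hd]
  simp
  ring

/-- An orthogonal family which spans the commutant of `U ⊗ U ⊗ conj U`. -/
def commutantBasis (d : ℕ) : (Bool × Bool) ⊕ Bool → Matrix (Tri d) (Tri d) ℂ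
  | .inl ε => embed d ε.1 * (embed d ε.2)ᴴ
  | .inr ε => restProj d ε

theorem mixedRep_mul_symProj (U : Gate d) (ε : Bool) :
    mixedRep U * symProj d ε = symProj d ε * mixedRep U := by
  simp [symProj, Matrix.mul_add, Matrix.add_mul, mixedRep_mul_swapMat]

theorem mixedRep_mul_embed (U : Gate d) (ε : Bool) :
    mixedRep U * embed d ε = embed d ε * (U : Matrix (Fin d) (Fin d) ℂ) := by
  rw [embed, Matrix.mul_smul, ← Matrix.mul_assoc, mixedRep_mul_symProj, Matrix.mul_assoc,
    mixedRep_mul_pairMat, Matrix.smul_mul, Matrix.mul_assoc]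

theorem embed_conjTranspose_mul_mixedRep (U : Gate d) (ε : Bool) :
    (embed d ε)ᴴ * mixedRep U = (U : Matrix (Fin d) (Fin d) ℂ) * (embed d ε)ᴴ := by
  have h := congrArg Matrix.conjTranspose (mixedRep_mul_embed U ε)
  rw [Matrix.conjTranspose_mul, Matrix.conjTranspose_mul] at h
  calc (embed d ε)ᴴ * mixedRep U
      = (U : Matrix (Fin d) (Fin d) ℂ) * ((U : Matrix (Fin d) (Fin d) ℂ)ᴴ * (embed d ε)ᴴ) *
          mixedRep U := by
        rw [← Matrix.mul_assoc _ _ (embed d ε)ᴴ, gate_mul_conjTranspose, Matrix.one_mul]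
    _ = _ := by
        rw [← h, Matrix.mul_assoc, Matrix.mul_assoc, isUnitaryRep_mixedRep.unitary, Matrix.mul_one]

theorem commutantBasis_commute (s : (Bool × Bool) ⊕ Bool) (U : Gate d) :
    mixedRep U * commutantBasis d s = commutantBasis d s * mixedRep U := by
  have h : ∀ a b : Bool, mixedRep U * (embed d a * (embed d b)ᴴ) =
      embed d a * (embed d b)ᴴ * mixedRep U := fun a b => by
    rw [← Matrix.mul_assoc, mixedRep_mul_embed, Matrix.mul_assoc, Matrix.mul_assoc,
      embed_conjTranspose_mul_mixedRep]
  rcases s with ⟨a, b⟩ | ε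
  · exact h a b
  · simp only [commutantBasis, restProj]
    rw [Matrix.mul_sub, Matrix.sub_mul, mixedRep_mul_symProj, h]

theorem commutantBasis_trace (hd : 2 ≤ d) (s t : (Bool × Bool) ⊕ Bool) :
    ((commutantBasis d s)ᴴ * commutantBasis d t).trace = if s = t then
      (match s with
        | .inl _ => (d : ℂ)
        | .inr ε => ((d * (d * tau d ε ^ 2 - 1) : ℝ) : ℂ)) else 0 := by
  rcases s with ⟨a, b⟩ | ε <;> rcases t with ⟨a', b'⟩ | ε'
  · simp only [commutantBasis, Matrix.conjTranspose_mul, Matrix.conjTranspose_conjTranspose]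
    rw [Matrix.mul_assoc, ← Matrix.mul_assoc _ (embed d a'), embed_conjTranspose_mul hd]
    by_cases h : a = a'
    · subst h
      rw [if_pos rfl, Matrix.one_mul, trace_embed_mul hd]
      simp
    · simp [h]
  · simp only [commutantBasis, Matrix.conjTranspose_mul, Matrix.conjTranspose_conjTranspose]
    rw [Matrix.mul_assoc, embed_conjTranspose_mul_restProj hd]
    simp
  · simp only [commutantBasis]
    rw [restProj_conjTranspose, ← Matrix.mul_assoc, restProj_mul_embed hd]
    simp
  · simp only [commutantBasis]
    rw [restProj_conjTranspose, restProj_mul hd]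
    by_cases h : ε = ε'
    · subst h
      rw [if_pos rfl, if_pos rfl, trace_restProj hd]
    · simp [h]

/-- Partial transposition turns the commutant of `U ⊗ U ⊗ conj U` into that of `U ⊗ U ⊗ U`. -/
theorem partialTranspose_commute {X : Matrix (Tri d) (Tri d) ℂ} {U : Gate d}
    (hX : mixedRep U * X = X * mixedRep U) :
    threeCopies U * (Matrix.of fun p q => X (p.1, q.2) (q.1, p.2)) =
      (Matrix.of fun p q => X (p.1, q.2) (q.1, p.2)) * threeCopies U := by
  set A : Matrix (Tri d) (Tri d) ℂ := twoCopies U ⊗ₖ (1 : Matrix (Fin d) (Fin d) ℂ) with hA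
  set B : Matrix (Tri d) (Tri d) ℂ := (1 : Matrix (Fin d × Fin d) (Fin d × Fin d) ℂ) ⊗ₖ
    (U : Matrix (Fin d) (Fin d) ℂ).map star with hB
  set C : Matrix (Tri d) (Tri d) ℂ := (1 : Matrix (Fin d × Fin d) (Fin d × Fin d) ℂ) ⊗ₖ
    (U : Matrix (Fin d) (Fin d) ℂ)ᵀ with hC
  have hAB : A * B = mixedRep U := by
    rw [hA, hB, ← Matrix.mul_kronecker_mul, Matrix.mul_one, Matrix.one_mul, mixedRep]
  have hBA : B * A = mixedRep U := by
    rw [hA, hB, ← Matrix.mul_kronecker_mul, Matrix.mul_one, Matrix.one_mul, mixedRep]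
  have hBC : B * C = 1 := by
    rw [hB, hC, ← Matrix.mul_kronecker_mul, gate_map_mul_transpose, Matrix.one_mul,
      Matrix.one_kronecker_one]
  have hCB : C * B = 1 := mul_eq_one_comm.mp hBC
  have h : A * X * C = C * X * A := by
    calc A * X * C = C * (B * A * X) * C := by
          rw [← Matrix.mul_assoc, ← Matrix.mul_assoc, hCB, Matrix.one_mul]
      _ = C * X * A * (B * C) := by
          rw [hBA, hX, ← hAB]; simp only [Matrix.mul_assoc]
      _ = C * X * A := by rw [hBC, Matrix.mul_one]
  ext ⟨⟨i, j⟩, n⟩ ⟨⟨k, l⟩, m⟩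
  have h1 := congrFun (congrFun h ((i, j), m)) ((k, l), n)
  simp only [hA, hC, Matrix.mul_apply, Matrix.kroneckerMap_apply, twoCopies,
    Fintype.sum_prod_type, Matrix.one_apply, mul_ite, ite_mul, mul_zero, zero_mul, mul_one, one_mul,
    Matrix.transpose_apply] at h1
  simp only [threeCopies, twoCopies, Matrix.mul_apply, Matrix.kroneckerMap_apply,
    Fintype.sum_prod_type, Matrix.of_apply]
  simp [Finset.sum_ite_irrel, ite_and] at h1
  calc _ = _ := by
        rw [Finset.sum_congr rfl fun x _ => Finset.sum_comm, Finset.sum_comm]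
        simp only [Finset.sum_mul]
        refine Finset.sum_congr rfl fun x _ => Finset.sum_congr rfl fun y _ =>
          Finset.sum_congr rfl fun z _ => ?_
        ring
    _ = _ := h1
    _ = _ := by
        simp only [Finset.sum_mul]
        refine Finset.sum_congr rfl fun x _ => Finset.sum_congr rfl fun y _ =>
          Finset.sum_congr rfl fun z _ => ?_
        ring

theorem swapMat_mul_pairMat_apply (p : Tri d) (v : Fin d) :
    (swapMat d * pairMat d) p v = if p.1.2 = v ∧ p.1.1 = p.2 then 1 else 0 := by
  simp only [swapMat, pairMat, Matrix.mul_apply, Matrix.of_apply, Fintype.sum_prod_type,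
    ite_and, mul_ite, mul_one, mul_zero]
  simp [Finset.sum_ite_irrel]
  grind

/-- The commutant of `U ⊗ U ⊗ conj U` is spanned by the partial transposes of the permutations,
written in terms of the swap and of the pairing vector. -/
theorem exists_swapMat_pairMat (hd : 2 ≤ d) {X : Matrix (Tri d) (Tri d) ℂ}
    (hX : ∀ U, mixedRep U * X = X * mixedRep U) :
    ∃ c : Fin 6 → ℂ, X = c 0 • 1 + c 1 • swapMat d + c 2 • (pairMat d * (pairMat d)ᴴ) +
      c 3 • (swapMat d * pairMat d * (swapMat d * pairMat d)ᴴ) +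
      c 4 • (pairMat d * (swapMat d * pairMat d)ᴴ) +
      c 5 • (swapMat d * pairMat d * (pairMat d)ᴴ) := by
  obtain ⟨c, hc⟩ := exists_permComb hd fun U => partialTranspose_commute (hX U)
  refine ⟨c, ?_⟩
  ext ⟨⟨i, j⟩, m⟩ ⟨⟨k, l⟩, n⟩
  have h := congrFun (congrFun hc ((i, j), n)) ((k, l), m)
  simp only [Matrix.of_apply] at h
  rw [h]
  simp only [permComb, Matrix.of_apply, Matrix.add_apply, Matrix.smul_apply, smul_eq_mul,
    Matrix.mul_apply (N := (pairMat d)ᴴ), Matrix.mul_apply (N := (swapMat d * pairMat d)ᴴ),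
    Matrix.conjTranspose_apply, swapMat_mul_pairMat_apply]
  simp only [pairMat, swapMat, Matrix.of_apply, Matrix.one_apply, Prod.mk.injEq, apply_ite star,
    star_one, star_zero, ite_and, mul_ite, mul_one, mul_zero]
  simp
  grind

theorem pairMat_eq_sum (hd : 2 ≤ d) :
    pairMat d = ∑ ε, (tau d ε : ℂ) • embed d ε := by
  have h : ∀ ε, (tau d ε : ℂ) • embed d ε = symProj d ε * pairMat d := fun ε => by
    rw [embed, smul_smul, mul_inv_cancel₀ (tau_ne_zero hd ε), one_smul]
  simp_rw [h]
  rw [← Matrix.sum_mul]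
  have h1 : ∑ ε, symProj d ε = 1 := by
    simp only [Fintype.sum_bool, symProj, sgn, ← smul_add]
    ext p q
    simp
    ring
  rw [h1, Matrix.one_mul]

theorem swapMat_mul_pairMat_eq_sum (hd : 2 ≤ d) :
    swapMat d * pairMat d = ∑ ε, (sgn ε * tau d ε : ℂ) • embed d ε := by
  have h : ∀ ε, swapMat d * embed d ε = (sgn ε : ℂ) • embed d ε := fun ε => by
    have h1 := congrArg Matrix.conjTranspose (symProj_mul_swapMat (d := d) ε)
    rw [Matrix.conjTranspose_mul, swapMat_conjTranspose, Matrix.conjTranspose_smul,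
      symProj_conjTranspose] at h1
    rw [embed, Matrix.mul_smul, ← Matrix.mul_assoc, h1, Matrix.smul_mul, smul_comm]
    simp
  conv_lhs => rw [pairMat_eq_sum hd, Matrix.mul_sum]
  refine Finset.sum_congr rfl fun ε _ => ?_
  rw [Matrix.mul_smul, h, smul_smul, mul_comm]

/-- `1` and the swap are combinations of the `symProj d ε`, while `pairMat d` and its swapped
version are combinations of the `embed d ε`. -/
theorem mem_span_commutantBasis (hd : 2 ≤ d) {X : Matrix (Tri d) (Tri d) ℂ}
    (hX : ∀ U, mixedRep U * X = X * mixedRep U) :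
    X ∈ Submodule.span ℂ (Set.range (commutantBasis d)) := by
  set S := Submodule.span ℂ (Set.range (commutantBasis d))
  have hE : ∀ a b, embed d a * (embed d b)ᴴ ∈ S := fun a b =>
    Submodule.subset_span ⟨.inl (a, b), rfl⟩
  have hR : ∀ ε, restProj d ε ∈ S := fun ε => Submodule.subset_span ⟨.inr ε, rfl⟩
  have hP : ∀ ε, symProj d ε ∈ S := fun ε => by
    have := S.add_mem (hR ε) (hE ε ε)
    rwa [restProj, sub_add_cancel] at this
  have h1 : (1 : Matrix (Tri d) (Tri d) ℂ) ∈ S := by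
    have := S.add_mem (hP true) (hP false)
    have h : symProj d true + symProj d false = 1 := by
      simp only [symProj, sgn, ← smul_add]
      ext p q
      simp
      ring
    rwa [h] at this
  have hF : swapMat d ∈ S := by
    have := S.sub_mem (hP true) (hP false)
    have h : symProj d true - symProj d false = swapMat d := by
      simp only [symProj, sgn, ← smul_sub]
      ext p q
      simp
      ring
    rwa [h] at this
  have hEE : ∀ x y : Bool → ℂ,
      (∑ a, x a • embed d a) * (∑ b, y b • embed d b)ᴴ ∈ S := fun x y => by
    rw [Matrix.conjTranspose_sum, Matrix.sum_mul]
    refine S.sum_mem fun a _ => ?_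
    rw [Matrix.mul_sum]
    refine S.sum_mem fun b _ => ?_
    rw [Matrix.conjTranspose_smul, Matrix.smul_mul, Matrix.mul_smul]
    exact S.smul_mem _ (S.smul_mem _ (hE a b))
  obtain ⟨c, hc⟩ := exists_swapMat_pairMat hd hX
  rw [hc, swapMat_mul_pairMat_eq_sum hd, pairMat_eq_sum hd]
  exact S.add_mem (S.add_mem (S.add_mem (S.add_mem (S.add_mem (S.smul_mem _ h1) (S.smul_mem _ hF))
    (S.smul_mem _ (hEE _ _))) (S.smul_mem _ (hEE _ _))) (S.smul_mem _ (hEE _ _)))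
    (S.smul_mem _ (hEE _ _))

/-! ### The averaged overlap with `U ⊗ U ⊗ conj U` -/

/-- The squared Hilbert-Schmidt norm. -/
def normSq {m n : Type} [Fintype m] [Fintype n] (A : Matrix m n ℂ) : ℝ :=
  ∑ p : m × n, ‖A p.1 p.2‖ ^ 2

theorem normSq_nonneg {m n : Type} [Fintype m] [Fintype n] (A : Matrix m n ℂ) : 0 ≤ normSq A :=
  Finset.sum_nonneg fun _ _ => sq_nonneg _

theorem trace_conjTranspose_mul_self {m n : Type} [Fintype m] [Fintype n] (A : Matrix m n ℂ) :
    (Aᴴ * A).trace = (normSq A : ℂ) := by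
  rw [trace_conjTranspose_mul_eq_sum, normSq, Complex.ofReal_sum]
  refine Finset.sum_congr rfl fun p _ => ?_
  rw [Complex.ofReal_pow, ← Complex.conj_mul']
  rfl

theorem trace_compress {n : Type} [Fintype n] {R : Matrix n n ℂ} (hR : R * R = R) (hR' : Rᴴ = R)
    (B : Matrix n n ℂ) : (Bᴴ * R * B * Rᴴ).trace = (normSq (R * B * R) : ℂ) := by
  rw [← trace_conjTranspose_mul_self]
  simp only [Matrix.conjTranspose_mul, hR']
  calc (Bᴴ * R * B * R).trace = (Bᴴ * (R * R) * B * (R * R)).trace := by rw [hR]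
    _ = (Bᴴ * R * R * B * R * R).trace := by simp only [Matrix.mul_assoc]
    _ = (R * (Bᴴ * R * R * B * R)).trace := Matrix.trace_mul_comm _ _
    _ = _ := by simp only [Matrix.mul_assoc]

/-- The Hilbert-Schmidt overlaps with `U ⊗ U ⊗ conj U`, averaged over `U`. -/
theorem integral_overlap (hd : 2 ≤ d) (B : Matrix (Tri d) (Tri d) ℂ) :
    ∫ U, ‖(Bᴴ * mixedRep U).trace‖ ^ 2 ∂gateHaar d =
      normSq (∑ ε, (embed d ε)ᴴ * B * embed d ε) / d +
        ∑ ε, normSq (restProj d ε * B * restProj d ε) / (d * (d * tau d ε ^ 2 - 1)) := by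
  have h := isUnitaryRep_mixedRep.integral_norm_sq_trace (commutantBasis d)
    commutantBasis_commute (fun s t hst => by rw [commutantBasis_trace hd, if_neg hst])
    (fun X hX => mem_span_commutantBasis hd hX) B
  apply Complex.ofReal_injective
  rw [h, Fintype.sum_sum_type]
  simp only [commutantBasis_trace hd, if_true]
  rw [Complex.ofReal_add, Complex.ofReal_sum]
  congr 1
  · rw [Complex.ofReal_div, ← trace_conjTranspose_mul_self, Matrix.conjTranspose_sum,
      Finset.sum_mul_sum, Matrix.trace_sum, Finset.sum_div, Fintype.sum_prod_type]
    refine Finset.sum_congr rfl fun a _ => ?_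
    rw [Matrix.trace_sum, Finset.sum_div]
    refine Finset.sum_congr rfl fun b _ => ?_
    simp only [commutantBasis, Matrix.conjTranspose_mul, Matrix.conjTranspose_conjTranspose,
      Complex.ofReal_natCast]
    congr 1
    rw [← Matrix.mul_assoc, Matrix.trace_mul_comm]
    simp only [Matrix.mul_assoc]
  · refine Finset.sum_congr rfl fun ε _ => ?_
    rw [Complex.ofReal_div]
    congr 1
    exact trace_compress (by simpa using restProj_mul hd ε ε) (restProj_conjTranspose ε) B

end

section
variable {d : ℕ}

/-- The rank of `restProj d ε`. -/
def restDim (d : ℕ) (ε : Bool) : ℝ := d * (d * tau d ε ^ 2 - 1)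

/-- The complement in the antisymmetric part vanishes for `d = 2`; in all other cases the
dimension of the complement is at least `d`. -/
theorem restDim_cases (hd : 2 ≤ d) (ε : Bool) :
    (d = 2 ∧ ε = false ∧ restDim d ε = 0) ∨ ((d ≠ 2 ∨ ε = true) ∧ (d : ℝ) ≤ restDim d ε) := by
  have h2 : (2 : ℝ) ≤ d := by exact_mod_cast hd
  rw [restDim, tau_sq hd]
  cases ε
  · obtain rfl | h3 : 2 = d ∨ 3 ≤ d := by omega
    · left; norm_num [sgn]
    · right
      have h3' : (3 : ℝ) ≤ d := by exact_mod_cast h3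
      refine ⟨Or.inl (by omega), ?_⟩
      simp only [sgn]
      exact le_mul_of_one_le_right (by linarith) (by nlinarith)
  · right
    refine ⟨Or.inr rfl, ?_⟩
    simp only [sgn]
    exact le_mul_of_one_le_right (by linarith) (by nlinarith)

theorem restDim_nonneg (hd : 2 ≤ d) (ε : Bool) : 0 ≤ restDim d ε := by
  rcases restDim_cases hd ε with h | h
  · exact h.2.2.ge
  · exact (Nat.cast_nonneg d).trans h.2

/-- The quotients are `1`, except that `0 / 0 = 0` for the antisymmetric part with `d = 2`: this is
where the values `6` and `5` come from. -/
theorem sum_restDim_div (hd : 2 ≤ d) :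
    4 + ∑ ε, restDim d ε / restDim d ε = if d = 2 then 5 else 6 := by
  have hpos : (0 : ℝ) < d := by exact_mod_cast (by omega : 0 < d)
  have ht : restDim d true ≠ 0 := by
    rcases restDim_cases hd true with h | h
    · simp at h
    · exact (hpos.trans_le h.2).ne'
  rw [Fintype.sum_bool, div_self ht]
  rcases restDim_cases hd false with h | h
  · rw [h.2.2, if_pos h.1]; norm_num
  · rw [div_self (hpos.trans_le h.2).ne', if_neg (by simpa using h.1)]; norm_num

theorem normSq_restProj (hd : 2 ≤ d) (ε : Bool) : normSq (restProj d ε) = restDim d ε := by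
  apply Complex.ofReal_injective
  rw [← trace_conjTranspose_mul_self, restProj_conjTranspose, restProj_mul hd, if_pos rfl,
    trace_restProj hd, restDim]

/-- The sixth absolute moment of the trace of a random unitary. -/
theorem integral_norm_trace_pow_six (hd : 2 ≤ d) :
    ∫ U : Gate d, ‖(U : Matrix (Fin d) (Fin d) ℂ).trace‖ ^ 6 ∂gateHaar d =
      if d = 2 then 5 else 6 := by
  have h1 : ∀ U : Gate d, ‖(U : Matrix (Fin d) (Fin d) ℂ).trace‖ ^ 6 =
      ‖((1 : Matrix (Tri d) (Tri d) ℂ)ᴴ * mixedRep U).trace‖ ^ 2 := fun U => by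
    have : ((U : Matrix (Fin d) (Fin d) ℂ).map star).trace =
        star (U : Matrix (Fin d) (Fin d) ℂ).trace := by
      simp [Matrix.trace]
    rw [Matrix.conjTranspose_one, Matrix.one_mul, mixedRep, twoCopies, Matrix.trace_kronecker,
      Matrix.trace_kronecker, this, norm_mul, norm_mul, norm_star]
    ring
  have hd0 : (d : ℝ) ≠ 0 := by exact_mod_cast (by omega : d ≠ 0)
  simp_rw [h1]
  rw [integral_overlap hd, ← sum_restDim_div hd]
  congr 1
  · have h2 : ∑ ε, (embed d ε)ᴴ * (1 : Matrix (Tri d) (Tri d) ℂ) * embed d ε = (2 : ℂ) • 1 := by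
      simp only [Matrix.mul_one, embed_conjTranspose_mul hd, if_true, Fintype.sum_bool, two_smul]
    have h3 : normSq ((2 : ℂ) • (1 : Matrix (Fin d) (Fin d) ℂ)) = 4 * d := by
      apply Complex.ofReal_injective
      rw [← trace_conjTranspose_mul_self]
      simp
      ring
    rw [h2, h3]
    field_simp
  · refine Finset.sum_congr rfl fun ε _ => ?_
    rw [Matrix.mul_one, restProj_mul hd, if_pos rfl, normSq_restProj hd, restDim]

/-- Partial isometries do not increase the Hilbert-Schmidt norm. -/
theorem normSq_mul_le {l m n : Type} [Fintype l] [Fintype m] [Fintype n] (C : Matrix l m ℂ)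
    (hC : (Cᴴ * C) * (Cᴴ * C) = Cᴴ * C) (X : Matrix m n ℂ) : normSq (C * X) ≤ normSq X := by
  have h : (normSq X : ℂ) = normSq (C * X) + normSq (X - Cᴴ * C * X) := by
    simp only [← trace_conjTranspose_mul_self]
    rw [← Matrix.trace_add]
    congr 1
    have h1 : (Cᴴ * C)ᴴ = Cᴴ * C := by simp
    rw [Matrix.conjTranspose_sub, Matrix.sub_mul, Matrix.mul_sub, Matrix.mul_sub,
      Matrix.conjTranspose_mul (Cᴴ * C), h1, Matrix.conjTranspose_mul]
    have h2 : Xᴴ * (Cᴴ * C) * (Cᴴ * C * X) = Xᴴ * (Cᴴ * C) * X := by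
      calc _ = Xᴴ * ((Cᴴ * C) * (Cᴴ * C)) * X := by simp only [Matrix.mul_assoc]
        _ = _ := by rw [hC]
    rw [h2]
    simp only [Matrix.mul_assoc]
    abel
  have h' : normSq X = normSq (C * X) + normSq (X - Cᴴ * C * X) := by exact_mod_cast h
  linarith [normSq_nonneg (X - Cᴴ * C * X)]

theorem normSq_conjTranspose {m n : Type} [Fintype m] [Fintype n] (A : Matrix m n ℂ) :
    normSq Aᴴ = normSq A := by
  simp only [normSq, Fintype.sum_prod_type, Matrix.conjTranspose_apply, norm_star]
  exact Finset.sum_comm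

/-- A weighted form of the Cauchy-Schwarz inequality. -/
theorem normSq_add_le {m n : Type} [Fintype m] [Fintype n] (X Y : Matrix m n ℂ) {s t : ℝ}
    (hs : 1 < s) (hst : s + t = s * t) : normSq (X + Y) ≤ s * normSq X + t * normSq Y := by
  rw [normSq, normSq, normSq, Finset.mul_sum, Finset.mul_sum, ← Finset.sum_add_distrib]
  refine Finset.sum_le_sum fun p _ => ?_
  rw [Matrix.add_apply]
  have h1 := norm_add_le (X p.1 p.2) (Y p.1 p.2)
  set a := ‖X p.1 p.2‖
  set b := ‖Y p.1 p.2‖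
  have h2 : ‖X p.1 p.2 + Y p.1 p.2‖ ^ 2 ≤ (a + b) ^ 2 := pow_le_pow_left₀ (norm_nonneg _) h1 2
  refine h2.trans ?_
  have h3 : 0 < s - 1 := by linarith
  have h4 : (s - 1) * (s * a ^ 2 + t * b ^ 2 - (a + b) ^ 2) = ((s - 1) * a - b) ^ 2 := by
    linear_combination b ^ 2 * (- hst)
  exact sub_nonneg.mp ((mul_nonneg_iff_of_pos_left h3).mp (h4 ▸ sq_nonneg _))

/-- A bound for the averaged overlap in terms of the Gram matrix `Bᴴ * B` only. -/
theorem integral_overlap_le (hd : 2 ≤ d) (B : Matrix (Tri d) (Tri d) ℂ) {w : Bool → ℝ}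
    (hw : 1 < w true) (hw' : w true + w false = w true * w false) :
    ∫ U, ‖(Bᴴ * mixedRep U).trace‖ ^ 2 ∂gateHaar d ≤
      ∑ ε, (w ε * normSq (B * embed d ε) / d + normSq (B * restProj d ε) / restDim d ε) := by
  have hw0 : ∀ ε, 0 ≤ w ε := by
    have : 0 < w false := by nlinarith
    intro ε; cases ε
    · exact this.le
    · linarith
  rw [integral_overlap hd, Finset.sum_add_distrib]
  refine add_le_add ?_ (Finset.sum_le_sum fun ε _ => ?_)
  · rw [← Finset.sum_div]
    refine div_le_div_of_nonneg_right ?_ (Nat.cast_nonneg d)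
    rw [Fintype.sum_bool, Fintype.sum_bool]
    refine (normSq_add_le _ _ hw hw').trans ?_
    have h : ∀ ε, normSq ((embed d ε)ᴴ * B * embed d ε) ≤ normSq (B * embed d ε) := fun ε => by
      rw [Matrix.mul_assoc]
      refine normSq_mul_le _ ?_ _
      have := embed_conjTranspose_mul hd ε ε
      rw [if_pos rfl] at this
      rw [Matrix.conjTranspose_conjTranspose, Matrix.mul_assoc, ← Matrix.mul_assoc _ (embed d ε),
        this, Matrix.one_mul]
    exact add_le_add (mul_le_mul_of_nonneg_left (h _) (hw0 _))
      (mul_le_mul_of_nonneg_left (h _) (hw0 _))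
  · refine div_le_div_of_nonneg_right ?_ (restDim_nonneg hd ε)
    rw [Matrix.mul_assoc]
    refine normSq_mul_le _ ?_ _
    have := restProj_mul hd ε ε
    rw [if_pos rfl] at this
    rw [restProj_conjTranspose, this, this]

/-- A coarser bound, in which the two parts of each symmetry type are given the same weight. -/
theorem integral_overlap_le_symProj (hd : 2 ≤ d) (B : Matrix (Tri d) (Tri d) ℂ) {w : Bool → ℝ}
    (hw : 1 < w true) (hw' : w true + w false = w true * w false) :
    ∫ U, ‖(Bᴴ * mixedRep U).trace‖ ^ 2 ∂gateHaar d ≤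
      ∑ ε, w ε / d * normSq (B * symProj d ε) := by
  have hd0 : (0 : ℝ) < d := by exact_mod_cast (by omega : 0 < d)
  have hw1 : ∀ ε, 1 ≤ w ε := by
    have : 1 < w false := by
      have : 0 < w false := by nlinarith
      nlinarith
    intro ε; cases ε
    · exact this.le
    · exact hw.le
  refine (integral_overlap_le hd B hw hw').trans (Finset.sum_le_sum fun ε _ => ?_)
  -- The rank-`d` part and its complement are orthogonal.
  have h : normSq (B * symProj d ε) = normSq (B * embed d ε) + normSq (B * restProj d ε) := by
    apply Complex.ofReal_injective
    rw [Complex.ofReal_add, ← normSq_conjTranspose, ← normSq_conjTranspose (B * embed d ε),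
      ← normSq_conjTranspose (B * restProj d ε)]
    simp only [← trace_conjTranspose_mul_self, Matrix.conjTranspose_conjTranspose]
    rw [← Matrix.trace_add]
    have h1 : ∀ {l : Type} [Fintype l] (V : Matrix (Tri d) l ℂ),
        B * V * (B * V)ᴴ = B * (V * Vᴴ) * Bᴴ := fun V => by
      rw [Matrix.conjTranspose_mul]; simp only [Matrix.mul_assoc]
    rw [h1, h1, h1, ← Matrix.add_mul, ← Matrix.mul_add, symProj_conjTranspose, symProj_mul,
      if_pos rfl, restProj_conjTranspose, restProj_mul hd, if_pos rfl, restProj,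
      add_sub_cancel]
  rw [h, mul_add]
  refine add_le_add (by rw [div_mul_eq_mul_div]) ?_
  have hR0 := normSq_nonneg (B * restProj d ε)
  have hstep : normSq (B * restProj d ε) / d ≤ w ε / d * normSq (B * restProj d ε) := by
    rw [div_mul_eq_mul_div]
    exact div_le_div_of_nonneg_right (by nlinarith [hw1 ε]) hd0.le
  refine le_trans ?_ hstep
  rcases restDim_cases hd ε with h | h
  · rw [h.2.2, div_zero]
    exact div_nonneg hR0 hd0.le
  · exact div_le_div_of_nonneg_left hR0 hd0 h.2

end

/-! ### Networks with a single use of the gate -/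

section
variable {d : ℕ} {m r s : Type} [Fintype m] [DecidableEq m] [Fintype r] [Fintype s]

/-- The operator which represents the network `B * (U ⊗ 1) * A` with open slot `U`, between the
inputs of `U ⊗ U ⊗ conj U` and its outputs. -/
def combOp (A : Matrix (Fin d × m) (Fin d × Fin d) ℂ) (B : Matrix (Fin d × Fin d) (Fin d × m) ℂ) :
    Matrix (Tri d) (Tri d) ℂ :=
  Matrix.of fun p q => ∑ x, B p.1 (p.2, x) * A (q.2, x) q.1

/-- The Kraus operators of a network with encoding Kraus operators `A` and decoding Kraus operators
`B`. -/
def networkKraus (A : s → Matrix (Fin d × m) (Fin d × Fin d) ℂ)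
    (B : r → Matrix (Fin d × Fin d) (Fin d × m) ℂ) (U : Gate d) (q : r × s) :
    Matrix (Fin d × Fin d) (Fin d × Fin d) ℂ :=
  B q.1 * ((U : Matrix (Fin d) (Fin d) ℂ) ⊗ₖ (1 : Matrix m m ℂ)) * A q.2

/-- The fidelity of a network, quadratic in `U ⊗ U` and in the slot `U`, is an overlap with
`U ⊗ U ⊗ conj U`. -/
theorem norm_trace_network (A : Matrix (Fin d × m) (Fin d × Fin d) ℂ)
    (B : Matrix (Fin d × Fin d) (Fin d × m) ℂ) (U : Gate d) :
    ‖((twoCopies U)ᴴ * (B * ((U : Matrix (Fin d) (Fin d) ℂ) ⊗ₖ (1 : Matrix m m ℂ)) * A)).trace‖ =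
      ‖((combOp A B)ᴴ * mixedRep U).trace‖ := by
  have h : ((twoCopies U)ᴴ *
      (B * ((U : Matrix (Fin d) (Fin d) ℂ) ⊗ₖ (1 : Matrix m m ℂ)) * A)).trace =
      star ((combOp A B)ᴴ * mixedRep U).trace := by
    rw [trace_conjTranspose_mul_eq_sum, trace_conjTranspose_mul_eq_sum, star_sum]
    have h1 : ∀ o i : Fin d × Fin d,
        (B * ((U : Matrix (Fin d) (Fin d) ℂ) ⊗ₖ (1 : Matrix m m ℂ)) * A) o i =
        ∑ a, ∑ b, (U : Matrix (Fin d) (Fin d) ℂ) a b * combOp A B (o, a) (i, b) := by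
      intro o i
      simp only [Matrix.mul_apply, Fintype.sum_prod_type, Matrix.kroneckerMap_apply,
        Matrix.one_apply, mul_ite, mul_one, mul_zero, Finset.sum_ite_eq', Finset.mem_univ, if_true,
        combOp, Matrix.of_apply, Finset.sum_mul, Finset.mul_sum]
      rw [Finset.sum_congr rfl fun b _ => Finset.sum_comm, Finset.sum_comm]
      refine Finset.sum_congr rfl fun a _ => Finset.sum_congr rfl fun b _ =>
        Finset.sum_congr rfl fun x _ => ?_
      ring
    simp only [h1, combOp, mixedRep, Fintype.sum_prod_type (α₁ := Tri d),
      Fintype.sum_prod_type (α₁ := Fin d × Fin d), Matrix.kroneckerMap_apply, Matrix.map_apply,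
      star_mul', star_star, Finset.mul_sum]
    refine Finset.sum_congr rfl fun o _ => ?_
    rw [Finset.sum_comm]
    refine Finset.sum_congr rfl fun a _ => Finset.sum_congr rfl fun i _ =>
      Finset.sum_congr rfl fun b _ => ?_
    ring
  rw [h, norm_star]

theorem averageFidelity_network (A : s → Matrix (Fin d × m) (Fin d × Fin d) ℂ)
    (B : r → Matrix (Fin d × Fin d) (Fin d × m) ℂ) :
    averageFidelity d (fun U => krausMap (networkKraus A B U)) =
      (∑ q : r × s, ∫ U, ‖((combOp (A q.2) (B q.1))ᴴ * mixedRep U).trace‖ ^ 2 ∂gateHaar d) /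
        (d : ℝ) ^ 4 := by
  simp only [averageFidelity, gateFidelity_krausMap, networkKraus, norm_trace_network]
  rw [integral_div, integral_finsetSum]
  intro q _
  refine integrable_of_continuous ?_
  exact ((continuous_const.matrix_mul
    isUnitaryRep_mixedRep.continuous).matrix_trace.norm).pow 2

/-- The Gram matrix of a network does not depend on the decoding channel. -/
theorem sum_combOp_gram (A : Matrix (Fin d × m) (Fin d × Fin d) ℂ)
    (B : r → Matrix (Fin d × Fin d) (Fin d × m) ℂ) (hB : ∑ t, (B t)ᴴ * B t = 1) :
    ∑ t, (combOp A (B t))ᴴ * combOp A (B t) =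
      (d : ℂ) • Matrix.of fun q q' => ∑ x, star (A (q.2, x) q.1) * A (q'.2, x) q'.1 := by
  ext q q'
  have h : ∀ a x x', ∑ t, ∑ o, star (B t o (a, x)) * B t o (a, x') = if x = x' then 1 else 0 := by
    intro a x x'
    have := congrFun (congrFun hB (a, x)) (a, x')
    simpa [Matrix.sum_apply, Matrix.mul_apply, Matrix.one_apply] using this
  have h1 : (∑ t, (combOp A (B t))ᴴ * combOp A (B t)) q q' =
      ∑ a, ∑ x, ∑ x', (∑ t, ∑ o, star (B t o (a, x)) * B t o (a, x')) *
        (star (A (q.2, x) q.1) * A (q'.2, x') q'.1) := by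
    simp only [Matrix.sum_apply, Matrix.mul_apply, Matrix.conjTranspose_apply, combOp,
      Matrix.of_apply, star_sum, star_mul', Finset.sum_mul_sum,
      Fintype.sum_prod_type (α₁ := Fin d × Fin d)]
    simp only [Finset.sum_mul]
    rw [Finset.sum_congr rfl fun t _ => Finset.sum_comm, Finset.sum_comm]
    refine Finset.sum_congr rfl fun a _ => ?_
    rw [Finset.sum_congr rfl fun t _ => Finset.sum_comm, Finset.sum_comm]
    refine Finset.sum_congr rfl fun x _ => ?_
    rw [Finset.sum_congr rfl fun t _ => Finset.sum_comm, Finset.sum_comm]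
    refine Finset.sum_congr rfl fun x' _ => Finset.sum_congr rfl fun t _ =>
      Finset.sum_congr rfl fun o _ => ?_
    ring
  rw [h1]
  simp only [h]
  simp

/-- The Hilbert-Schmidt norms of the operators of a network, compressed from the right. -/
theorem sum_normSq_combOp_mul {l : Type} [Fintype l]
    (A : s → Matrix (Fin d × m) (Fin d × Fin d) ℂ)
    (B : r → Matrix (Fin d × Fin d) (Fin d × m) ℂ) (hB : ∑ t, (B t)ᴴ * B t = 1)
    (V : Matrix (Tri d) l ℂ) :
    ((∑ q : r × s, normSq (combOp (A q.2) (B q.1) * V) : ℝ) : ℂ) =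
      d * ∑ q, ∑ q', (∑ t, ∑ x, star (A t (q.2, x) q.1) * A t (q'.2, x) q'.1) *
        (V * Vᴴ) q' q := by
  have h1 : ∀ q : r × s, (normSq (combOp (A q.2) (B q.1) * V) : ℂ) =
      (((combOp (A q.2) (B q.1))ᴴ * combOp (A q.2) (B q.1)) * (V * Vᴴ)).trace := fun q => by
    rw [← trace_conjTranspose_mul_self, Matrix.conjTranspose_mul, Matrix.mul_assoc,
      Matrix.trace_mul_comm]
    simp only [Matrix.mul_assoc]
  rw [Complex.ofReal_sum]
  simp_rw [h1]
  rw [Fintype.sum_prod_type, Finset.sum_comm]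
  have h2 : ∀ t, ∑ q : r, (((combOp (A t) (B q))ᴴ * combOp (A t) (B q)) * (V * Vᴴ)).trace =
      d * ∑ q, ∑ q', (∑ x, star (A t (q.2, x) q.1) * A t (q'.2, x) q'.1) * (V * Vᴴ) q' q := by
    intro t
    rw [← Matrix.trace_sum, ← Matrix.sum_mul, sum_combOp_gram _ _ hB, Matrix.smul_mul,
      Matrix.trace_smul, smul_eq_mul]
    congr 1
  simp_rw [h2, ← Finset.mul_sum]
  congr 1
  rw [Finset.sum_comm]
  refine Finset.sum_congr rfl fun q _ => ?_
  rw [Finset.sum_comm]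
  refine Finset.sum_congr rfl fun q' _ => ?_
  rw [Finset.sum_mul]

end

/-! ### Upper bounds -/

section
variable {d : ℕ}

theorem embed_apply (ε : Bool) (p : Tri d) (v : Fin d) :
    embed d ε p v = ((tau d ε)⁻¹ : ℂ) * (2⁻¹ * ((if p.1.1 = v ∧ p.1.2 = p.2 then 1 else 0) +
      sgn ε * (if p.1.2 = v ∧ p.1.1 = p.2 then 1 else 0))) := by
  have h : symProj d ε * pairMat d =
      (2⁻¹ : ℂ) • (pairMat d + (sgn ε : ℂ) • (swapMat d * pairMat d)) := by
    rw [symProj, Matrix.smul_mul, Matrix.add_mul, Matrix.one_mul, Matrix.smul_mul]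
  rw [embed, h]
  simp only [Matrix.smul_apply, Matrix.add_apply, swapMat_mul_pairMat_apply, smul_eq_mul]
  rfl

theorem star_embed (ε : Bool) (p : Tri d) (v : Fin d) :
    star (embed d ε p v) = embed d ε p v := by
  have hs : star (sgn ε : ℂ) = sgn ε := Complex.conj_ofReal _
  have ht : star (tau d ε : ℂ) = tau d ε := Complex.conj_ofReal _
  have h2 : star (2 : ℂ) = 2 := by simp
  rw [embed_apply]
  simp only [star_mul', star_add, star_inv₀, hs, ht, h2, apply_ite star, star_one, star_zero]

/-- The projection to the symmetric or antisymmetric vectors of two systems. -/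
def pairProj (d : ℕ) (ε : Bool) : Matrix (Fin d × Fin d) (Fin d × Fin d) ℂ :=
  Matrix.of fun p q => 2⁻¹ * ((if p = q then 1 else 0) + sgn ε * (if p = q.swap then 1 else 0))

theorem symProj_apply (ε : Bool) (p q : Tri d) :
    symProj d ε p q = if p.2 = q.2 then pairProj d ε p.1 q.1 else 0 := by
  obtain ⟨⟨i, j⟩, k⟩ := p
  obtain ⟨⟨l, m⟩, n⟩ := q
  simp only [symProj, pairProj, swapMat, Matrix.smul_apply, Matrix.add_apply, Matrix.one_apply,
    Matrix.of_apply, smul_eq_mul, Prod.mk.injEq, Prod.swap_prod_mk]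
  by_cases h : k = n <;> simp [h]

theorem sum_pairProj (hd : 2 ≤ d) (ε : Bool) :
    ∑ i, pairProj d ε i i = ((d * tau d ε ^ 2 : ℝ) : ℂ) := by
  rw [tau_sq hd]
  simp only [pairProj, Matrix.of_apply, Fintype.sum_prod_type, Prod.swap_prod_mk, Prod.mk.injEq,
    if_true, ← Finset.mul_sum, Finset.sum_add_distrib]
  have : ∀ x : Fin d, ∑ y : Fin d, (if x = y ∧ y = x then (1 : ℂ) else 0) = 1 := fun x => by
    rw [Finset.sum_eq_single x]
    · simp
    · intro y _ hy; simp [hy]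
    · simp
  simp_rw [this]
  simp
  ring

theorem sum_symProj (hd : 2 ≤ d) (ε : Bool) (b b' : Fin d) :
    ∑ i, symProj d ε (i, b') (i, b) = if b' = b then ((d * tau d ε ^ 2 : ℝ) : ℂ) else 0 := by
  simp only [symProj_apply]
  split_ifs
  · exact sum_pairProj hd ε
  · simp

/-- The partial trace of `embed d ε * (embed d ε')ᴴ` over the first two systems. -/
theorem sum_embed_mul (hd : 2 ≤ d) (ε ε' : Bool) (b b' : Fin d) :
    ∑ i, (embed d ε * (embed d ε')ᴴ) (i, b') (i, b) = if ε = ε' ∧ b' = b then 1 else 0 := by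
  have h : ∀ i : Fin d × Fin d, (embed d ε * (embed d ε')ᴴ) (i, b') (i, b) =
      ((tau d ε)⁻¹ : ℂ) * ((tau d ε')⁻¹ : ℂ) * 4⁻¹ * ∑ v,
        (((if i.1 = v ∧ i.2 = b' then 1 else 0) + sgn ε * (if i.2 = v ∧ i.1 = b' then 1 else 0)) *
        ((if i.1 = v ∧ i.2 = b then 1 else 0) +
          sgn ε' * (if i.2 = v ∧ i.1 = b then 1 else 0)) : ℂ) := by
    intro i
    rw [Matrix.mul_apply, Finset.mul_sum]
    refine Finset.sum_congr rfl fun v _ => ?_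
    rw [Matrix.conjTranspose_apply, star_embed, embed_apply, embed_apply]
    ring
  simp_rw [h, ← Finset.mul_sum]
  simp only [Fintype.sum_prod_type, add_mul, mul_add, Finset.sum_add_distrib, ite_and, mul_ite,
    ite_mul, mul_one, mul_zero, zero_mul, one_mul]
  simp [Finset.sum_ite_irrel]
  by_cases hb : b' = b
  · subst hb
    by_cases hε : ε = ε'
    · subst hε
      have hs : (sgn ε : ℂ) * (sgn ε : ℂ) = 1 := by exact_mod_cast sgn_mul_self ε
      have ht : (tau d ε : ℂ) ^ 2 = (d + sgn ε) / 2 := by exact_mod_cast tau_sq hd ε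
      have ht0 := tau_ne_zero hd ε
      simp [Finset.sum_add_distrib]
      field_simp
      linear_combination (-4 : ℂ) * ht + d * hs
    · have h0 : (sgn ε : ℂ) = - (sgn ε' : ℂ) := by
        revert hε; cases ε <;> cases ε' <;> simp [sgn]
      have hs : (sgn ε' : ℂ) * (sgn ε' : ℂ) = 1 := by exact_mod_cast sgn_mul_self ε'
      simp [Finset.sum_add_distrib, hε, h0]
      linear_combination (-((tau d ε : ℂ)⁻¹ * (tau d ε' : ℂ)⁻¹ * 4⁻¹ * d)) * hs
  · simp [hb, Ne.symm hb]

theorem sum_restProj (hd : 2 ≤ d) (ε : Bool) (b b' : Fin d) :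
    ∑ i, restProj d ε (i, b') (i, b) = if b' = b then ((d * tau d ε ^ 2 - 1 : ℝ) : ℂ) else 0 := by
  simp only [restProj, Matrix.sub_apply, Finset.sum_sub_distrib, sum_symProj hd, sum_embed_mul hd,
    true_and]
  split_ifs
  · push_cast; rfl
  · simp

theorem sum_tau_sq (hd : 2 ≤ d) :
    (tau d true + tau d false) ^ 2 = d + Real.sqrt ((d : ℝ) ^ 2 - 1) := by
  have h : tau d true * tau d false = Real.sqrt ((d : ℝ) ^ 2 - 1) / 2 := by
    rw [tau, tau, ← Real.sqrt_mul (add_sgn_pos hd true).le]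
    have : ((d : ℝ) + sgn true) / 2 * ((d + sgn false) / 2) = ((d : ℝ) ^ 2 - 1) / 2 ^ 2 := by
      simp only [sgn]; ring
    rw [this, Real.sqrt_div' _ (by positivity), Real.sqrt_sq (by norm_num)]
  have h1 := tau_sq hd true
  have h2 := tau_sq hd false
  simp only [sgn] at h1 h2
  linear_combination h1 + h2 + 2 * h

/-- The upper bound for networks with a single use of the gate. -/
theorem network_le (hd : 2 ≤ d) {m r s : Type} [Fintype m] [DecidableEq m] [Fintype r] [Fintype s]
    (A : s → Matrix (Fin d × m) (Fin d × Fin d) ℂ) (B : r → Matrix (Fin d × Fin d) (Fin d × m) ℂ)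
    (hA : ∑ t, (A t)ᴴ * A t = 1) (hB : ∑ t, (B t)ᴴ * B t = 1) :
    averageFidelity d (fun U => krausMap (networkKraus A B U)) ≤
      (d + Real.sqrt ((d : ℝ) ^ 2 - 1)) / (d : ℝ) ^ 3 := by
  have hd0 : (0 : ℝ) < d := by exact_mod_cast (by omega : 0 < d)
  set T := tau d true + tau d false with hT
  have htt := tau_pos hd true
  have htf := tau_pos hd false
  -- These weights minimize the bound.
  let w : Bool → ℝ := fun ε => T / tau d ε
  have hw : 1 < w true := by
    simp only [w]
    rw [one_lt_div htt]
    linarith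
  have hw' : w true + w false = w true * w false := by
    simp only [w, hT]
    field_simp
    ring
  have hsum : ∀ ε, ∑ q : r × s, normSq (combOp (A q.2) (B q.1) * symProj d ε) =
      d * (d * tau d ε ^ 2) := by
    intro ε
    apply Complex.ofReal_injective
    rw [sum_normSq_combOp_mul A B hB, symProj_conjTranspose, symProj_mul, if_pos rfl,
      Complex.ofReal_mul, ← sum_pairProj hd, Complex.ofReal_natCast]
    congr 1
    have hA' : ∀ i i', ∑ b, ∑ t, ∑ x, star (A t (b, x) i) * A t (b, x) i' =
        if i = i' then 1 else 0 := by
      intro i i'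
      have := congrFun (congrFun hA i) i'
      rw [Finset.sum_comm]
      simpa [Matrix.sum_apply, Matrix.mul_apply, Matrix.one_apply, Fintype.sum_prod_type] using this
    simp only [symProj_apply, mul_ite, mul_zero, Fintype.sum_prod_type (α₁ := Fin d × Fin d)
      (α₂ := Fin d), Finset.sum_ite_eq', Finset.mem_univ, if_true]
    refine Finset.sum_congr rfl fun i _ => ?_
    rw [Finset.sum_comm]
    simp_rw [← Finset.sum_mul, hA']
    simp
  rw [averageFidelity_network]
  have h1 : ∑ q : r × s, ∫ U, ‖((combOp (A q.2) (B q.1))ᴴ * mixedRep U).trace‖ ^ 2 ∂gateHaar d ≤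
      d * T ^ 2 := by
    refine (Finset.sum_le_sum fun q _ => integral_overlap_le_symProj hd _ hw hw').trans ?_
    rw [Finset.sum_comm]
    simp_rw [← Finset.mul_sum, hsum]
    rw [Fintype.sum_bool]
    simp only [w]
    apply le_of_eq
    have : ∀ ε, T / tau d ε / d * (d * (d * tau d ε ^ 2)) = d * T * tau d ε := fun ε => by
      have := (tau_pos hd ε).ne'
      field_simp
    rw [this, this, hT]
    ring
  calc _ ≤ d * T ^ 2 / (d : ℝ) ^ 4 := div_le_div_of_nonneg_right h1 (by positivity)
    _ = T ^ 2 / (d : ℝ) ^ 3 := by field_simp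
    _ = _ := by rw [hT, sum_tau_sq hd]

/-! ### Learning schemes as networks -/

/-- The encoding of a learning scheme as a network: the input systems are kept in the memory,
next to the vector `v`. -/
def storeOp {k : ℕ} (v : Fin d × Fin k → ℂ) :
    Matrix (Fin d × ((Fin d × Fin d) × Fin k)) (Fin d × Fin d) ℂ :=
  Matrix.of fun p i => if p.2.1 = i then v (p.1, p.2.2) else 0

/-- The reordering of systems between a learning scheme and the corresponding network. -/
def storeEquiv (d k : ℕ) :
    Fin d × ((Fin d × Fin d) × Fin k) ≃ (Fin d × Fin d) × (Fin d × Fin k) where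
  toFun p := (p.2.1, (p.1, p.2.2))
  invFun p := (p.2.1, (p.1, p.2.2))
  left_inv _ := rfl
  right_inv _ := rfl

/-- The decoding of a learning scheme as a network. -/
def retrieveOp {k : ℕ} (K : Matrix (Fin d × Fin d) ((Fin d × Fin d) × (Fin d × Fin k)) ℂ) :
    Matrix (Fin d × Fin d) (Fin d × ((Fin d × Fin d) × Fin k)) ℂ :=
  K.submatrix id (storeEquiv d k)

theorem sum_retrieveOp {k : ℕ} {r : Type} [Fintype r]
    {K : r → Matrix (Fin d × Fin d) ((Fin d × Fin d) × (Fin d × Fin k)) ℂ}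
    (hK : ∑ q, (K q)ᴴ * K q = 1) : ∑ q, (retrieveOp (K q))ᴴ * retrieveOp (K q) = 1 := by
  ext p p'
  have := congrFun (congrFun hK (storeEquiv d k p)) (storeEquiv d k p')
  simp only [Matrix.sum_apply, Matrix.mul_apply, Matrix.conjTranspose_apply, retrieveOp,
    Matrix.submatrix_apply, id_eq] at this ⊢
  rw [this, Matrix.one_apply, Matrix.one_apply]
  simp

/-- The memory keeps the input systems intact. -/
theorem sum_star_storeOp {k : ℕ} (v : Fin d × Fin k → ℂ) (i i' : Fin d × Fin d) (b b' : Fin d) :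
    ∑ x, star (storeOp v (b, x) i) * storeOp v (b', x) i' =
      if i = i' then ∑ x, star (v (b, x)) * v (b', x) else 0 := by
  simp only [storeOp, Matrix.of_apply, Fintype.sum_prod_type (α₁ := Fin d × Fin d)]
  rw [Finset.sum_eq_single i]
  · by_cases h : i = i' <;> simp [h]
  · intro j _ hj; simp [hj]
  · simp

theorem DensityMatrix.evolve_apply {k : ℕ} {s : Type} [Fintype s]
    (σ : DensityMatrix (Fin d × Fin k)) (v : s → Fin d × Fin k → ℂ)
    (hv : ∀ p q, σ.mat p q = ∑ t, v t p * star (v t q)) (U : Gate d) (p q : Fin d × Fin k) :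
    (σ.evolve U).mat p q =
      ∑ t, (∑ b, (U : Matrix (Fin d) (Fin d) ℂ) p.1 b * v t (b, p.2)) *
        star (∑ b, (U : Matrix (Fin d) (Fin d) ℂ) q.1 b * v t (b, q.2)) := by
  set G := (U : Matrix (Fin d) (Fin d) ℂ) ⊗ₖ (1 : Matrix (Fin k) (Fin k) ℂ) with hG
  have h1 : ∀ t p, (G *ᵥ v t) p = ∑ b, (U : Matrix (Fin d) (Fin d) ℂ) p.1 b * v t (b, p.2) := by
    intro t p
    simp [hG, Matrix.mulVec, dotProduct, Fintype.sum_prod_type, Matrix.one_apply]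
  have h2 : σ.mat = ∑ t, Matrix.vecMulVec (v t) (star (v t)) := by
    ext p q
    simp [hv, Matrix.sum_apply, Matrix.vecMulVec_apply]
  have h3 : (σ.evolve U).mat = ∑ t, Matrix.vecMulVec (G *ᵥ v t) (star (G *ᵥ v t)) := by
    change G * σ.mat * Gᴴ = _
    rw [h2, Matrix.mul_sum, Matrix.sum_mul]
    refine Finset.sum_congr rfl fun t _ => ?_
    rw [Matrix.mul_vecMulVec, Matrix.vecMulVec_mul, Matrix.star_mulVec]
  rw [h3, Matrix.sum_apply]
  simp only [Matrix.vecMulVec_apply, Pi.star_apply, h1]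

/-- A learning scheme is a network. -/
theorem learning_eq_network {k : ℕ} {r s : Type} [Fintype r] [Fintype s]
    (K : r → Matrix (Fin d × Fin d) ((Fin d × Fin d) × (Fin d × Fin k)) ℂ)
    (σ : DensityMatrix (Fin d × Fin k)) (v : s → Fin d × Fin k → ℂ)
    (hv : ∀ p q, σ.mat p q = ∑ t, v t p * star (v t q)) (U : Gate d)
    (ρ : Matrix (Fin d × Fin d) (Fin d × Fin d) ℂ) :
    krausMap K (ρ ⊗ₖ (σ.evolve U).mat) =
      krausMap (networkKraus (fun t => storeOp (v t)) (fun q => retrieveOp (K q)) U) ρ := by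
  set G := (U : Matrix (Fin d) (Fin d) ℂ) ⊗ₖ
      (1 : Matrix ((Fin d × Fin d) × Fin k) ((Fin d × Fin d) × Fin k) ℂ) with hG
  have h1 : ∀ t p i, (G * storeOp (v t)) p i =
      if p.2.1 = i then ∑ b, (U : Matrix (Fin d) (Fin d) ℂ) p.1 b * v t (b, p.2.2) else 0 := by
    intro t p i
    rw [Matrix.mul_apply, Fintype.sum_prod_type]
    have h : ∀ b, ∑ y, G p (b, y) * storeOp (v t) (b, y) i =
        if p.2.1 = i then (U : Matrix (Fin d) (Fin d) ℂ) p.1 b * v t (b, p.2.2) else 0 := by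
      intro b
      rw [Finset.sum_eq_single p.2]
      · simp [hG, storeOp]
      · intro y _ hy
        simp [hG, hy.symm]
      · simp
    simp_rw [h]
    split_ifs <;> simp
  have h2 : ∑ t, (G * storeOp (v t)) * ρ * (G * storeOp (v t))ᴴ =
      (ρ ⊗ₖ (σ.evolve U).mat).submatrix (storeEquiv d k) (storeEquiv d k) := by
    ext p p'
    rw [Matrix.submatrix_apply, Matrix.kroneckerMap_apply, σ.evolve_apply v hv, Finset.mul_sum,
      Matrix.sum_apply]
    refine Finset.sum_congr rfl fun t _ => ?_
    simp only [Matrix.mul_apply (N := (G * storeOp (v t))ᴴ), Matrix.mul_apply (N := ρ),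
      Matrix.conjTranspose_apply, h1, ite_mul, zero_mul, apply_ite star, star_zero, mul_ite,
      mul_zero, Finset.sum_ite_eq, Finset.mem_univ, if_true, storeEquiv, Equiv.coe_fn_mk]
    ring
  rw [krausMap_apply, krausMap_apply, Fintype.sum_prod_type]
  refine Finset.sum_congr rfl fun q _ => ?_
  have h3 : ∀ t, networkKraus (fun t => storeOp (v t)) (fun q => retrieveOp (K q)) U (q, t) * ρ *
      (networkKraus (fun t => storeOp (v t)) (fun q => retrieveOp (K q)) U (q, t))ᴴ =
      retrieveOp (K q) * ((G * storeOp (v t)) * ρ * (G * storeOp (v t))ᴴ) *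
        (retrieveOp (K q))ᴴ := fun t => by
    simp only [networkKraus, ← hG, Matrix.conjTranspose_mul, Matrix.mul_assoc]
  simp_rw [h3]
  rw [← Matrix.sum_mul, ← Matrix.mul_sum, h2, retrieveOp, Matrix.conjTranspose_submatrix,
    Matrix.submatrix_mul_equiv, Matrix.submatrix_mul_equiv, Matrix.submatrix_id_id]

/-- The upper bound for learning schemes. -/
theorem learning_le (hd : 2 ≤ d) {k : ℕ} {r : Type} [Fintype r]
    (K : r → Matrix (Fin d × Fin d) ((Fin d × Fin d) × (Fin d × Fin k)) ℂ)
    (hK : ∑ q, (K q)ᴴ * K q = 1) (σ : DensityMatrix (Fin d × Fin k)) :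
    averageFidelity d (fun U ρ => krausMap K (ρ ⊗ₖ (σ.evolve U).mat)) ≤
      (if d = 2 then 5 else 6) / (d : ℝ) ^ 4 := by
  have hd0 : (0 : ℝ) < d := by exact_mod_cast (by omega : 0 < d)
  obtain ⟨v, hv⟩ := posSemidef_exists_sum σ.posSemidef
  have hv1 : ∑ p, ∑ t, v t p * star (v t p) = 1 := by
    rw [← σ.trace_eq_one, Matrix.trace]
    simp only [Matrix.diag_apply, hv]
  have hnet : (fun (U : Gate d) (ρ : Matrix (Fin d × Fin d) (Fin d × Fin d) ℂ) =>
      krausMap K (ρ ⊗ₖ (σ.evolve U).mat)) = fun U =>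
        ⇑(krausMap (networkKraus (fun t => storeOp (v t)) (fun q => retrieveOp (K q)) U)) := by
    funext U ρ
    exact learning_eq_network K σ v hv U ρ
  rw [hnet, averageFidelity_network]
  refine div_le_div_of_nonneg_right ?_ (by positivity)
  have hsum : ∀ {l : Type} [Fintype l] (V : Matrix (Tri d) l ℂ) (κ : ℝ),
      (∀ b b', ∑ i, (V * Vᴴ) (i, b') (i, b) = if b' = b then (κ : ℂ) else 0) →
      ∑ q : r × (Fin d × Fin k),
        normSq (combOp (storeOp (v q.2)) (retrieveOp (K q.1)) * V) = d * κ := by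
    intro l _ V κ hV
    apply Complex.ofReal_injective
    rw [sum_normSq_combOp_mul (fun t => storeOp (v t)) (fun q => retrieveOp (K q))
      (sum_retrieveOp hK), Complex.ofReal_mul, Complex.ofReal_natCast]
    congr 1
    simp only [sum_star_storeOp, Fintype.sum_prod_type (α₁ := Fin d × Fin d) (α₂ := Fin d)]
    have h1 : ∀ i : Fin d × Fin d, ∀ b : Fin d, ∑ i', ∑ b',
        (∑ t, if i = i' then ∑ x, star (v t (b, x)) * v t (b', x) else 0) *
          (V * Vᴴ) (i', b') (i, b) =
        ∑ b', (∑ t, ∑ x, star (v t (b, x)) * v t (b', x)) * (V * Vᴴ) (i, b') (i, b) := by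
      intro i b
      rw [Finset.sum_eq_single i]
      · simp
      · intro j _ hj; simp [hj.symm]
      · simp
    simp_rw [h1]
    rw [Finset.sum_comm]
    have h2 : ∀ b, ∑ i : Fin d × Fin d, ∑ b', (∑ t, ∑ x, star (v t (b, x)) * v t (b', x)) *
        (V * Vᴴ) (i, b') (i, b) = (∑ x, ∑ t, v t (b, x) * star (v t (b, x))) * κ := by
      intro b
      rw [Finset.sum_comm]
      simp_rw [← Finset.mul_sum, hV]
      simp only [mul_ite, mul_zero, Finset.sum_ite_eq', Finset.mem_univ, if_true]
      rw [Finset.sum_comm]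
      simp only [mul_comm]
    simp_rw [h2]
    rw [← Finset.sum_mul, ← Fintype.sum_prod_type (f := fun p => ∑ t, v t p * star (v t p)), hv1,
      one_mul]
  have hE : ∀ ε, ∑ q : r × (Fin d × Fin k),
      normSq (combOp (storeOp (v q.2)) (retrieveOp (K q.1)) * embed d ε) = d := fun ε => by
    rw [hsum (embed d ε) 1 fun b b' => by simp [sum_embed_mul hd], mul_one]
  have hR : ∀ ε, ∑ q : r × (Fin d × Fin k),
      normSq (combOp (storeOp (v q.2)) (retrieveOp (K q.1)) * restProj d ε) = restDim d ε :=
    fun ε => by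
      rw [hsum (restProj d ε) (d * tau d ε ^ 2 - 1) fun b b' => by
        rw [restProj_conjTranspose, restProj_mul hd, if_pos rfl, sum_restProj hd], restDim]
  refine (Finset.sum_le_sum fun q _ => integral_overlap_le hd _ (w := fun _ => 2) (by norm_num)
    (by norm_num)).trans ?_
  rw [Finset.sum_comm, ← sum_restDim_div hd]
  simp_rw [Finset.sum_add_distrib, ← Finset.sum_div, ← Finset.mul_sum, hE, hR]
  rw [Fintype.sum_bool]
  apply le_of_eq
  field_simp
  norm_num

end

/-! ### The optimal cloning network -/

section
variable {d : ℕ}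

theorem krausMap_network {m r s : Type} [Fintype m] [DecidableEq m] [Fintype r] [Fintype s]
    (A : s → Matrix (Fin d × m) (Fin d × Fin d) ℂ) (B : r → Matrix (Fin d × Fin d) (Fin d × m) ℂ)
    (U : Gate d) (ρ : Matrix (Fin d × Fin d) (Fin d × Fin d) ℂ) :
    krausMap B (applyGate U (krausMap A ρ)) = krausMap (networkKraus A B U) ρ := by
  simp only [krausMap_apply, applyGate, Fintype.sum_prod_type, networkKraus]
  refine Finset.sum_congr rfl fun q _ => ?_
  simp only [Matrix.mul_sum, Matrix.sum_mul]
  refine Finset.sum_congr rfl fun t _ => ?_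
  simp only [Matrix.conjTranspose_mul, Matrix.mul_assoc]

theorem cloningFidelities_le (hd : 2 ≤ d) {F : ℝ} (hF : F ∈ cloningFidelities d) :
    F ≤ (d + Real.sqrt ((d : ℝ) ^ 2 - 1)) / (d : ℝ) ^ 3 := by
  obtain ⟨k, 𝒜, ℬ, h𝒜, hℬ, rfl⟩ := hF
  obtain ⟨A, rfl, hA⟩ := h𝒜.exists_kraus
  obtain ⟨B, rfl, hB⟩ := hℬ.exists_kraus
  simp_rw [krausMap_network]
  exact network_le hd A B hA hB

/-- Networks may use a memory with an arbitrary finite index type. -/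
theorem network_mem_cloningFidelities {m r s : Type} [Fintype m] [DecidableEq m] [Fintype r]
    [Fintype s] (A : s → Matrix (Fin d × m) (Fin d × Fin d) ℂ)
    (B : r → Matrix (Fin d × Fin d) (Fin d × m) ℂ)
    (hA : ∑ t, (A t)ᴴ * A t = 1) (hB : ∑ t, (B t)ᴴ * B t = 1) :
    averageFidelity d (fun U => krausMap (networkKraus A B U)) ∈ cloningFidelities d := by
  let e : Fin d × Fin (Fintype.card m) ≃ Fin d × m :=
    Equiv.prodCongr (Equiv.refl _) (Fintype.equivFin m).symm
  let A' : s → Matrix (Fin d × Fin (Fintype.card m)) (Fin d × Fin d) ℂ := fun t =>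
    (A t).submatrix e id
  let B' : r → Matrix (Fin d × Fin d) (Fin d × Fin (Fintype.card m)) ℂ := fun t =>
    (B t).submatrix id e
  have hA' : ∑ t, (A' t)ᴴ * A' t = 1 := by
    rw [← hA]
    refine Finset.sum_congr rfl fun t _ => ?_
    rw [Matrix.conjTranspose_submatrix, Matrix.submatrix_mul_equiv, Matrix.submatrix_id_id]
  have hB' : ∑ t, (B' t)ᴴ * B' t = 1 := by
    have h : ∑ t, (B' t)ᴴ * B' t = (∑ t, (B t)ᴴ * B t).submatrix e e := by
      ext p q
      simp [B', Matrix.sum_apply, Matrix.mul_apply]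
    rw [h, hB, Matrix.submatrix_one_equiv]
  refine ⟨Fintype.card m, krausMap A', krausMap B', isChannel_krausMap hA',
    isChannel_krausMap hB', ?_⟩
  simp_rw [krausMap_network]
  congr 1
  funext U
  congr 2
  funext q
  have hG : (U : Matrix (Fin d) (Fin d) ℂ) ⊗ₖ
      (1 : Matrix (Fin (Fintype.card m)) (Fin (Fintype.card m)) ℂ) =
      ((U : Matrix (Fin d) (Fin d) ℂ) ⊗ₖ (1 : Matrix m m ℂ)).submatrix e e := by
    ext p q
    simp [e, Matrix.one_apply]
  simp only [networkKraus, hG, A', B']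
  rw [Matrix.submatrix_mul_equiv, Matrix.submatrix_mul_equiv, Matrix.submatrix_id_id]

/-- The encoding of the optimal network: an isometry to the gate input, a copy of the
`d`-dimensional space, and a bit for the symmetry type. -/
def cloneEncode (d : ℕ) : Matrix (Fin d × (Fin d × Bool)) (Fin d × Fin d) ℂ :=
  Matrix.of fun p i => tau d p.2.2 * embed d p.2.2 (i, p.1) p.2.1

/-- The Kraus operators of the decoding of the optimal network. -/
def cloneDecode (d : ℕ) (t : Fin d × Fin d) : Matrix (Fin d × Fin d) (Fin d × (Fin d × Bool)) ℂ :=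
  Matrix.of fun o p => if p.2.1 = t.2 then embed d p.2.2 (o, p.1) t.1 else 0

theorem cloneEncode_isometry (hd : 2 ≤ d) : (cloneEncode d)ᴴ * cloneEncode d = 1 := by
  have h : ∀ p i, cloneEncode d p i =
      2⁻¹ * ((if i.1 = p.2.1 ∧ i.2 = p.1 then 1 else 0) +
      sgn p.2.2 * (if i.2 = p.2.1 ∧ i.1 = p.1 then 1 else 0)) := by
    intro p i
    rw [cloneEncode, Matrix.of_apply, embed_apply, ← mul_assoc, mul_inv_cancel₀ (tau_ne_zero hd _),
      one_mul]
  have hr : ∀ p i, star (cloneEncode d p i) = cloneEncode d p i := by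
    intro p i
    rw [h]
    simp [apply_ite (starRingEnd ℂ)]
  ext i i'
  simp only [Matrix.mul_apply, Matrix.conjTranspose_apply, hr]
  simp only [h, Fintype.sum_prod_type, Fintype.sum_bool, sgn]
  have h3 : ∀ b v : Fin d,
      (2⁻¹ * ((if i.1 = v ∧ i.2 = b then (1 : ℂ) else 0) +
        ((1 : ℝ) : ℂ) * (if i.2 = v ∧ i.1 = b then 1 else 0))) *
      (2⁻¹ * ((if i'.1 = v ∧ i'.2 = b then (1 : ℂ) else 0) +
        ((1 : ℝ) : ℂ) * (if i'.2 = v ∧ i'.1 = b then 1 else 0))) +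
      (2⁻¹ * ((if i.1 = v ∧ i.2 = b then (1 : ℂ) else 0) +
        ((-1 : ℝ) : ℂ) * (if i.2 = v ∧ i.1 = b then 1 else 0))) *
      (2⁻¹ * ((if i'.1 = v ∧ i'.2 = b then (1 : ℂ) else 0) +
        ((-1 : ℝ) : ℂ) * (if i'.2 = v ∧ i'.1 = b then 1 else 0))) =
      2⁻¹ * ((if i.1 = v ∧ i.2 = b then (1 : ℂ) else 0) *
        (if i'.1 = v ∧ i'.2 = b then (1 : ℂ) else 0) +
        (if i.2 = v ∧ i.1 = b then (1 : ℂ) else 0) *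
        (if i'.2 = v ∧ i'.1 = b then (1 : ℂ) else 0)) := by
    intro b v
    push_cast
    ring
  simp_rw [h3, ← Finset.mul_sum, Finset.sum_add_distrib, ite_and]
  simp only [mul_ite, mul_one, mul_zero, Finset.sum_ite_eq, Finset.mem_univ, if_true]
  simp only [Matrix.one_apply, Prod.ext_iff]
  by_cases e1 : i.1 = i'.1 <;> by_cases e2 : i.2 = i'.2 <;> norm_num [e1, e2]

/-- The Gram matrix is a partial trace of the operators `embed d ε * (embed d ε')ᴴ`. -/
theorem cloneDecode_sum (hd : 2 ≤ d) : ∑ t, (cloneDecode d t)ᴴ * cloneDecode d t = 1 := by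
  ext ⟨a, β, ε⟩ ⟨a', β', ε'⟩
  have h : (∑ t, (cloneDecode d t)ᴴ * cloneDecode d t) (a, (β, ε)) (a', (β', ε')) =
      ∑ γ, if β = γ ∧ β' = γ then ∑ o, (embed d ε' * (embed d ε)ᴴ) (o, a') (o, a) else 0 := by
    simp only [Matrix.sum_apply, Matrix.mul_apply, Matrix.conjTranspose_apply, cloneDecode,
      Matrix.of_apply, apply_ite star, star_zero]
    rw [Fintype.sum_prod_type_right]
    refine Finset.sum_congr rfl fun γ _ => ?_
    split_ifs with h1
    · rw [Finset.sum_comm]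
      refine Finset.sum_congr rfl fun o _ => Finset.sum_congr rfl fun α _ => ?_
      rw [if_pos h1.1, if_pos h1.2, mul_comm]
    · refine Finset.sum_eq_zero fun α _ => Finset.sum_eq_zero fun o _ => ?_
      rw [not_and_or] at h1
      rcases h1 with h1 | h1 <;> simp [h1]
  rw [h]
  simp only [sum_embed_mul hd, Matrix.one_apply, Prod.mk.injEq, ite_and]
  simp
  grind

theorem sum_norm_sq_gate (U : Gate d) :
    ∑ t : Fin d × Fin d, ‖(U : Matrix (Fin d) (Fin d) ℂ) t.1 t.2‖ ^ 2 = d := by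
  have h := trace_conjTranspose_mul_self (U : Matrix (Fin d) (Fin d) ℂ)
  rw [gate_conjTranspose_mul, Matrix.trace_one, Fintype.card_fin] at h
  exact_mod_cast h.symm

/-- The amplitudes of the two symmetry types add up coherently, because the decoding does not
measure the type. -/
theorem clone_trace (hd : 2 ≤ d) (t : Fin d × Fin d) (U : Gate d) :
    ‖((combOp (cloneEncode d) (cloneDecode d t))ᴴ * mixedRep U).trace‖ ^ 2 =
      (tau d true + tau d false) ^ 2 * ‖(U : Matrix (Fin d) (Fin d) ℂ) t.1 t.2‖ ^ 2 := by
  have h1 : combOp (cloneEncode d) (cloneDecode d t) =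
      ∑ ε, (tau d ε : ℂ) • (embed d ε * Matrix.single t.1 t.2 (1 : ℂ) * (embed d ε)ᴴ) := by
    ext p q
    simp only [combOp, cloneEncode, cloneDecode, Matrix.of_apply, Fintype.sum_prod_type_right,
      Matrix.sum_apply, Matrix.smul_apply, smul_eq_mul]
    refine Finset.sum_congr rfl fun ε _ => ?_
    rw [Finset.sum_eq_single t.2]
    · simp [Matrix.mul_apply, Matrix.single_apply, ite_and, star_embed]
      ring
    · intro β _ hβ; simp [hβ]
    · simp
  have h2 : ((combOp (cloneEncode d) (cloneDecode d t))ᴴ * mixedRep U).trace =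
      ((tau d true + tau d false : ℝ) : ℂ) * (U : Matrix (Fin d) (Fin d) ℂ) t.1 t.2 := by
    have h3 : ∀ ε, (((tau d ε : ℂ) • (embed d ε * Matrix.single t.1 t.2 (1 : ℂ) * (embed d ε)ᴴ))ᴴ *
        mixedRep U).trace = (tau d ε : ℂ) * (U : Matrix (Fin d) (Fin d) ℂ) t.1 t.2 := by
      intro ε
      have hs : star (tau d ε : ℂ) = tau d ε := Complex.conj_ofReal _
      have hE := embed_conjTranspose_mul hd ε ε
      rw [if_pos rfl] at hE
      rw [Matrix.conjTranspose_smul, hs, Matrix.smul_mul, Matrix.trace_smul, smul_eq_mul,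
        Matrix.conjTranspose_mul, Matrix.conjTranspose_mul, Matrix.conjTranspose_conjTranspose,
        Matrix.trace_mul_comm, ← Matrix.mul_assoc, mixedRep_mul_embed, Matrix.mul_assoc,
        Matrix.trace_mul_comm, Matrix.mul_assoc, Matrix.mul_assoc,
        hE, Matrix.mul_one, Matrix.conjTranspose_single, star_one, Matrix.trace_mul_single]
      simp
    rw [h1, Matrix.conjTranspose_sum, Matrix.sum_mul, Matrix.trace_sum]
    simp_rw [h3]
    rw [Fintype.sum_bool]
    push_cast
    ring
  rw [h2, norm_mul, mul_pow, Complex.norm_real, Real.norm_eq_abs, sq_abs]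

/-- The fidelity of the network given by `cloneEncode` and `cloneDecode` is the same for all gates.
-/
theorem cloning_attained (hd : 2 ≤ d) :
    (d + Real.sqrt ((d : ℝ) ^ 2 - 1)) / (d : ℝ) ^ 3 ∈ cloningFidelities d := by
  have hd0 : (0 : ℝ) < d := by exact_mod_cast (by omega : 0 < d)
  have h := network_mem_cloningFidelities (fun _ : Unit => cloneEncode d) (cloneDecode d)
    (by simpa using cloneEncode_isometry hd) (cloneDecode_sum hd)
  convert h using 1
  have h1 : ∀ U : Gate d, gateFidelity U
      (krausMap (networkKraus (fun _ : Unit => cloneEncode d) (cloneDecode d) U)) =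
      (d + Real.sqrt ((d : ℝ) ^ 2 - 1)) / (d : ℝ) ^ 3 := by
    intro U
    rw [gateFidelity_krausMap]
    simp only [networkKraus, norm_trace_network, clone_trace hd]
    rw [Fintype.sum_prod_type]
    simp only [Finset.univ_unique, Finset.sum_singleton]
    rw [← Finset.mul_sum, sum_norm_sq_gate, sum_tau_sq hd]
    field_simp
  simp [averageFidelity, h1]

end

/-! ### The optimal estimation scheme -/

section
variable {d : ℕ}

/-- The defining representation is irreducible. -/
theorem exists_smul_one_of_commute {Y : Matrix (Fin d) (Fin d) ℂ}
    (hY : ∀ U : Gate d, (U : Matrix (Fin d) (Fin d) ℂ) * Y = Y * (U : Matrix (Fin d) (Fin d) ℂ)) :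
    ∃ c : ℂ, Y = c • 1 := by
  have h0 : ∀ i j, i ≠ j → Y i j = 0 := by
    intro i j hij
    have h := congrFun (congrFun (hY (phaseGate i)) i) j
    simp only [phaseGate, Matrix.diagonal_mul, Matrix.mul_diagonal, if_true, if_neg hij.symm,
      mul_one] at h
    have h1 : (Complex.I - 1) * Y i j = 0 := by rw [sub_mul, h, one_mul, sub_self]
    rcases mul_eq_zero.mp h1 with h2 | h2
    · have := congrArg Complex.re h2; simp at this
    · exact h2
  have h1 : ∀ i j, Y i i = Y j j := by
    intro i j
    have h := congrFun (congrFun (hY (permGate (Equiv.swap i j))) j) i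
    rw [Matrix.mul_apply, Matrix.mul_apply, Finset.sum_eq_single i, Finset.sum_eq_single j] at h
    · simpa [permGate] using h
    · intro k _ hk
      simp [permGate, hk, Equiv.swap_apply_left]
    · simp
    · intro k _ hk
      have : j ≠ Equiv.swap i j k := fun h' => hk (by
        rw [← Equiv.swap_apply_self i j k, ← h', Equiv.swap_apply_right])
      simp [permGate, this]
    · simp
  rcases isEmpty_or_nonempty (Fin d) with he | ⟨⟨a⟩⟩
  · exact ⟨0, by ext i; exact he.elim i⟩
  · refine ⟨Y a a, ?_⟩
    ext i j
    by_cases h : i = j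
    · subst h; simp [h1 i a]
    · simp [h0 i j h, h]

/-- The second moments of the entries of a Haar random gate. -/
theorem integral_gate_mul_star (i j k l : Fin d) :
    ∫ U : Gate d, (U : Matrix (Fin d) (Fin d) ℂ) i j *
      star ((U : Matrix (Fin d) (Fin d) ℂ) k l) ∂gateHaar d =
      if i = k ∧ j = l then (d : ℂ)⁻¹ else 0 := by
  have hG : IsUnitaryRep fun U : Gate d => (U : Matrix (Fin d) (Fin d) ℂ) :=
    ⟨continuous_gate, fun _ _ => rfl, gate_conjTranspose_mul⟩
  rw [hG.integral_mul_star (fun _ : Unit => 1) (by simp) (fun s t h => (h rfl).elim)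
    (fun X hX => ?_)]
  · simp [Matrix.one_apply, ite_and, apply_ite star]
    split_ifs <;> simp
  · obtain ⟨c, rfl⟩ := exists_smul_one_of_commute hX
    exact Submodule.smul_mem _ _ (Submodule.subset_span ⟨(), rfl⟩)

theorem posSemidef_integral {Ω n : Type} [MeasurableSpace Ω] [Fintype n] {μ : Measure Ω}
    {f : Ω → Matrix n n ℂ} (hint : ∀ i j, Integrable (fun x => f x i j) μ)
    (hf : ∀ x, (f x).PosSemidef) : (Matrix.of fun i j => ∫ x, f x i j ∂μ).PosSemidef := by
  refine Matrix.PosSemidef.of_dotProduct_mulVec_nonneg ?_ fun v => ?_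
  · ext i j
    rw [Matrix.conjTranspose_apply, Matrix.of_apply, Matrix.of_apply, RCLike.star_def,
      ← integral_conj]
    congr 1
    funext x
    exact (hf x).isHermitian.apply i j
  · have h : star v ⬝ᵥ (Matrix.of fun i j => ∫ x, f x i j ∂μ) *ᵥ v =
        ∫ x, star v ⬝ᵥ (f x *ᵥ v) ∂μ := by
      simp only [dotProduct, Matrix.mulVec, Matrix.of_apply, Finset.mul_sum]
      have h1 : ∀ i j, Integrable (fun x => star v i * (f x i j * v j)) μ := fun i j =>
        ((hint i j).mul_const _).const_mul _
      rw [integral_finsetSum _ fun i _ => integrable_finsetSum _ fun j _ => h1 i j]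
      refine Finset.sum_congr rfl fun i _ => ?_
      rw [integral_finsetSum _ fun j _ => h1 i j]
      refine Finset.sum_congr rfl fun j _ => ?_
      rw [integral_const_mul, integral_mul_const]
    rw [h]
    exact integral_nonneg fun x => (hf x).dotProduct_mulVec_nonneg v

theorem integrable_gateFidelity {Ω : Type} [MeasurableSpace Ω] {μ : Measure Ω} (U : Gate d)
    {Φ : Ω → Matrix (Fin d × Fin d) (Fin d × Fin d) ℂ → Matrix (Fin d × Fin d) (Fin d × Fin d) ℂ}
    (hint : ∀ ρ i j, Integrable (fun x => Φ x ρ i j) μ) :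
    Integrable (fun x => gateFidelity U (Φ x)) μ := by
  refine Integrable.div_const (Integrable.re (𝕜 := ℂ) ?_) _
  simp only [Matrix.trace, Matrix.diag_apply, Matrix.mul_apply]
  exact integrable_finsetSum _ fun p _ => integrable_finsetSum _ fun q _ =>
    (hint _ _ _).mul_const _

/-- The fidelity is affine, also for continuous mixtures. -/
theorem gateFidelity_integral {Ω : Type} [MeasurableSpace Ω] {μ : Measure Ω} (U : Gate d)
    {Φ : Ω → Matrix (Fin d × Fin d) (Fin d × Fin d) ℂ → Matrix (Fin d × Fin d) (Fin d × Fin d) ℂ}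
    (hint : ∀ ρ i j, Integrable (fun x => Φ x ρ i j) μ) :
    gateFidelity U (fun ρ => Matrix.of fun i j => ∫ x, Φ x ρ i j ∂μ) =
      ∫ x, gateFidelity U (Φ x) ∂μ := by
  have h1 : ∀ p q, Integrable (fun x => choi (Φ x) p q * ketbra (ket (twoCopies U)) q p) μ :=
    fun p q => (hint _ _ _).mul_const _
  simp only [gateFidelity]
  rw [integral_div]
  congr 1
  have h2 : (choi (fun ρ => Matrix.of fun i j => ∫ x, Φ x ρ i j ∂μ) *
      ketbra (ket (twoCopies U))).trace =
      ∫ x, (choi (Φ x) * ketbra (ket (twoCopies U))).trace ∂μ := by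
    simp only [Matrix.trace, Matrix.diag_apply, Matrix.mul_apply]
    rw [integral_finsetSum _ fun p _ => integrable_finsetSum _ fun q _ => h1 p q]
    refine Finset.sum_congr rfl fun p _ => ?_
    rw [integral_finsetSum _ fun q _ => h1 p q]
    refine Finset.sum_congr rfl fun q _ => ?_
    rw [integral_mul_const]
    simp [choi]
  rw [h2]
  refine (integral_re (𝕜 := ℂ) ?_).symm
  simp only [Matrix.trace, Matrix.diag_apply, Matrix.mul_apply]
  exact integrable_finsetSum _ fun p _ => integrable_finsetSum _ fun q _ => h1 p q

/-- The Kraus operator of the estimation scheme for the estimate `V`. -/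
def estimateKraus (U V : Gate d) (_ : Unit) : Matrix (Fin d × Fin d) (Fin d × Fin d) ℂ :=
  ((V : Matrix (Fin d) (Fin d) ℂ)ᴴ * (U : Matrix (Fin d) (Fin d) ℂ)).trace • twoCopies V

theorem continuous_twoCopies : Continuous fun V : Gate d => twoCopies V := by
  refine continuous_pi fun p => continuous_pi fun q => ?_
  exact (continuous_gate.matrix_elem _ _).mul (continuous_gate.matrix_elem _ _)

theorem continuous_estimateKraus (U : Gate d) (ρ : Matrix (Fin d × Fin d) (Fin d × Fin d) ℂ) :
    Continuous fun V => krausMap (estimateKraus U V) ρ := by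
  have h : Continuous fun V : Gate d => estimateKraus U V () :=
    ((continuous_gate.matrix_conjTranspose.matrix_mul continuous_const).matrix_trace).smul
      continuous_twoCopies
  simp only [krausMap_apply, Finset.univ_unique, Finset.sum_singleton]
  exact (h.matrix_mul continuous_const).matrix_mul h.matrix_conjTranspose

/-- The estimate `V` has density `‖Tr (Vᴴ * U)‖ ^ 2`, and the fidelity of `V ⊗ V` with `U ⊗ U` is
`‖Tr (Uᴴ * V)‖ ^ 4 / d ^ 4`; by invariance, the average is a sixth moment of the trace. -/
theorem averageFidelity_estimate (hd : 2 ≤ d) :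
    averageFidelity d (fun U ρ => haarAverage fun V => krausMap (estimateKraus U V) ρ) =
      (if d = 2 then 5 else 6) / (d : ℝ) ^ 4 := by
  have h1 : ∀ U : Gate d,
      gateFidelity U (fun ρ => haarAverage fun V => krausMap (estimateKraus U V) ρ) =
      (if d = 2 then 5 else 6) / (d : ℝ) ^ 4 := by
    intro U
    rw [show (fun ρ => haarAverage fun V => krausMap (estimateKraus U V) ρ) = fun ρ =>
      Matrix.of fun i j => ∫ V, krausMap (estimateKraus U V) ρ i j ∂gateHaar d from rfl,
      gateFidelity_integral U (Φ := fun V => krausMap (estimateKraus U V)) fun ρ i j =>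
        integrable_of_continuous ((continuous_estimateKraus U ρ).matrix_elem i j)]
    simp only [gateFidelity_krausMap, Finset.univ_unique, Finset.sum_singleton]
    rw [integral_div, ← integral_norm_trace_pow_six hd]
    congr 1
    rw [← integral_mul_left_eq_self (fun V : Gate d =>
      ‖(V : Matrix (Fin d) (Fin d) ℂ).trace‖ ^ 6) U⁻¹]
    congr 1
    funext V
    have h2 : ((twoCopies U)ᴴ * twoCopies V).trace =
        ((U : Matrix (Fin d) (Fin d) ℂ)ᴴ * (V : Matrix (Fin d) (Fin d) ℂ)).trace ^ 2 := by
      rw [twoCopies, twoCopies, Matrix.conjTranspose_kronecker, ← Matrix.mul_kronecker_mul,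
        Matrix.trace_kronecker, sq]
    have h3 : ((V : Matrix (Fin d) (Fin d) ℂ)ᴴ * (U : Matrix (Fin d) (Fin d) ℂ)).trace =
        star ((U : Matrix (Fin d) (Fin d) ℂ)ᴴ * (V : Matrix (Fin d) (Fin d) ℂ)).trace := by
      rw [← Matrix.trace_conjTranspose, Matrix.conjTranspose_mul,
        Matrix.conjTranspose_conjTranspose]
    have h4 : ((U⁻¹ * V : Gate d) : Matrix (Fin d) (Fin d) ℂ) =
        (U : Matrix (Fin d) (Fin d) ℂ)ᴴ * (V : Matrix (Fin d) (Fin d) ℂ) := rfl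
    rw [estimateKraus, Matrix.mul_smul, Matrix.trace_smul, smul_eq_mul, h2, h3, h4, norm_mul,
      norm_star, norm_pow]
    ring
  simp [averageFidelity, h1]

/-- The maximally entangled state. -/
def maxEntangled (hd : 2 ≤ d) : DensityMatrix (Fin d × Fin d) where
  mat := (d : ℂ)⁻¹ • ketbra (ket (1 : Matrix (Fin d) (Fin d) ℂ))
  posSemidef := (Matrix.posSemidef_vecMulVec_self_star _).smul (by positivity)
  trace_eq_one := by
    have : (d : ℂ) ≠ 0 := by exact_mod_cast (by omega : d ≠ 0)
    simp [Matrix.trace, ketbra, ket, Matrix.vecMulVec_apply, Fintype.sum_prod_type,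
      Matrix.one_apply, apply_ite (starRingEnd ℂ), this]

theorem maxEntangled_evolve (hd : 2 ≤ d) (U : Gate d) :
    ((maxEntangled hd).evolve U).mat =
      (d : ℂ)⁻¹ • ketbra (ket (U : Matrix (Fin d) (Fin d) ℂ)) := by
  have h : ((U : Matrix (Fin d) (Fin d) ℂ) ⊗ₖ (1 : Matrix (Fin d) (Fin d) ℂ)) *ᵥ
      ket (1 : Matrix (Fin d) (Fin d) ℂ) = ket (U : Matrix (Fin d) (Fin d) ℂ) := by
    ext p
    simp [ket, Matrix.mulVec, dotProduct, Fintype.sum_prod_type, Matrix.one_apply]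
  change ((U : Matrix (Fin d) (Fin d) ℂ) ⊗ₖ (1 : Matrix (Fin d) (Fin d) ℂ)) *
    ((d : ℂ)⁻¹ • ketbra (ket (1 : Matrix (Fin d) (Fin d) ℂ))) *
    ((U : Matrix (Fin d) (Fin d) ℂ) ⊗ₖ (1 : Matrix (Fin d) (Fin d) ℂ))ᴴ = _
  rw [Matrix.mul_smul, Matrix.smul_mul, ketbra, Matrix.mul_vecMulVec, Matrix.vecMulVec_mul,
    ← Matrix.star_mulVec, h, ketbra]

/-- The density of the measurement `d • |V⟩⟨V| dV`. -/
def estimateDensity (V : Gate d) : Matrix (Fin d × Fin d) (Fin d × Fin d) ℂ :=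
  (d : ℂ) • ketbra (ket (V : Matrix (Fin d) (Fin d) ℂ))

theorem continuous_estimateDensity : Continuous fun V : Gate d => estimateDensity V := by
  refine continuous_pi fun p => continuous_pi fun q => ?_
  exact continuous_const.mul ((continuous_gate.matrix_elem p.1 p.2).mul
    (continuous_gate.matrix_elem q.1 q.2).star)

theorem integrable_estimateDensity (p q : Fin d × Fin d) :
    Integrable (fun V : Gate d => estimateDensity V p q) (gateHaar d) :=
  integrable_of_continuous (continuous_estimateDensity.matrix_elem p q)

theorem estimateDensity_posSemidef (V : Gate d) : (estimateDensity V).PosSemidef :=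
  (Matrix.posSemidef_vecMulVec_self_star _).smul (by positivity)

theorem haarAverage_estimateDensity (hd : 2 ≤ d) :
    haarAverage (fun V : Gate d => estimateDensity V) = 1 := by
  have hd0 : (d : ℂ) ≠ 0 := by exact_mod_cast (by omega : d ≠ 0)
  ext p q
  simp only [haarAverage, Matrix.of_apply, estimateDensity, Matrix.smul_apply, ketbra,
    Matrix.vecMulVec_apply, Pi.star_apply, ket, smul_eq_mul, integral_const_mul,
    integral_gate_mul_star, Matrix.one_apply, Prod.ext_iff]
  split_ifs <;> simp [hd0]

/-- The measurement of the estimation scheme. -/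
def estimatePOVM (hd : 2 ≤ d) : POVM (Gate d) (Fin d × Fin d) where
  effect :=
    { measureOf' := fun s => open Classical in if MeasurableSet s then
        Matrix.of fun p q => ∫ V in s, estimateDensity V p q ∂gateHaar d else 0
      empty' := by ext p q; simp
      not_measurable' := fun s hs => if_neg hs
      m_iUnion' := by
        intro f hf hdisj
        rw [if_pos (MeasurableSet.iUnion hf)]
        simp only [hf, if_true]
        refine Pi.hasSum.mpr fun p => Pi.hasSum.mpr fun q => ?_
        exact hasSum_integral_iUnion hf hdisj (integrable_estimateDensity p q).integrableOn }
  posSemidef := by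
    intro s
    change Matrix.PosSemidef (open Classical in if MeasurableSet s then
        Matrix.of fun p q => ∫ V in s, estimateDensity V p q ∂gateHaar d else 0)
    split_ifs
    · exact posSemidef_integral (fun p q => (integrable_estimateDensity p q).integrableOn)
        estimateDensity_posSemidef
    · exact Matrix.PosSemidef.zero
  effect_univ := by
    change (open Classical in if MeasurableSet Set.univ then
        Matrix.of fun p q => ∫ V in Set.univ, estimateDensity V p q ∂gateHaar d else 0) = _
    rw [if_pos MeasurableSet.univ, Measure.restrict_univ]
    exact haarAverage_estimateDensity hd

theorem estimatePOVM_effect (hd : 2 ≤ d) {s : Set (Gate d)} (hs : MeasurableSet s) :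
    (estimatePOVM hd).effect s =
      Matrix.of fun p q => ∫ V in s, estimateDensity V p q ∂gateHaar d :=
  if_pos hs

theorem POVM.law_apply {Ω : Type} [MeasurableSpace Ω] {n : Type} [Fintype n] [DecidableEq n]
    (P : POVM Ω n) (τ : DensityMatrix n) {s : Set Ω} (hs : MeasurableSet s) :
    P.law τ s = ENNReal.ofReal ((P.effect s * τ.mat).trace.re) :=
  Measure.ofMeasurable_apply s hs

theorem trace_estimateDensity_mul (hd : 2 ≤ d) (U V : Gate d) :
    (estimateDensity V * ((maxEntangled hd).evolve U).mat).trace =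
      ((‖((V : Matrix (Fin d) (Fin d) ℂ)ᴴ * (U : Matrix (Fin d) (Fin d) ℂ)).trace‖ ^ 2 : ℝ) :
        ℂ) := by
  have hd0 : (d : ℂ) ≠ 0 := by exact_mod_cast (by omega : d ≠ 0)
  rw [maxEntangled_evolve, estimateDensity, Matrix.smul_mul, Matrix.mul_smul, smul_smul,
    mul_inv_cancel₀ hd0, one_smul, ketbra, ketbra, Matrix.vecMulVec_mul_vecMulVec,
    Matrix.trace_vecMulVec, Complex.ofReal_pow, ← Complex.mul_conj',
    trace_conjTranspose_mul_eq_sum]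
  rw [dotProduct_smul, smul_eq_mul]
  congr 1
  simp [dotProduct, ket, map_sum]

/-- The law of the estimate of `U` has density `‖Tr (Vᴴ * U)‖ ^ 2`. -/
theorem estimatePOVM_law (hd : 2 ≤ d) (U : Gate d) :
    (estimatePOVM hd).law ((maxEntangled hd).evolve U) =
      (gateHaar d).withDensity fun V => ENNReal.ofReal
        (‖((V : Matrix (Fin d) (Fin d) ℂ)ᴴ * (U : Matrix (Fin d) (Fin d) ℂ)).trace‖ ^ 2) := by
  have hc : Continuous fun V : Gate d =>
      ‖((V : Matrix (Fin d) (Fin d) ℂ)ᴴ * (U : Matrix (Fin d) (Fin d) ℂ)).trace‖ ^ 2 :=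
    ((continuous_gate.matrix_conjTranspose.matrix_mul continuous_const).matrix_trace).norm.pow 2
  refine Measure.ext fun s hs => ?_
  rw [POVM.law_apply _ _ hs, withDensity_apply _ hs, ← ofReal_integral_eq_lintegral_ofReal
    (integrable_of_continuous hc).integrableOn (Filter.Eventually.of_forall fun V => by positivity),
    estimatePOVM_effect hd hs]
  congr 1
  have h1 : ((Matrix.of fun p q => ∫ V in s, estimateDensity V p q ∂gateHaar d) *
      ((maxEntangled hd).evolve U).mat).trace =
      ∫ V in s, (estimateDensity V * ((maxEntangled hd).evolve U).mat).trace ∂gateHaar d := by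
    have h2 : ∀ p q, Integrable (fun V => estimateDensity V p q *
        ((maxEntangled hd).evolve U).mat q p) ((gateHaar d).restrict s) := fun p q =>
      ((integrable_estimateDensity p q).mul_const _).integrableOn
    simp only [Matrix.trace, Matrix.diag_apply, Matrix.mul_apply, Matrix.of_apply]
    rw [integral_finsetSum _ fun p _ => integrable_finsetSum _ fun q _ => h2 p q]
    refine Finset.sum_congr rfl fun p _ => ?_
    rw [integral_finsetSum _ fun q _ => h2 p q]
    refine Finset.sum_congr rfl fun q _ => ?_
    rw [integral_mul_const]
  rw [h1]
  simp_rw [trace_estimateDensity_mul hd]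
  rw [integral_complex_ofReal, Complex.ofReal_re]

theorem estimation_attained (hd : 2 ≤ d) :
    (if d = 2 then 5 else 6) / (d : ℝ) ^ 4 ∈ estimationFidelities d := by
  refine ⟨d, maxEntangled hd, estimatePOVM hd, ?_⟩
  rw [← averageFidelity_estimate hd]
  congr 1
  funext U ρ
  ext i j
  have hm : Measurable fun V : Gate d => ENNReal.ofReal
        (‖((V : Matrix (Fin d) (Fin d) ℂ)ᴴ * (U : Matrix (Fin d) (Fin d) ℂ)).trace‖ ^ 2) := by
    refine ENNReal.measurable_ofReal.comp (Continuous.measurable ?_)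
    exact ((continuous_gate.matrix_conjTranspose.matrix_mul
      continuous_const).matrix_trace).norm.pow 2
  rw [measurePrepareMap, Matrix.of_apply, estimatePOVM_law hd,
    integral_withDensity_eq_integral_toReal_smul hm
      (Filter.Eventually.of_forall fun _ => ENNReal.ofReal_lt_top), haarAverage, Matrix.of_apply]
  congr 1
  funext V
  rw [ENNReal.toReal_ofReal (by positivity), krausMap_apply, Finset.univ_unique,
    Finset.sum_singleton, estimateKraus, Matrix.conjTranspose_smul, Matrix.smul_mul,
    Matrix.smul_mul, Matrix.mul_smul, smul_smul, Matrix.smul_apply, RCLike.star_def,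
    Complex.mul_conj', ← Complex.ofReal_pow, smul_eq_mul, Complex.real_smul]

/-- The Kraus operator that applies `A` to the first system after finding the vector `w` on the
second one. -/
def measureKraus {m n p : Type} (A : Matrix m n ℂ) (w : p → ℂ) : Matrix m (n × p) ℂ :=
  Matrix.of fun o x => A o x.1 * star (w x.2)

theorem measureKraus_mul {m n p : Type} [Fintype n] [Fintype p] (A : Matrix m n ℂ) (w : p → ℂ)
    (ρ : Matrix n n ℂ) (τ : Matrix p p ℂ) :
    measureKraus A w * (ρ ⊗ₖ τ) * (measureKraus A w)ᴴ =
      (star w ⬝ᵥ (τ *ᵥ w)) • (A * ρ * Aᴴ) := by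
  have h : measureKraus A w * (ρ ⊗ₖ τ) =
      Matrix.of fun o x => (A * ρ) o x.1 * (star w ᵥ* τ) x.2 := by
    ext o x
    simp only [Matrix.mul_apply, measureKraus, Matrix.of_apply, Matrix.kroneckerMap_apply,
      Matrix.vecMul, dotProduct, Finset.sum_mul_sum, Fintype.sum_prod_type, Pi.star_apply]
    refine Finset.sum_congr rfl fun i _ => Finset.sum_congr rfl fun j _ => ?_
    ring
  rw [h, Matrix.dotProduct_mulVec]
  ext o o'
  rw [Matrix.mul_apply, Matrix.smul_apply, Matrix.mul_apply, smul_eq_mul, mul_comm, dotProduct,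
    Finset.sum_mul_sum, Fintype.sum_prod_type]
  refine Finset.sum_congr rfl fun i _ => Finset.sum_congr rfl fun j _ => ?_
  simp only [Matrix.conjTranspose_apply, measureKraus, Matrix.of_apply, star_mul', star_star]
  ring

theorem measureKraus_gram {m n p : Type} [Fintype m] (A : Matrix m n ℂ) (w : p → ℂ) :
    (measureKraus A w)ᴴ * measureKraus A w = (Aᴴ * A) ⊗ₖ Matrix.vecMulVec w (star w) := by
  ext x y
  simp only [Matrix.mul_apply, Matrix.conjTranspose_apply, measureKraus, Matrix.of_apply,
    Matrix.kroneckerMap_apply, Matrix.vecMulVec_apply, Pi.star_apply, star_mul', star_star,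
    Finset.sum_mul]
  refine Finset.sum_congr rfl fun i _ => ?_
  ring

/-- The continuous family of Kraus operators of the channel by which the estimation scheme is a
learning scheme. -/
def retrieveKraus (V : Gate d) :
    Matrix (Fin d × Fin d) ((Fin d × Fin d) × (Fin d × Fin d)) ℂ :=
  measureKraus (twoCopies V) ((Real.sqrt d : ℂ) • ket (V : Matrix (Fin d) (Fin d) ℂ))

theorem continuous_retrieveKraus : Continuous fun V : Gate d => retrieveKraus V := by
  refine continuous_pi fun p => continuous_pi fun q => ?_
  exact (continuous_twoCopies.matrix_elem p q.1).mul
    (continuous_const.mul (continuous_gate.matrix_elem q.2.1 q.2.2)).star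

/-- The completely positive map with a continuous family of Kraus operators. -/
def haarKrausMap {m n : Type} [Fintype n] (K : Gate d → Matrix m n ℂ) (hK : Continuous K) :
    Matrix n n ℂ →ₗ[ℂ] Matrix m m ℂ where
  toFun X := haarAverage fun V => K V * X * (K V)ᴴ
  map_add' X Y := by
    have h : ∀ X : Matrix n n ℂ, ∀ i j,
        Integrable (fun V => (K V * X * (K V)ᴴ) i j) (gateHaar d) := fun X i j =>
      integrable_of_continuous (((hK.matrix_mul continuous_const).matrix_mul
        hK.matrix_conjTranspose).matrix_elem i j)
    ext i j
    simp only [haarAverage, Matrix.of_apply, Matrix.add_apply, Matrix.mul_add, Matrix.add_mul]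
    exact integral_add (h X i j) (h Y i j)
  map_smul' c X := by
    ext i j
    simp only [haarAverage, Matrix.of_apply, Matrix.smul_apply, Matrix.mul_smul, Matrix.smul_mul,
      RingHom.id_apply]
    exact integral_smul c _

theorem isChannel_haarKrausMap {m n : Type} [Fintype m] [Fintype n] [DecidableEq n]
    {K : Gate d → Matrix m n ℂ} (hK : Continuous K)
    (h1 : haarAverage (fun V => (K V)ᴴ * K V) = 1) : IsChannel (haarKrausMap K hK) where
  completelyPositive k X hX := by
    have h : ampliate (haarKrausMap K hK) k X = Matrix.of fun p q =>
        ∫ V, ampliate (krausMap fun _ : Unit => K V) k X p q ∂gateHaar d := by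
      ext p q
      simp only [ampliate, krausMap_apply, Finset.univ_unique, Finset.sum_singleton]
      rfl
    rw [h]
    refine posSemidef_integral (fun p q => ?_) fun V => ?_
    · simp only [ampliate, krausMap_apply, Finset.univ_unique, Finset.sum_singleton]
      exact integrable_of_continuous (((hK.matrix_mul continuous_const).matrix_mul
        hK.matrix_conjTranspose).matrix_elem p.1 q.1)
    · rw [ampliate_krausMap]
      exact Matrix.posSemidef_sum _ fun q _ => hX.mul_mul_conjTranspose_same _
  tracePreserving X := by
    change (haarAverage fun V => K V * X * (K V)ᴴ).trace = _
    rw [trace_haarAverage ((hK.matrix_mul continuous_const).matrix_mul hK.matrix_conjTranspose)]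
    have h2 : ∀ V, (K V * X * (K V)ᴴ).trace = ((K V)ᴴ * K V * X).trace := fun V => by
      rw [Matrix.trace_mul_comm, Matrix.mul_assoc]
    have hc := hK.matrix_conjTranspose.matrix_mul hK
    simp_rw [h2]
    rw [← trace_haarAverage (hc.matrix_mul continuous_const), mul_haarAverage hc, h1,
      Matrix.one_mul]

/-- The measurement of the estimate and the application of `V ⊗ V` are absorbed into a single
channel, with a continuous family of Kraus operators. -/
theorem learning_attained (hd : 2 ≤ d) :
    (if d = 2 then 5 else 6) / (d : ℝ) ^ 4 ∈ learningFidelities d := by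
  have hsd : (Real.sqrt d : ℂ) * Real.sqrt d = d := by
    rw [← Complex.ofReal_mul, Real.mul_self_sqrt (Nat.cast_nonneg d), Complex.ofReal_natCast]
  have hw : ∀ V : Gate d, Matrix.vecMulVec ((Real.sqrt d : ℂ) • ket (V : Matrix (Fin d) (Fin d) ℂ))
      (star ((Real.sqrt d : ℂ) • ket (V : Matrix (Fin d) (Fin d) ℂ))) = estimateDensity V := by
    intro V
    rw [star_smul, Matrix.smul_vecMulVec, Matrix.vecMulVec_smul, smul_smul, RCLike.star_def,
      Complex.conj_ofReal, hsd, estimateDensity, ketbra]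
  refine ⟨d, maxEntangled hd, haarKrausMap retrieveKraus continuous_retrieveKraus,
    isChannel_haarKrausMap _ ?_, ?_⟩
  · have hK : ∀ V : Gate d, (retrieveKraus V)ᴴ * retrieveKraus V =
        (1 : Matrix (Fin d × Fin d) (Fin d × Fin d) ℂ) ⊗ₖ estimateDensity V := by
      intro V
      rw [retrieveKraus, measureKraus_gram, twoCopies, Matrix.conjTranspose_kronecker,
        ← Matrix.mul_kronecker_mul, gate_conjTranspose_mul, Matrix.one_kronecker_one, hw]
    simp_rw [hK]
    refine Eq.trans (b := (1 : Matrix (Fin d × Fin d) (Fin d × Fin d) ℂ) ⊗ₖ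
      haarAverage fun V : Gate d => estimateDensity V) ?_ ?_
    · ext x y
      simp only [haarAverage, Matrix.of_apply, Matrix.kroneckerMap_apply]
      rw [integral_const_mul]
    · rw [haarAverage_estimateDensity hd, Matrix.one_kronecker_one]
  · rw [← averageFidelity_estimate hd]
    congr 1
    funext U ρ
    change _ = haarAverage fun V => retrieveKraus V * _ * (retrieveKraus V)ᴴ
    congr 1
    funext V
    rw [retrieveKraus, measureKraus_mul, krausMap_apply, Finset.univ_unique,
      Finset.sum_singleton, estimateKraus, Matrix.conjTranspose_smul, Matrix.smul_mul,
      Matrix.smul_mul, Matrix.mul_smul, smul_smul, RCLike.star_def, Complex.mul_conj',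
      ← Complex.ofReal_pow, ← trace_estimateDensity_mul hd, ← hw V, Matrix.vecMulVec_mul,
      Matrix.trace_vecMulVec]
    congr 1
    rw [Matrix.dotProduct_mulVec, dotProduct_comm]

end

/-! ### Learning schemes of interaction type -/

section
variable {d : ℕ}

theorem learningFidelities_le (hd : 2 ≤ d) {F : ℝ} (hF : F ∈ learningFidelities d) :
    F ≤ (if d = 2 then 5 else 6) / (d : ℝ) ^ 4 := by
  obtain ⟨k, σ, Λ, hΛ, rfl⟩ := hF
  obtain ⟨K, rfl, hK⟩ := hΛ.exists_kraus
  exact learning_le hd K hK σ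

/-- The Kraus operators of the partial trace of an operator. -/
def traceKraus {m p n : Type} (V : Matrix (m × p) n ℂ) (a : p) : Matrix m n ℂ :=
  Matrix.of fun o x => V (o, a) x

theorem traceSnd_conj {m p n : Type} [Fintype p] [Fintype n] (V : Matrix (m × p) n ℂ)
    (X : Matrix n n ℂ) : traceSnd (V * X * Vᴴ) = krausMap (traceKraus V) X := by
  ext o o'
  simp only [traceSnd, krausMap_apply, Matrix.of_apply, Matrix.sum_apply]
  rfl

theorem sum_traceKraus {m p n : Type} [Fintype m] [Fintype p] (V : Matrix (m × p) n ℂ) :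
    ∑ a, (traceKraus V a)ᴴ * traceKraus V a = Vᴴ * V := by
  ext x y
  simp only [Matrix.sum_apply, Matrix.mul_apply, Fintype.sum_prod_type_right]
  rfl

theorem interactionFidelities_le (hd : 2 ≤ d) {F : ℝ} (hF : F ∈ interactionFidelities d) :
    F ≤ (if d = 2 then 5 else 6) / (d : ℝ) ^ 4 := by
  obtain ⟨k, σ, W, rfl⟩ := hF
  simp_rw [traceSnd_conj]
  refine learning_le hd _ ?_ σ
  rw [sum_traceKraus]
  exact Matrix.mem_unitaryGroup_iff'.mp W.2

/-- An isometry extends to a unitary matrix. -/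
theorem exists_unitary_extension {m n : Type} [Fintype m] [DecidableEq m] [DecidableEq n]
    (V : Matrix m n ℂ) (hV : Vᴴ * V = 1) (f : n → m) (hf : Function.Injective f) :
    ∃ W ∈ Matrix.unitaryGroup m ℂ, ∀ x y, W x (f y) = V x y := by
  let w : n → EuclideanSpace ℂ m := fun y => WithLp.toLp 2 fun x => V x y
  let v : m → EuclideanSpace ℂ m := Function.extend f w 0
  have hin : ∀ y y', inner ℂ (w y) (w y') = if y = y' then (1 : ℂ) else 0 := by
    intro y y'
    have h := congrFun (congrFun hV y) y'
    rw [Matrix.one_apply] at h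
    rw [← h, PiLp.inner_apply, Matrix.mul_apply]
    refine Finset.sum_congr rfl fun x _ => ?_
    simp [w, mul_comm]
  have hv : Orthonormal ℂ ((Set.range f).domRestrict v) := by
    rw [orthonormal_iff_ite]
    rintro ⟨_, y, rfl⟩ ⟨_, y', rfl⟩
    rw [Set.domRestrict_apply, Set.domRestrict_apply]
    simp only [v, hf.extend_apply, hin]
    exact if_congr (Subtype.ext_iff.trans hf.eq_iff).symm rfl rfl
  obtain ⟨b, hb⟩ := hv.exists_orthonormalBasis_extension_of_card_eq (by simp)
  refine ⟨Matrix.of fun x x' => b x' x, ?_, fun x y => ?_⟩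
  · rw [Matrix.mem_unitaryGroup_iff']
    ext x x'
    have h := orthonormal_iff_ite.mp b.orthonormal x x'
    rw [PiLp.inner_apply] at h
    rw [Matrix.one_apply, ← h, Matrix.mul_apply]
    refine Finset.sum_congr rfl fun y _ => ?_
    simp [Matrix.star_apply, mul_comm]
  · rw [Matrix.of_apply, hb _ ⟨y, rfl⟩]
    simp [v, hf.extend_apply, w]

/-- The isometry that attaches the basis vector `q₀` of an ancilla. -/
def attachOp {k k' : ℕ} {r : Type} (e : Fin k' ≃ Fin k × r) (q₀ : r) :
    Matrix (Fin k') (Fin k) ℂ :=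
  Matrix.of fun x y => if x = e.symm (y, q₀) then 1 else 0

theorem attachOp_isometry {k k' : ℕ} {r : Type} (e : Fin k' ≃ Fin k × r) (q₀ : r) :
    (attachOp e q₀)ᴴ * attachOp e q₀ = 1 := by
  ext x y
  rw [Matrix.mul_apply, Matrix.one_apply]
  simp [attachOp, apply_ite star, eq_comm]

/-- Operations on the ancilla commute with the gate. -/
theorem applyGate_conj_one_kronecker {a b : Type} [Fintype a] [DecidableEq a] [Fintype b]
    [DecidableEq b] (U : Gate d) (B : Matrix b a ℂ) (X : Matrix (Fin d × a) (Fin d × a) ℂ) :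
    applyGate U (((1 : Matrix (Fin d) (Fin d) ℂ) ⊗ₖ B) * X *
        ((1 : Matrix (Fin d) (Fin d) ℂ) ⊗ₖ B)ᴴ) =
      ((1 : Matrix (Fin d) (Fin d) ℂ) ⊗ₖ B) * applyGate U X *
        ((1 : Matrix (Fin d) (Fin d) ℂ) ⊗ₖ B)ᴴ := by
  have h : ((U : Matrix (Fin d) (Fin d) ℂ) ⊗ₖ (1 : Matrix b b ℂ)) *
      ((1 : Matrix (Fin d) (Fin d) ℂ) ⊗ₖ B) =
      ((1 : Matrix (Fin d) (Fin d) ℂ) ⊗ₖ B) *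
        ((U : Matrix (Fin d) (Fin d) ℂ) ⊗ₖ (1 : Matrix a a ℂ)) := by
    rw [← Matrix.mul_kronecker_mul, ← Matrix.mul_kronecker_mul, Matrix.one_mul, Matrix.one_mul,
      Matrix.mul_one, Matrix.mul_one]
  have h' := congrArg Matrix.conjTranspose h
  rw [Matrix.conjTranspose_mul, Matrix.conjTranspose_mul] at h'
  rw [applyGate, applyGate, ← Matrix.mul_assoc, ← Matrix.mul_assoc, h]
  simp only [Matrix.mul_assoc]
  rw [h']

/-- Every learning scheme is of interaction type: dilate the retrieving channel to an isometry,
which stores the index of the Kraus operator in an ancilla, and extend it to a unitary. -/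
theorem learning_mem_interactionFidelities {k : ℕ} {r : Type} [Fintype r] [DecidableEq r]
    (K : r → Matrix (Fin d × Fin d) ((Fin d × Fin d) × (Fin d × Fin k)) ℂ)
    (hK : ∑ q, (K q)ᴴ * K q = 1) (σ : DensityMatrix (Fin d × Fin k)) (a₀ : Fin d) (x₀ : Fin k)
    (q₀ : r) :
    averageFidelity d (fun U ρ => krausMap K (ρ ⊗ₖ (σ.evolve U).mat)) ∈
      interactionFidelities d := by
  let e : Fin (Fintype.card (Fin k × r)) ≃ Fin k × r := (Fintype.equivFin _).symm
  let A : Matrix (Fin d × Fin (Fintype.card (Fin k × r))) (Fin d × Fin k) ℂ :=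
    (1 : Matrix (Fin d) (Fin d) ℂ) ⊗ₖ attachOp e q₀
  let V : Matrix ((Fin d × Fin d) × (Fin d × Fin (Fintype.card (Fin k × r))))
      ((Fin d × Fin d) × (Fin d × Fin k)) ℂ := Matrix.of fun p x =>
    if p.2.1 = a₀ ∧ (e p.2.2).1 = x₀ then K (e p.2.2).2 p.1 x else 0
  have hVK : ∀ X, krausMap (traceKraus V) X = krausMap K X := by
    intro X
    rw [krausMap_apply, krausMap_apply, Fintype.sum_prod_type, Finset.sum_eq_single a₀,
      ← e.symm.sum_comp, Fintype.sum_prod_type, Finset.sum_eq_single x₀]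
    · refine Finset.sum_congr rfl fun q _ => ?_
      have : traceKraus V (a₀, e.symm (x₀, q)) = K q := by
        ext o x
        simp [traceKraus, V]
      rw [this]
    · intro x _ hx
      refine Finset.sum_eq_zero fun q _ => ?_
      have : traceKraus V (a₀, e.symm (x, q)) = 0 := by
        ext o y
        simp [traceKraus, V, hx]
      rw [this, Matrix.zero_mul, Matrix.zero_mul]
    · simp
    · intro a _ ha
      refine Finset.sum_eq_zero fun q _ => ?_
      have : traceKraus V (a, q) = 0 := by
        ext o y
        simp [traceKraus, V, ha]
      rw [this, Matrix.zero_mul, Matrix.zero_mul]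
    · simp
  have hV : Vᴴ * V = 1 := by
    rw [← hK]
    ext x y
    rw [Matrix.mul_apply, Fintype.sum_prod_type_right, Fintype.sum_prod_type,
      Finset.sum_eq_single a₀, ← e.symm.sum_comp, Fintype.sum_prod_type, Finset.sum_eq_single x₀,
      Matrix.sum_apply]
    · refine Finset.sum_congr rfl fun q _ => ?_
      rw [Matrix.mul_apply]
      refine Finset.sum_congr rfl fun o _ => ?_
      simp [V]
    · intro x _ hx
      refine Finset.sum_eq_zero fun q _ => Finset.sum_eq_zero fun o _ => ?_
      simp [V, hx]
    · simp
    · intro a _ ha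
      refine Finset.sum_eq_zero fun q _ => Finset.sum_eq_zero fun o _ => ?_
      simp [V, ha]
    · simp
  obtain ⟨W, hW, hWV⟩ := exists_unitary_extension V hV
    (fun x => (x.1, (x.2.1, e.symm (x.2.2, q₀)))) (by
      rintro ⟨i, a, x⟩ ⟨i', a', x'⟩ h
      simpa [Prod.ext_iff] using h)
  have hWA : W * ((1 : Matrix (Fin d × Fin d) (Fin d × Fin d) ℂ) ⊗ₖ A) = V := by
    ext p x
    rw [Matrix.mul_apply, Finset.sum_eq_single (x.1, (x.2.1, e.symm (x.2.2, q₀))), hWV]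
    · simp [A, attachOp]
    · rintro ⟨i, a, y⟩ _ hy
      by_cases hi : i = x.1
      · by_cases ha : a = x.2.1
        · have h1 : y ≠ e.symm (x.2.2, q₀) := fun h => hy (by rw [hi, ha, h])
          simp [A, attachOp, h1]
        · simp [A, ha]
      · simp [hi]
    · simp
  let σ' : DensityMatrix (Fin d × Fin (Fintype.card (Fin k × r))) :=
    { mat := A * σ.mat * Aᴴ
      posSemidef := σ.posSemidef.mul_mul_conjTranspose_same _
      trace_eq_one := by
        rw [Matrix.trace_mul_comm, ← Matrix.mul_assoc, Matrix.conjTranspose_kronecker,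
          ← Matrix.mul_kronecker_mul, attachOp_isometry, Matrix.conjTranspose_one, Matrix.one_mul,
          Matrix.one_kronecker_one, Matrix.one_mul, σ.trace_eq_one] }
  refine ⟨_, σ', ⟨W, hW⟩, ?_⟩
  congr 1
  funext U ρ
  have h1 : (σ'.evolve U).mat = A * (σ.evolve U).mat * Aᴴ :=
    applyGate_conj_one_kronecker U (attachOp e q₀) σ.mat
  have h2 : ρ ⊗ₖ (σ'.evolve U).mat =
      ((1 : Matrix (Fin d × Fin d) (Fin d × Fin d) ℂ) ⊗ₖ A) * (ρ ⊗ₖ (σ.evolve U).mat) *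
        ((1 : Matrix (Fin d × Fin d) (Fin d × Fin d) ℂ) ⊗ₖ A)ᴴ := by
    rw [h1, Matrix.conjTranspose_kronecker (1 : Matrix (Fin d × Fin d) (Fin d × Fin d) ℂ),
      ← Matrix.mul_kronecker_mul, ← Matrix.mul_kronecker_mul, Matrix.conjTranspose_one,
      Matrix.one_mul, Matrix.mul_one]
  have h3 : W * (ρ ⊗ₖ (σ'.evolve U).mat) * Wᴴ = V * (ρ ⊗ₖ (σ.evolve U).mat) * Vᴴ := by
    rw [h2, ← hWA, Matrix.conjTranspose_mul]
    simp only [Matrix.mul_assoc]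
  change _ = traceSnd (W * (ρ ⊗ₖ (σ'.evolve U).mat) * Wᴴ)
  rw [h3, traceSnd_conj, hVK]

theorem interaction_attained (hd : 2 ≤ d) :
    (if d = 2 then 5 else 6) / (d : ℝ) ^ 4 ∈ interactionFidelities d := by
  let z : Fin d := ⟨0, by omega⟩
  obtain ⟨k, σ, Λ, hΛ, h⟩ := learning_attained hd
  obtain ⟨K, rfl, hK⟩ := hΛ.exists_kraus
  have hx : Nonempty (Fin k) := by
    by_contra hk
    rw [not_nonempty_iff] at hk
    have := σ.trace_eq_one
    simp [Matrix.trace] at this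
  obtain ⟨x⟩ := hx
  rw [h]
  exact learning_mem_interactionFidelities K hK σ z x ((z, z), ((z, z), (z, x)))

/-! ### Comparison of learning and cloning -/

theorem learning_lt_cloning (hd : 2 ≤ d) :
    (if d = 2 then 5 else 6) / (d : ℝ) ^ 4 < (d + Real.sqrt ((d : ℝ) ^ 2 - 1)) / (d : ℝ) ^ 3 := by
  have hd0 : (0 : ℝ) < d := by exact_mod_cast (by omega : 0 < d)
  have hd2 : (2 : ℝ) ≤ d := by exact_mod_cast hd
  have h1 : (1 : ℝ) < Real.sqrt ((d : ℝ) ^ 2 - 1) := by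
    rw [Real.lt_sqrt one_pos.le]
    nlinarith
  have h2 : (if d = 2 then 5 else 6 : ℝ) < d * (d + Real.sqrt ((d : ℝ) ^ 2 - 1)) := by
    split_ifs with h
    · nlinarith
    · have h3 : (3 : ℝ) ≤ d := by exact_mod_cast (by omega : 3 ≤ d)
      nlinarith
  rw [div_lt_div_iff₀ (by positivity) (by positivity)]
  calc _ < d * (d + Real.sqrt ((d : ℝ) ^ 2 - 1)) * (d : ℝ) ^ 3 :=
        mul_lt_mul_of_pos_right h2 (by positivity)
    _ = _ := by ring

/-- Cloning the state `|U⟩⟨U| / d` and then programming a channel is a learning scheme whose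
retrieving channel is the composite. -/
theorem stateCloningFidelities_le (hd : 2 ≤ d) {F : ℝ} (hF : F ∈ stateCloningFidelities d) :
    F ≤ (if d = 2 then 5 else 6) / (d : ℝ) ^ 4 := by
  obtain ⟨Ξ, Λ, hΞ, hΛ, rfl⟩ := hF
  obtain ⟨K, rfl, hK⟩ := hΞ.exists_kraus
  obtain ⟨L, rfl, hL⟩ := hΛ.exists_kraus
  let M : (_ × _) → Matrix (Fin d × Fin d) ((Fin d × Fin d) × (Fin d × Fin d)) ℂ := fun q =>
    L q.1 * ((1 : Matrix (Fin d × Fin d) (Fin d × Fin d) ℂ) ⊗ₖ K q.2)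
  have hM : ∑ q, (M q)ᴴ * M q = 1 := by
    rw [Fintype.sum_prod_type_right]
    have h : ∀ t, ∑ q, (M (q, t))ᴴ * M (q, t) =
        (1 : Matrix (Fin d × Fin d) (Fin d × Fin d) ℂ) ⊗ₖ ((K t)ᴴ * K t) := by
      intro t
      have h1 : ∀ q, (M (q, t))ᴴ * M (q, t) =
          ((1 : Matrix (Fin d × Fin d) (Fin d × Fin d) ℂ) ⊗ₖ K t)ᴴ * ((L q)ᴴ * L q) *
            ((1 : Matrix (Fin d × Fin d) (Fin d × Fin d) ℂ) ⊗ₖ K t) := fun q => by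
        simp only [M, Matrix.conjTranspose_mul, Matrix.mul_assoc]
      simp_rw [h1]
      rw [← Matrix.sum_mul, ← Matrix.mul_sum, hL, Matrix.mul_one, Matrix.conjTranspose_kronecker,
        ← Matrix.mul_kronecker_mul, Matrix.conjTranspose_one, Matrix.one_mul]
    simp_rw [h]
    refine Eq.trans (b := (1 : Matrix (Fin d × Fin d) (Fin d × Fin d) ℂ) ⊗ₖ
      ∑ t, (K t)ᴴ * K t) ?_ ?_
    · ext x y
      simp [Matrix.sum_apply, Finset.mul_sum]
    · rw [hK, Matrix.one_kronecker_one]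
  refine le_of_eq_of_le ?_ (learning_le hd M hM (maxEntangled hd))
  congr 1
  funext U ρ
  rw [maxEntangled_evolve, krausMap_apply, krausMap_apply, krausMap_apply M,
    Fintype.sum_prod_type (f := fun q => M q * _ * _)]
  refine Finset.sum_congr rfl fun q _ => ?_
  have h : ∀ τ : Matrix (Fin d × Fin d) (Fin d × Fin d) ℂ, ρ ⊗ₖ (∑ t, K t * τ * (K t)ᴴ) =
      ∑ t, ((1 : Matrix (Fin d × Fin d) (Fin d × Fin d) ℂ) ⊗ₖ K t) * (ρ ⊗ₖ τ) *
        ((1 : Matrix (Fin d × Fin d) (Fin d × Fin d) ℂ) ⊗ₖ K t)ᴴ := by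
    intro τ
    simp only [Matrix.conjTranspose_kronecker, ← Matrix.mul_kronecker_mul,
      Matrix.conjTranspose_one, Matrix.one_mul, Matrix.mul_one]
    ext x y
    simp [Matrix.sum_apply, Finset.mul_sum]
  rw [h, Matrix.mul_sum, Matrix.sum_mul]
  refine Finset.sum_congr rfl fun t _ => ?_
  simp only [M, Matrix.conjTranspose_mul, Matrix.mul_assoc]

end

/-! ### Measure-and-prepare schemes -/

section
variable {d : ℕ}

/-- The map that performs the channel with Kraus operators `N j` when a measurement with effects
`∑ t, |v j t⟩⟨v j t|` has the outcome `j`. -/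
theorem krausMap_measureKraus {ι q s m n p : Type} [Fintype ι] [Fintype q] [Fintype s] [Fintype n]
    [Fintype p] (N : ι → q → Matrix m n ℂ) (v : ι → s → p → ℂ) (E : ι → Matrix p p ℂ)
    (hE : ∀ j a b, E j a b = ∑ t, v j t a * star (v j t b)) (ρ : Matrix n n ℂ)
    (τ : Matrix p p ℂ) :
    krausMap (fun x : ι × q × s => measureKraus (N x.1 x.2.1) (v x.1 x.2.2)) (ρ ⊗ₖ τ) =
      ∑ j, (E j * τ).trace • krausMap (N j) ρ := by
  have h : ∀ j, (E j * τ).trace = ∑ t, star (v j t) ⬝ᵥ (τ *ᵥ v j t) := by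
    intro j
    have h1 : E j = ∑ t, Matrix.vecMulVec (v j t) (star (v j t)) := by
      ext a b
      simp [hE, Matrix.sum_apply, Matrix.vecMulVec_apply]
    rw [h1, Matrix.sum_mul, Matrix.trace_sum]
    refine Finset.sum_congr rfl fun t _ => ?_
    rw [Matrix.vecMulVec_mul, Matrix.trace_vecMulVec, Matrix.dotProduct_mulVec, dotProduct_comm]
  rw [krausMap_apply, Fintype.sum_prod_type]
  refine Finset.sum_congr rfl fun j _ => ?_
  simp only [measureKraus_mul, Fintype.sum_prod_type]
  rw [h, krausMap_apply, Finset.sum_comm, Finset.sum_smul]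
  simp only [Finset.smul_sum]

theorem sum_measureKraus_gram {ι q s m n p : Type} [Fintype ι] [Fintype q] [Fintype s] [Fintype m]
    [Fintype n] [DecidableEq n] [Fintype p] [DecidableEq p]
    (N : ι → q → Matrix m n ℂ) (hN : ∀ j, ∑ t, (N j t)ᴴ * N j t = 1) (v : ι → s → p → ℂ)
    (E : ι → Matrix p p ℂ) (hE : ∀ j a b, E j a b = ∑ t, v j t a * star (v j t b))
    (hE1 : ∑ j, E j = 1) :
    ∑ x : ι × q × s, (measureKraus (N x.1 x.2.1) (v x.1 x.2.2))ᴴ *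
      measureKraus (N x.1 x.2.1) (v x.1 x.2.2) = 1 := by
  ext x y
  have h : ∀ j, ∑ t, ∑ u, ((measureKraus (N j t) (v j u))ᴴ * measureKraus (N j t) (v j u)) x y =
      (1 : Matrix n n ℂ) x.1 y.1 * E j x.2 y.2 := by
    intro j
    simp only [measureKraus_gram, Matrix.kroneckerMap_apply, ← Finset.mul_sum, ← Finset.sum_mul,
      hE, ← hN j, Matrix.sum_apply, Matrix.vecMulVec_apply, Pi.star_apply]
  simp only [Matrix.sum_apply, Fintype.sum_prod_type, h]
  rw [← Finset.mul_sum, ← Matrix.sum_apply, hE1, ← Matrix.one_kronecker_one,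
    Matrix.kroneckerMap_apply]

theorem gateFidelity_sum_smul {ι : Type} [Fintype ι] (U : Gate d) (c : ι → ℂ)
    (hc : ∀ j, (c j).im = 0)
    (Φ : ι → Matrix (Fin d × Fin d) (Fin d × Fin d) ℂ → Matrix (Fin d × Fin d) (Fin d × Fin d) ℂ) :
    gateFidelity U (fun ρ => ∑ j, c j • Φ j ρ) = ∑ j, (c j).re * gateFidelity U (Φ j) := by
  have h : choi (fun ρ => ∑ j, c j • Φ j ρ) = ∑ j, c j • choi (Φ j) := by
    ext p q
    simp [choi, Matrix.sum_apply]
  simp only [gateFidelity]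
  rw [h, Matrix.sum_mul, Matrix.trace_sum, Complex.re_sum, Finset.sum_div]
  refine Finset.sum_congr rfl fun j _ => ?_
  rw [Matrix.smul_mul, Matrix.trace_smul, smul_eq_mul, Complex.mul_re, hc]
  ring

theorem norm_twoCopies_le (U : Gate d) (p q : Fin d × Fin d) : ‖twoCopies U p q‖ ≤ 1 := by
  rw [twoCopies, Matrix.kroneckerMap_apply, norm_mul]
  exact mul_le_one₀ (entry_norm_bound_of_unitary U.2 _ _) (norm_nonneg _)
    (entry_norm_bound_of_unitary U.2 _ _)

/-- The fidelity is Lipschitz in the Choi operator. -/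
theorem gateFidelity_le_add (hd : 2 ≤ d) (U : Gate d) {δ : ℝ}
    {Φ Ψ : Matrix (Fin d × Fin d) (Fin d × Fin d) ℂ → Matrix (Fin d × Fin d) (Fin d × Fin d) ℂ}
    (h : ∀ p q, ‖choi Φ p q - choi Ψ p q‖ ≤ δ) :
    gateFidelity U Φ ≤ gateFidelity U Ψ + (d : ℝ) ^ 4 * δ := by
  have hd0 : (0 : ℝ) < d := by exact_mod_cast (by omega : 0 < d)
  have h1 : ∀ p q, ‖(choi Φ p q - choi Ψ p q) * ketbra (ket (twoCopies U)) q p‖ ≤ δ := by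
    intro p q
    have h2 : ‖ketbra (ket (twoCopies U)) q p‖ ≤ 1 := by
      rw [ketbra, Matrix.vecMulVec_apply, Pi.star_apply, norm_mul, norm_star]
      exact mul_le_one₀ (norm_twoCopies_le U _ _) (norm_nonneg _) (norm_twoCopies_le U _ _)
    rw [norm_mul]
    exact (mul_le_of_le_one_right (norm_nonneg _) h2).trans (h p q)
  have h3 : (choi Φ * ketbra (ket (twoCopies U))).trace.re -
      (choi Ψ * ketbra (ket (twoCopies U))).trace.re ≤ (d : ℝ) ^ 8 * δ := by
    rw [← Complex.sub_re, ← Matrix.trace_sub, ← Matrix.sub_mul]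
    refine (Complex.re_le_norm _).trans ?_
    simp only [Matrix.trace, Matrix.diag_apply, Matrix.mul_apply, Matrix.sub_apply]
    refine (norm_sum_le_of_le _ fun p _ => norm_sum_le_of_le _ fun q _ => h1 p q).trans ?_
    simp only [Finset.sum_const, Finset.card_univ, Fintype.card_prod, Fintype.card_fin,
      nsmul_eq_mul]
    push_cast
    apply le_of_eq
    ring
  rw [gateFidelity, gateFidelity, ← sub_le_iff_le_add', ← sub_div, div_le_iff₀ (by positivity)]
  refine h3.trans (le_of_eq ?_)
  ring

/-- A positive semidefinite matrix has entries bounded by its trace. -/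
theorem choi_norm_le {Φ : Matrix (Fin d × Fin d) (Fin d × Fin d) ℂ →ₗ[ℂ]
      Matrix (Fin d × Fin d) (Fin d × Fin d) ℂ} (hΦ : IsChannel Φ)
    (p q : (Fin d × Fin d) × (Fin d × Fin d)) : ‖choi Φ p q‖ ≤ (d : ℝ) ^ 2 := by
  obtain ⟨v, hv⟩ := posSemidef_exists_sum (choi_posSemidef hΦ)
  have h1 : ∑ p, ∑ r, ‖v r p‖ ^ 2 = (d : ℝ) ^ 2 := by
    have h2 : (choi Φ).trace = (d : ℂ) ^ 2 := by
      have h3 : (choi Φ).trace = ∑ i, (Φ (Matrix.single i i 1)).trace := by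
        simp only [Matrix.trace, Matrix.diag_apply, choi, Matrix.of_apply,
          Fintype.sum_prod_type_right (α₂ := Fin d × Fin d) (α₁ := Fin d × Fin d)]
      simp only [h3, hΦ.tracePreserving, Matrix.trace_single_eq_same]
      simp [sq]
    have h4 : (choi Φ).trace = ((∑ p, ∑ r, ‖v r p‖ ^ 2 : ℝ) : ℂ) := by
      push_cast
      simp only [Matrix.trace, Matrix.diag_apply, hv]
      refine Finset.sum_congr rfl fun p _ => Finset.sum_congr rfl fun r _ => ?_
      rw [RCLike.star_def, Complex.mul_conj']
    rw [h4] at h2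
    exact_mod_cast h2
  have h5 : ∀ p, ∑ r, ‖v r p‖ ^ 2 ≤ (d : ℝ) ^ 2 := fun p => by
    rw [← h1]
    exact Finset.single_le_sum (f := fun p => ∑ r, ‖v r p‖ ^ 2)
      (fun p _ => Finset.sum_nonneg fun r _ => by positivity) (Finset.mem_univ p)
  rw [hv]
  refine (norm_sum_le _ _).trans ?_
  have h6 : ∀ r, ‖v r p * star (v r q)‖ ≤ (‖v r p‖ ^ 2 + ‖v r q‖ ^ 2) / 2 := by
    intro r
    rw [norm_mul, norm_star]
    nlinarith [sq_nonneg (‖v r p‖ - ‖v r q‖)]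
  refine (Finset.sum_le_sum fun r _ => h6 r).trans ?_
  rw [← Finset.sum_div, Finset.sum_add_distrib]
  linarith [h5 p, h5 q]

theorem linearMap_apply_eq_sum {m n : Type} [Fintype n] [DecidableEq n]
    (Φ : Matrix n n ℂ →ₗ[ℂ] Matrix m m ℂ) (ρ : Matrix n n ℂ) (i j : m) :
    Φ ρ i j = ∑ a, ∑ b, ρ a b * choi Φ (i, a) (j, b) := by
  conv_lhs => rw [Matrix.matrix_eq_sum_single ρ]
  simp only [map_sum, Matrix.sum_apply]
  refine Finset.sum_congr rfl fun a _ => Finset.sum_congr rfl fun b _ => ?_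
  have : Matrix.single a b (ρ a b) = ρ a b • Matrix.single a b (1 : ℂ) := by simp
  rw [this, map_smul, Matrix.smul_apply, smul_eq_mul, choi, Matrix.of_apply]

/-- A bounded measurable function with finitely many complex components is approximated uniformly by
its values at finitely many points. -/
theorem exists_measurable_approx {Ω ι : Type} [MeasurableSpace Ω] [Fintype ι] {h : Ω → ι → ℂ}
    (hm : ∀ i, Measurable fun x => h x i) {R : ℝ} (hR : ∀ x i, ‖h x i‖ ≤ R) (hR0 : 0 ≤ R)
    {δ : ℝ} (hδ : 0 < δ) :
    ∃ (n : ℕ) (y : Fin n → Ω) (π : Ω → Fin n), Measurable π ∧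
      ∀ x i, ‖h x i - h (y (π x)) i‖ ≤ δ := by
  have hb : TotallyBounded (Set.range h) := by
    refine (isCompact_closedBall (0 : ι → ℂ) R).totallyBounded.subset ?_
    rintro _ ⟨x, rfl⟩
    rw [mem_closedBall_zero_iff, pi_norm_le_iff_of_nonneg hR0]
    exact hR x
  obtain ⟨t, ht, hfin, hcov⟩ := Metric.finite_approx_of_totallyBounded hb δ hδ
  let e := hfin.toFinset.equivFin.symm
  have hex : ∀ k, ∃ x, h x = (e k : ι → ℂ) := fun k => ht (hfin.mem_toFinset.mp (e k).2)
  choose y hy using hex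
  have hp : ∀ x, ∃ k : ℕ, ∃ hk : k < _, dist (h x) (h (y ⟨k, hk⟩)) < δ := by
    intro x
    obtain ⟨z, hz, hxz⟩ := Set.mem_iUnion₂.mp (hcov ⟨x, rfl⟩)
    refine ⟨(e.symm ⟨z, hfin.mem_toFinset.mpr hz⟩).1, (e.symm ⟨z, hfin.mem_toFinset.mpr hz⟩).2, ?_⟩
    rw [hy, Fin.eta, Equiv.apply_symm_apply]
    exact hxz
  have hmh : Measurable h := measurable_pi_iff.mpr hm
  classical
  have hmf : Measurable fun x => Nat.find (hp x) := by
    refine measurable_find hp fun k => ?_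
    by_cases hk : k < hfin.toFinset.card
    · simp only [hk, exists_true_left]
      exact measurableSet_lt (hmh.dist measurable_const) measurable_const
    · simp [hk]
  refine ⟨_, y, fun x => ⟨Nat.find (hp x), (Nat.find_spec (hp x)).1⟩, ?_, fun x i => ?_⟩
  · refine measurable_to_countable' fun k => ?_
    have : (fun x => (⟨Nat.find (hp x), (Nat.find_spec (hp x)).1⟩ : Fin _)) ⁻¹' {k} =
        (fun x => Nat.find (hp x)) ⁻¹' {k.1} := by
      ext x
      simp [Fin.ext_iff]
    rw [this]
    exact hmf (measurableSet_singleton _)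
  · have h1 := (Nat.find_spec (hp x)).2
    rw [← dist_eq_norm]
    exact (dist_le_pi_dist _ _ i).trans h1.le

instance POVM.isProbabilityMeasure_law {Ω : Type} [MeasurableSpace Ω] {n : Type} [Fintype n]
    [DecidableEq n] (P : POVM Ω n) (τ : DensityMatrix n) : IsProbabilityMeasure (P.law τ) :=
  ⟨by rw [P.law_apply τ MeasurableSet.univ, P.effect_univ, Matrix.one_mul, τ.trace_eq_one]; simp⟩

theorem POVM.trace_effect_im {Ω : Type} [MeasurableSpace Ω] {n : Type} [Fintype n] [DecidableEq n]
    (P : POVM Ω n) (τ : DensityMatrix n) (s : Set Ω) : (P.effect s * τ.mat).trace.im = 0 := by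
  have h : star (P.effect s * τ.mat).trace = (P.effect s * τ.mat).trace := by
    rw [← Matrix.trace_conjTranspose, Matrix.conjTranspose_mul, (P.posSemidef s).isHermitian,
      τ.posSemidef.isHermitian, Matrix.trace_mul_comm]
  exact Complex.conj_eq_iff_im.mp h

theorem continuous_gateFidelity_learning {k : ℕ} {r : Type} [Fintype r]
    (K : r → Matrix (Fin d × Fin d) ((Fin d × Fin d) × (Fin d × Fin k)) ℂ)
    (σ : DensityMatrix (Fin d × Fin k)) :
    Continuous fun U => gateFidelity U (fun ρ => krausMap K (ρ ⊗ₖ (σ.evolve U).mat)) := by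
  have h1 : Continuous fun U : Gate d => (σ.evolve U).mat := by
    have hG : Continuous fun U : Gate d =>
        (U : Matrix (Fin d) (Fin d) ℂ) ⊗ₖ (1 : Matrix (Fin k) (Fin k) ℂ) :=
      continuous_pi fun p => continuous_pi fun q =>
        (continuous_gate.matrix_elem _ _).mul continuous_const
    exact (hG.matrix_mul continuous_const).matrix_mul hG.matrix_conjTranspose
  have h2 : ∀ ρ : Matrix (Fin d × Fin d) (Fin d × Fin d) ℂ,
      Continuous fun U => krausMap K (ρ ⊗ₖ (σ.evolve U).mat) := by
    intro ρ
    have h3 : Continuous fun U => ρ ⊗ₖ (σ.evolve U).mat :=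
      continuous_pi fun p => continuous_pi fun q => continuous_const.mul (h1.matrix_elem _ _)
    simp only [krausMap_apply]
    exact continuous_finsetSum _ fun q _ =>
      (continuous_const.matrix_mul h3).matrix_mul continuous_const
  have h4 : Continuous fun U => choi (fun ρ => krausMap K (ρ ⊗ₖ (σ.evolve U).mat)) :=
    continuous_pi fun p => continuous_pi fun q => (h2 _).matrix_elem _ _
  have h5 : Continuous fun U : Gate d => ketbra (ket (twoCopies U)) :=
    continuous_pi fun p => continuous_pi fun q =>
      (continuous_twoCopies.matrix_elem _ _).mul (continuous_twoCopies.matrix_elem _ _).star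
  exact (Complex.continuous_re.comp (h4.matrix_mul h5).matrix_trace).div_const _

/-- Up to an arbitrarily small error, the prepared channel takes finitely many values, so that only a
measurement with finitely many outcomes is needed. Such a scheme is a learning scheme with an
explicit Kraus family. -/
theorem exists_learning_approx (hd : 2 ≤ d) {k : ℕ} (σ : DensityMatrix (Fin d × Fin k)) {Ω : Type}
    [MeasurableSpace Ω] (P : POVM Ω (Fin d × Fin k))
    {C : Ω → Matrix (Fin d × Fin d) (Fin d × Fin d) ℂ →ₗ[ℂ]
      Matrix (Fin d × Fin d) (Fin d × Fin d) ℂ}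
    (hC : ∀ x, IsChannel (C x)) (hCm : ∀ ρ i j, Measurable fun x => C x ρ i j) {ε : ℝ}
    (hε : 0 < ε) :
    ∃ (n : ℕ) (K : Fin n × ((Fin d × Fin d) × (Fin d × Fin d)) × (Fin d × Fin k) →
        Matrix (Fin d × Fin d) ((Fin d × Fin d) × (Fin d × Fin k)) ℂ),
      ∑ q, (K q)ᴴ * K q = 1 ∧ ∀ U, ‖gateFidelity U
        (measurePrepareMap P (fun x => C x) (σ.evolve U)) -
          gateFidelity U (fun ρ => krausMap K (ρ ⊗ₖ (σ.evolve U).mat))‖ ≤ ε := by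
  have hd0 : (0 : ℝ) < d := by exact_mod_cast (by omega : 0 < d)
  obtain ⟨n, y, π, hπ, hy⟩ := exists_measurable_approx
    (h := fun x (p : ((Fin d × Fin d) × (Fin d × Fin d)) × ((Fin d × Fin d) × (Fin d × Fin d))) =>
      choi (C x) p.1 p.2)
    (fun p => hCm _ _ _) (fun x p => choi_norm_le (hC x) p.1 p.2) (by positivity)
    (δ := ε / (d : ℝ) ^ 4) (by positivity)
  choose N hN hN1 using fun j => (hC (y j)).exists_kraus
  choose v hv using fun j => posSemidef_exists_sum (P.posSemidef (π ⁻¹' {j}))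
  have hE1 : ∑ j, P.effect (π ⁻¹' {j}) = 1 := by
    rw [← P.effect_univ, ← VectorMeasure.of_biUnion_finset]
    · congr 1
      ext x
      simp
    · intro i _ j _ hij
      exact Disjoint.preimage π (Set.disjoint_singleton.mpr hij)
    · exact fun j _ => hπ (measurableSet_singleton j)
  set K := fun x : Fin n × _ × _ => measureKraus (N x.1 x.2.1) (v x.1 x.2.2) with hK
  have hC2 : ∀ U ρ i j, Integrable (fun x => C x ρ i j) (P.law (σ.evolve U)) := by
    intro U ρ i j
    simp only [linearMap_apply_eq_sum (C _) ρ i j]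
    refine integrable_finsetSum _ fun a _ => integrable_finsetSum _ fun b _ =>
      Integrable.const_mul ?_ _
    exact Integrable.of_bound (hCm _ _ _).aestronglyMeasurable _
      (Filter.Eventually.of_forall fun x => choi_norm_le (hC x) _ _)
  refine ⟨n, K, sum_measureKraus_gram N hN1 v _ hv hE1, fun U => ?_⟩
  have h1 : gateFidelity U (measurePrepareMap P (fun x => C x) (σ.evolve U)) =
      ∫ x, gateFidelity U (C x) ∂P.law (σ.evolve U) :=
    gateFidelity_integral U (hC2 U)
  have h2 : gateFidelity U (fun ρ => krausMap K (ρ ⊗ₖ (σ.evolve U).mat)) =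
      ∫ x, gateFidelity U (C (y (π x))) ∂P.law (σ.evolve U) := by
    have h3 : (fun ρ => krausMap K (ρ ⊗ₖ (σ.evolve U).mat)) = fun ρ =>
        ∑ j, (P.effect (π ⁻¹' {j}) * (σ.evolve U).mat).trace • C (y j) ρ := by
      funext ρ
      rw [hK, krausMap_measureKraus N v _ hv]
      simp_rw [← hN]
    rw [h3, gateFidelity_sum_smul U _ (fun j => P.trace_effect_im _ _),
      ← integral_map (f := fun j => gateFidelity U (C (y j))) hπ.aemeasurable
        (measurable_of_finite _).aestronglyMeasurable, integral_fintype]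
    · refine Finset.sum_congr rfl fun j _ => ?_
      rw [smul_eq_mul, measureReal_def, Measure.map_apply hπ (measurableSet_singleton j),
        P.law_apply _ (hπ (measurableSet_singleton j)), ENNReal.toReal_ofReal
        (trace_mul_re_nonneg (P.posSemidef _) (σ.evolve U).posSemidef)]
    · have := Measure.isProbabilityMeasure_map (μ := P.law (σ.evolve U)) hπ.aemeasurable
      exact Integrable.of_finite
  have hint : Integrable (fun x => gateFidelity U (C (y (π x)))) (P.law (σ.evolve U)) := by
    refine ((Integrable.of_finite (μ := (P.law (σ.evolve U)).map π)
      (f := fun j => gateFidelity U (C (y j))))).comp_measurable hπ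
  rw [h1, h2, ← integral_sub (integrable_gateFidelity U (hC2 U)) hint]
  refine (norm_integral_le_of_norm_le_const (C := ε) (Filter.Eventually.of_forall fun x => ?_)).trans
    (by simp)
  have h3 := gateFidelity_le_add hd U (Φ := C x) (Ψ := C (y (π x))) fun p q => hy x (p, q)
  have h4 := gateFidelity_le_add hd U (Φ := C (y (π x))) (Ψ := C x) fun p q => by
    rw [norm_sub_rev]
    exact hy x (p, q)
  rw [mul_div_cancel₀ _ (by positivity)] at h3 h4
  rw [Real.norm_eq_abs, abs_sub_le_iff]
  exact ⟨by linarith, by linarith⟩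

theorem measurePrepareFidelities_le (hd : 2 ≤ d) {F : ℝ} (hF : F ∈ measurePrepareFidelities d) :
    F ≤ (if d = 2 then 5 else 6) / (d : ℝ) ^ 4 := by
  obtain ⟨k, σ, Ω, _, P, C, hC, hCm, rfl⟩ := hF
  -- The fidelity is a uniform limit of continuous functions of the gate, hence integrable.
  have hcont : Continuous fun U => gateFidelity U
      (measurePrepareMap P (fun x => C x) (σ.evolve U)) := by
    refine continuous_of_uniform_approx_of_continuous fun u hu => ?_
    obtain ⟨ε, hε, hu⟩ := Metric.mem_uniformity_dist.mp hu
    obtain ⟨n, K, -, h⟩ := exists_learning_approx hd σ P hC hCm (half_pos hε)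
    refine ⟨_, continuous_gateFidelity_learning K σ, fun U => hu ?_⟩
    rw [dist_eq_norm]
    exact (h U).trans_lt (half_lt_self hε)
  refine le_of_forall_pos_le_add fun ε hε => ?_
  obtain ⟨n, K, hK, h⟩ := exists_learning_approx hd σ P hC hCm hε
  have h1 : ∫ U, (gateFidelity U (fun ρ => krausMap K (ρ ⊗ₖ (σ.evolve U).mat)) + ε)
      ∂gateHaar d = averageFidelity d (fun U ρ => krausMap K (ρ ⊗ₖ (σ.evolve U).mat)) + ε := by
    rw [integral_add (integrable_of_continuous (continuous_gateFidelity_learning K σ))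
      (integrable_const _)]
    simp [averageFidelity]
  calc averageFidelity d (fun U => measurePrepareMap P (fun x => C x) (σ.evolve U))
      ≤ averageFidelity d (fun U ρ => krausMap K (ρ ⊗ₖ (σ.evolve U).mat)) + ε := by
        rw [← h1]
        refine integral_mono (integrable_of_continuous hcont) ((integrable_of_continuous
          (continuous_gateFidelity_learning K σ)).add (integrable_const _)) fun U => ?_
        have := (le_abs_self _).trans (h U)
        exact sub_le_iff_le_add'.mp this
    _ ≤ _ := by
        gcongr
        exact learning_le hd K hK σ

theorem estimation_subset_measurePrepare : estimationFidelities d ⊆ measurePrepareFidelities d := by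
  rintro F ⟨k, σ, P, rfl⟩
  refine ⟨k, σ, Gate d, inferInstance, P, fun V => krausMap fun _ : Unit => twoCopies V,
    fun V => isChannel_krausMap ?_, fun ρ i j => ?_, ?_⟩
  · rw [Finset.univ_unique, Finset.sum_singleton, twoCopies, Matrix.conjTranspose_kronecker,
      ← Matrix.mul_kronecker_mul, gate_conjTranspose_mul, Matrix.one_kronecker_one]
  · simp only [krausMap_apply, Finset.univ_unique, Finset.sum_singleton]
    exact (((continuous_twoCopies.matrix_mul continuous_const).matrix_mul
      continuous_twoCopies.matrix_conjTranspose).matrix_elem i j).measurable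
  · have h : ∀ V : Gate d, ⇑(krausMap fun _ : Unit => twoCopies V) =
        fun ρ => twoCopies V * ρ * (twoCopies V)ᴴ := fun V => by
      funext ρ
      simp [krausMap_apply]
    simp only [h]

end
end
end QuantumLearning

theorem mainTheorem2 (d : ℕ) (hd : 2 ≤ d) :
    IsGreatest (QuantumLearning.learningFidelities d)
      (if d = 2 then 5 / (d : ℝ) ^ 4 else 6 / (d : ℝ) ^ 4) ∧
    IsGreatest (QuantumLearning.interactionFidelities d)
      (if d = 2 then 5 / (d : ℝ) ^ 4 else 6 / (d : ℝ) ^ 4) ∧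
    IsGreatest (QuantumLearning.measurePrepareFidelities d)
      (if d = 2 then 5 / (d : ℝ) ^ 4 else 6 / (d : ℝ) ^ 4) ∧
    IsGreatest (QuantumLearning.estimationFidelities d)
      (if d = 2 then 5 / (d : ℝ) ^ 4 else 6 / (d : ℝ) ^ 4) ∧
    IsGreatest (QuantumLearning.cloningFidelities d)
      (((d : ℝ) + Real.sqrt ((d : ℝ) ^ 2 - 1)) / (d : ℝ) ^ 3) ∧
    (∀ F ∈ QuantumLearning.learningFidelities d,
      F < ((d : ℝ) + Real.sqrt ((d : ℝ) ^ 2 - 1)) / (d : ℝ) ^ 3) ∧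
    (∀ F ∈ QuantumLearning.stateCloningFidelities d,
      F < ((d : ℝ) + Real.sqrt ((d : ℝ) ^ 2 - 1)) / (d : ℝ) ^ 3) := by
  have h : (if d = 2 then 5 / (d : ℝ) ^ 4 else 6 / (d : ℝ) ^ 4) =
      (if d = 2 then 5 else 6) / (d : ℝ) ^ 4 := by split_ifs <;> rfl
  rw [h]
  exact ⟨⟨QuantumLearning.learning_attained hd, fun _ => QuantumLearning.learningFidelities_le hd⟩,
    ⟨QuantumLearning.interaction_attained hd, fun _ => QuantumLearning.interactionFidelities_le hd⟩,
    ⟨QuantumLearning.estimation_subset_measurePrepare (QuantumLearning.estimation_attained hd),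
      fun _ => QuantumLearning.measurePrepareFidelities_le hd⟩,
    ⟨QuantumLearning.estimation_attained hd, fun _ hF => QuantumLearning.measurePrepareFidelities_le
      hd (QuantumLearning.estimation_subset_measurePrepare hF)⟩,
    ⟨QuantumLearning.cloning_attained hd, fun _ => QuantumLearning.cloningFidelities_le hd⟩,
    fun _ hF => (QuantumLearning.learningFidelities_le hd hF).trans_lt
      (QuantumLearning.learning_lt_cloning hd),
    fun _ hF => (QuantumLearning.stateCloningFidelities_le hd hF).trans_lt
      (QuantumLearning.learning_lt_cloning hd)⟩
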